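/- Consider $n\ge 2$ bidders and one unit of an infinitely divisible good. Bidder $i$ has a private valuation $\eta_i>0$ per unit and a private budget $\beta_i>0$, and reports a valuation $v_i>0$ and a budget $B_i>0$. If she receives quantity $X_i$ and pays $P_i$, her utility is $u_i=\eta_iX_i-P_i$ if $P_i\le\beta_i$, and $u_i=-\infty$ if $P_i>\beta_i$. The adaptive clinching auction is the following process in time $t\ge 0$ with a unit price $p(t)$, quantities $x_i(t)$ allocated so far, amounts $P_i(t)$ extracted so far, effective budgets $b_i(t)$ and supply $S(t)=1-\sum_i x_i(t)$, all continuous up to the stopping time; $p(0)=x_i(0)=P_i(0)=0$, $b_i(0)=B_i$. Write $D_i(t)=b_i(t)/p(t)$ (equal to $+\infty$ if $p(t)=0<b_i(t)$), $A(t)=\{i: v_i>p(t),\,b_i(t)>0\}$, $E(t)=\{i: v_i=p(t),\,b_i(t)>0\}$, $C(t)=\{i\in A(t): S(t)=\sum_{j\ne i}D_j(t)\}$. Derivatives below are right derivatives; those not mentioned are $0$. (I) The process stops at the first time $f$ with $\sum_{i\in A(f)}D_i(f)\le S(f)$. Then, at unit price $p(f)$ and within the remaining effective budgets, a total of $\sum_{i\in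 A(f)}D_i(f)$ is allocated to the bidders in $A(f)$ and the remaining $S(f)-\sum_{i\in A(f)}D_i(f)$ to the bidders in $E(f)$, divided among them in any way. (II) Before stopping, while $E(t)=\emptyset$: $p'=1$, and $P_i'=-b_i'=S(t)$, $x_i'=S(t)/p(t)$ for $i\in C(t)$. (III) Before stopping, while $E(t)\ne\emptyset$: $p'=0$, $b_j'=-1$ for the smallest index $j\in E(t)$, and $P_i'=-b_i'=1$, $x_i'=1/p(t)$ for $i\in C(t)$. The outcome $(X_i,P_i)$ is the total quantity and total price of each bidder, including the allocation in (I). The randomized adaptive clinching auction runs this auction, keeps the allocation $X_i$, and, if bidder $i$ would have to pay $P_i$, charges her the full reported budget $B_i$ with probability $P_i/B_i$ and $0$ with probability $1-P_i/B_i$ (with any joint law of the charges of different bidders). Theorem. Both auctions are well defined on all such reports: the process has an outcome, and the charge probabilities form a probability distribution. Every randomized adaptive clinching auction satisfies: - Feasibility: for every random outcome, $X_i\ge 0$ and $\sum_iX_i\le 1$. - No Positive Transfers, always: for all reports and every random outcome, every bidder is charged at least $0$. - Pareto-optimality ex-post: for all reports and every random outcome, $\sum_iX_i=1$, and whenever $X_i>0$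 and $v_j>v_i$, bidder $j$ is charged exactly $B_j$. - Voluntary Participation in expectation: if $v_i=\eta_i$ and $B_i=\beta_i$, then $\mathbb E[u_i]\ge 0$, whatever the other bidders report. - Incentive Compatibility in expectation, with private budgets: whatever the other bidders report, $\mathbb E[u_i]$ is maximized over all reports $(v_i,B_i)$ of bidder $i$, with $v_i,B_i>0$, at $(v_i,B_i)=(\eta_i,\beta_i)$. -/

import Mathlib

/-! ### Mechanisms for one unit of an infinitely divisible good -/

/-- An outcome for `n` bidders: the quantities `X` received and the total prices `P` paid. -/
structure Outcome (n : ℕ) where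
  X : Fin n → ℝ
  P : Fin n → ℝ

/-- A deterministic mechanism maps reported valuations (per unit quantity) and reported budgets
to an outcome. -/
abbrev DetMechanism (n : ℕ) := (Fin n → ℝ) → (Fin n → ℝ) → Outcome n

/-- A randomized mechanism maps reported valuations and budgets to a (discrete) probability
distribution over outcomes. -/
abbrev RandMechanism (n : ℕ) := (Fin n → ℝ) → (Fin n → ℝ) → PMF (Outcome n)

/-- Admissible profiles of valuations and budgets: all entries are positive. -/
def Admissible {n : ℕ} (v B : Fin n → ℝ) : Prop := (∀ i, 0 < v i) ∧ (∀ i, 0 < B i)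

/-- Utility of bidder `i` with true valuation `η` and true budget `β` in the outcome `ω`:
it is `-∞` if the price exceeds the true budget. -/
noncomputable def utility {n : ℕ} (η β : ℝ) (i : Fin n) (ω : Outcome n) : EReal :=
  if β < ω.P i then ⊥ else ((η * ω.X i - ω.P i : ℝ) : EReal)

/-- Expectation of an extended-real random variable under a discrete law: the expectation of its
positive part minus the expectation of its negative part (and `-∞` if the latter is infinite). -/
noncomputable def expectation {Ω : Type*} (μ : PMF Ω) (u : Ω → EReal) : EReal :=
  ((∑' ω, μ ω * (u ω).toENNReal : ENNReal) : EReal) -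
    ((∑' ω, μ ω * (-(u ω)).toENNReal : ENNReal) : EReal)

/-- At most one unit is allocated, in nonnegative quantities, whatever the random outcome. -/
def IsFeasible {n : ℕ} (R : RandMechanism n) : Prop :=
  ∀ v B, Admissible v B → ∀ ω ∈ (R v B).support, (∀ i, 0 ≤ ω.X i) ∧ ∑ i, ω.X i ≤ 1

/-- No Positive Transfers, whatever the random outcome. -/
def NoPositiveTransfers {n : ℕ} (R : RandMechanism n) : Prop :=
  ∀ v B, Admissible v B → ∀ ω ∈ (R v B).support, ∀ i, 0 ≤ ω.P i

/-- Pareto-optimality ex-post (whatever the random outcome): the good is completely sold, and if a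
bidder gets a nonzero quantity then every bidder with a higher valuation has exhausted her
budget. -/
def ParetoOptimalExPost {n : ℕ} (R : RandMechanism n) : Prop :=
  ∀ v B, Admissible v B → ∀ ω ∈ (R v B).support,
    ∑ i, ω.X i = 1 ∧ ∀ i j, 0 < ω.X i → v i < v j → ω.P j = B j

/-- Voluntary Participation in expectation: a bidder who reports her true valuation and her true
budget has nonnegative expected utility, whatever the others report. -/
def VoluntaryParticipation {n : ℕ} (R : RandMechanism n) : Prop :=
  ∀ v B, Admissible v B → ∀ i, 0 ≤ expectation (R v B) (utility (v i) (B i) i)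

/-- Incentive Compatibility in expectation, with private valuations and private budgets: whatever
the others report, the expected utility of bidder `i`, with true valuation `v i` and true budget
`B i`, is maximal, among all reports `(v', B')`, at the true one. -/
def IncentiveCompatible {n : ℕ} (R : RandMechanism n) : Prop :=
  ∀ v B, Admissible v B → ∀ i, ∀ v' B' : ℝ, 0 < v' → 0 < B' →
    expectation (R (Function.update v i v') (Function.update B i B')) (utility (v i) (B i) i) ≤
      expectation (R v B) (utility (v i) (B i) i)

/-! ### The adaptive clinching auction -/

/-- The trajectory of an ascending auction: stopping time `f`, price per unit `p`, quantity `x`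
allocated so far, price `P` extracted so far, and effective budget `b`. -/
structure Trajectory (n : ℕ) where
  f : ℝ
  p : ℝ → ℝ
  x : Fin n → ℝ → ℝ
  P : Fin n → ℝ → ℝ
  b : Fin n → ℝ → ℝ

namespace Trajectory

variable {n : ℕ}

/-- Remaining supply. -/
noncomputable def S (r : Trajectory n) (t : ℝ) : ℝ := 1 - ∑ i, r.x i t

/-- Active bidders. -/
noncomputable def A (v : Fin n → ℝ) (r : Trajectory n) (t : ℝ) : Finset (Fin n) :=
  {j | r.p t < v j ∧ 0 < r.b j t}

/-- Exiting bidders. -/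
noncomputable def E (v : Fin n → ℝ) (r : Trajectory n) (t : ℝ) : Finset (Fin n) :=
  {j | v j = r.p t ∧ 0 < r.b j t}

/-- Clinching bidders: active bidders for whom the supply equals the total demand of the others.
The demand of `k` is `b k t / p t`; the equation is multiplied by `p t`, so that it fails, as it
should, at price `0`, where the demand of a bidder with a positive budget is infinite. -/
noncomputable def C (v : Fin n → ℝ) (r : Trajectory n) (t : ℝ) : Finset (Fin n) :=
  {j ∈ r.A v t | r.p t * r.S t = ∑ k with k ≠ j, r.b k t}

/-- Stopping condition: the total demand of the active bidders is at most the supply (again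
multiplied by the price). -/
def Stops (v : Fin n → ℝ) (r : Trajectory n) (t : ℝ) : Prop :=
  ∑ j ∈ r.A v t, r.b j t ≤ r.p t * r.S t

/-- Rate at which money is extracted from each clinching bidder: `S(t)` while the price increases,
and `1` while the effective budget of an exiting bidder is being reduced. -/
noncomputable def rate (v : Fin n → ℝ) (r : Trajectory n) (t : ℝ) : ℝ :=
  if r.E v t = ∅ then r.S t else 1

/-- The smallest-index exiting bidder. -/
def IsFirstExiting (v : Fin n → ℝ) (r : Trajectory n) (t : ℝ) (i : Fin n) : Prop :=
  i ∈ r.E v t ∧ ∀ k ∈ r.E v t, i ≤ k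

/-- `g` has right derivative `g'` at `t`. -/
def RightDeriv (g : ℝ → ℝ) (g' t : ℝ) : Prop := HasDerivWithinAt g g' (Set.Ici t) t

open Classical in
/-- The trajectory of the adaptive clinching auction on the reports `(v, B)`: continuous
functions on `[0, f]` which start at `p = x = P = 0`, `b = B` and evolve by the rules of the
auction (as right derivatives) until `f`, the first time at which the stopping condition holds. -/
structure IsClinching (v B : Fin n → ℝ) (r : Trajectory n) : Prop where
  f_nonneg : 0 ≤ r.f
  p_zero : r.p 0 = 0
  x_zero : ∀ i, r.x i 0 = 0
  P_zero : ∀ i, r.P i 0 = 0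
  b_zero : ∀ i, r.b i 0 = B i
  p_cont : ContinuousOn r.p (Set.Icc 0 r.f)
  x_cont : ∀ i, ContinuousOn (r.x i) (Set.Icc 0 r.f)
  P_cont : ∀ i, ContinuousOn (r.P i) (Set.Icc 0 r.f)
  b_cont : ∀ i, ContinuousOn (r.b i) (Set.Icc 0 r.f)
  not_stops : ∀ t ∈ Set.Ico 0 r.f, ¬ r.Stops v t
  stops : r.Stops v r.f
  p_deriv : ∀ t ∈ Set.Ico 0 r.f, RightDeriv r.p (if r.E v t = ∅ then 1 else 0) t
  P_deriv : ∀ t ∈ Set.Ico 0 r.f, ∀ i,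
    RightDeriv (r.P i) (if i ∈ r.C v t then r.rate v t else 0) t
  x_deriv : ∀ t ∈ Set.Ico 0 r.f, ∀ i,
    RightDeriv (r.x i) (if i ∈ r.C v t then r.rate v t / r.p t else 0) t
  b_deriv : ∀ t ∈ Set.Ico 0 r.f, ∀ i,
    RightDeriv (r.b i)
      (if i ∈ r.C v t then - r.rate v t else if r.IsFirstExiting v t i then -1 else 0) t

/-- One-shot allocation `y` at the stopping time, at unit price `p(f)` and within the remaining
budgets: the active bidders get their total demand, and the exiting bidders get the rest of the
supply (divided among them in any way). -/
structure IsFinalAllocation (v : Fin n → ℝ) (r : Trajectory n) (y : Fin n → ℝ) : Prop where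
  nonneg : ∀ i, 0 ≤ y i
  budget : ∀ i, r.p r.f * y i ≤ r.b i r.f
  others : ∀ i, i ∉ r.A v r.f → i ∉ r.E v r.f → y i = 0
  active : ∑ i ∈ r.A v r.f, y i = ∑ i ∈ r.A v r.f, r.b i r.f / r.p r.f
  exiting : ∑ i ∈ r.E v r.f, y i = r.S r.f - ∑ i ∈ r.A v r.f, r.b i r.f / r.p r.f

end Trajectory

/-- `ω` is an outcome of the adaptive clinching auction on the reports `(v, B)`. -/
def IsClinchingOutcome {n : ℕ} (v B : Fin n → ℝ) (ω : Outcome n) : Prop :=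
  ∃ (r : Trajectory n) (y : Fin n → ℝ), r.IsClinching v B ∧ r.IsFinalAllocation v y ∧
    (∀ i, ω.X i = r.x i r.f + y i) ∧ (∀ i, ω.P i = r.P i r.f + r.p r.f * y i)

/-- `M` is an adaptive clinching auction. (The auction is determined up to the division of the
last part of the supply among the bidders who are exiting at the stopping time.) -/
def IsAdaptiveClinching {n : ℕ} (M : DetMechanism n) : Prop :=
  ∀ v B, Admissible v B → IsClinchingOutcome v B (M v B)

/-- `R` is obtained from `M` by randomized extraction: the allocation is unchanged, and a bidder
with reported budget `B i` who has to pay `P i` in `M` is charged `B i` with probability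
`P i / B i` and `0` with probability `1 - P i / B i`. The joint law of the charges of different
bidders is left arbitrary. -/
def IsRandomizedExtraction {n : ℕ} (M : DetMechanism n) (R : RandMechanism n) : Prop :=
  ∀ v B, Admissible v B →
    (∀ ω ∈ (R v B).support, ω.X = (M v B).X) ∧
    ∀ i, (R v B).map (fun ω => ω.P i) (B i) = ENNReal.ofReal ((M v B).P i / B i) ∧
      (R v B).map (fun ω => ω.P i) 0 = ENNReal.ofReal (1 - (M v B).P i / B i)

namespace Trajectory

open Set

/-! ### Calculus of right derivatives -/

/-! Everything is governed by the residual `R = ∑ b_k - p S`. A bidder who has not exited clinches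
exactly while `b_k = R`, and `R` falls at the clinching rate whoever clinches. So a budget that
meets `R` stays on it: until her exit, `b_k = min (B_k) R` and `P_k = max 0 (B_k - R)` (`b_eq_min`,
`P_eq_max`). Stopping means that `R` is at most the remaining budgets of the bidders whose valuation
the price has reached, so whoever exits earlier has paid nothing (`P_eq_zero_of_exit`). Hence
bidders below the final price get nothing and bidders above it spend everything, which is
Pareto-optimality.

Incentives. Time is price plus destroyed budgets (`p_add_sum_drained`), so the price path does not
depend on the report of a bidder `i` who has not exited (`p_eq_p`). Compare a truthful run with one
where `B'_i ≤ B_i`, and put `D = (R - B_i) - (R' - B'_i)`. Initially `D = 0`, and while `D ≥ 0` the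
quotient `D / p` does not increase, so `D ≤ 0` (`residual_sub_le`). Thus the larger budget has paid
more, and the gain `x - P / p`, with derivative `p' P / p ^ 2`, is larger too (`gain_le_gain`).
`surplus_le_surplus` concludes at the first time at which a run stops or `i` exits. Randomization
keeps expected payments; a budget reported above the true one gives utility `-∞` as soon as anything
is paid, and without payment there is no good.

Existence. The price path is explicit (`priceAt`), and the cap `min (B_k) R` turns the rules into a
scalar differential equation for `R` (`flowRate`), solved by Picard–Lindelöf between break points.
An exponential lower bound shows that the auction can stop only at an exit time (`sum_exited_lt`).
Payments come from `R`, gains by integration, and quantities from both (`ofResidual`). -/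

theorem RightDeriv.unique {g : ℝ → ℝ} {c d t : ℝ} (h : RightDeriv g c t) (h' : RightDeriv g d t) :
    c = d :=
  (uniqueDiffOn_Ici t t self_mem_Ici).eq_deriv _ h h'

/-- A right derivative depends only on the values to the right. -/
theorem RightDeriv.congr_Ico {g k : ℝ → ℝ} {c t b : ℝ} (h : RightDeriv g c t) (hb : t < b)
    (hgk : ∀ s ∈ Ico t b, k s = g s) : RightDeriv k c t := by
  refine HasDerivWithinAt.congr_of_eventuallyEq h ?_ (hgk t ⟨le_rfl, hb⟩)
  filter_upwards [Ico_mem_nhdsGE hb] with s hs using hgk s hs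

theorem le_of_rightDeriv_nonneg {g g' : ℝ → ℝ} {a b : ℝ} (hab : a ≤ b)
    (hc : ContinuousOn g (Icc a b)) (hd : ∀ t ∈ Ico a b, RightDeriv g (g' t) t)
    (h : ∀ t ∈ Ico a b, 0 ≤ g' t) : g a ≤ g b := by
  refine image_le_of_deriv_right_le_deriv_boundary (f := fun _ => g a) (f' := fun _ => 0)
    continuousOn_const (fun x _ => hasDerivWithinAt_const _ _ _) le_rfl hc hd h ⟨hab, le_rfl⟩

theorem le_of_rightDeriv_nonpos {g g' : ℝ → ℝ} {a b : ℝ} (hab : a ≤ b)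
    (hc : ContinuousOn g (Icc a b)) (hd : ∀ t ∈ Ico a b, RightDeriv g (g' t) t)
    (h : ∀ t ∈ Ico a b, g' t ≤ 0) : g b ≤ g a := by
  have := le_of_rightDeriv_nonneg (g := fun t => - g t) (g' := fun t => - g' t) hab hc.neg
    (fun t ht => (hd t ht).neg) (fun t ht => by have := h t ht; linarith)
  simpa using this

theorem eq_of_rightDeriv_zero {g : ℝ → ℝ} {a b : ℝ} (hab : a ≤ b)
    (hc : ContinuousOn g (Icc a b)) (hd : ∀ t ∈ Ico a b, RightDeriv g 0 t) : g b = g a :=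
  constant_of_has_deriv_right_zero hc hd b ⟨hab, le_rfl⟩

theorem eq_of_rightDeriv_eq {g k g' : ℝ → ℝ} {a b : ℝ} (hab : a ≤ b)
    (hc : ContinuousOn g (Icc a b)) (hk : ContinuousOn k (Icc a b))
    (hd : ∀ t ∈ Ico a b, RightDeriv g (g' t) t) (hd' : ∀ t ∈ Ico a b, RightDeriv k (g' t) t)
    (h : g a = k a) : g b = k b := by
  have : (g - k) b = (g - k) a := eq_of_rightDeriv_zero hab (hc.sub hk)
    (fun t ht => by simpa [RightDeriv] using HasDerivWithinAt.sub (hd t ht) (hd' t ht))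
  simp only [Pi.sub_apply] at this
  linarith

/-- The last crossing of level zero. -/
theorem exists_last_crossing {g : ℝ → ℝ} {a b : ℝ} (hab : a ≤ b) (hc : ContinuousOn g (Icc a b))
    (ha : g a ≤ 0) (hb : 0 < g b) : ∃ c ∈ Ico a b, g c = 0 ∧ ∀ t ∈ Ioc c b, 0 < g t := by
  have hK : IsCompact (Icc a b ∩ g ⁻¹' Iic 0) :=
    isCompact_Icc.of_isClosed_subset (hc.preimage_isClosed_of_isClosed isClosed_Icc isClosed_Iic)
      inter_subset_left
  obtain ⟨c, ⟨hcI, hc0⟩, hcm⟩ := hK.exists_isGreatest ⟨a, ⟨le_rfl, hab⟩, ha⟩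
  have hpos : ∀ t ∈ Ioc c b, 0 < g t := by
    intro t ht
    by_contra hcon
    exact absurd (hcm ⟨⟨hcI.1.trans ht.1.le, ht.2⟩, not_lt.1 hcon⟩) (not_le.2 ht.1)
  have hcb : c < b := lt_of_le_of_ne hcI.2 (by rintro rfl; exact absurd hc0 (not_le.2 hb))
  refine ⟨c, ⟨hcI.1, hcb⟩, le_antisymm hc0 ?_, hpos⟩
  by_contra hneg
  obtain ⟨d, hd, hd0⟩ := intermediate_value_Icc hcb.le (hc.mono (Icc_subset_Icc_left hcI.1))
    ⟨(not_le.1 hneg).le, hb.le⟩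
  have hdc : d ≤ c := hcm ⟨⟨hcI.1.trans hd.1, hd.2⟩, hd0.le⟩
  have : d = c := le_antisymm hdc hd.1
  subst this
  exact hneg hd0.ge

/-- A function that does not increase while it is nonnegative stays nonpositive. -/
theorem nonpos_of_barrier {g g' : ℝ → ℝ} {a b : ℝ} (hab : a ≤ b)
    (hc : ContinuousOn g (Icc a b)) (hd : ∀ t ∈ Ico a b, RightDeriv g (g' t) t)
    (ha : g a ≤ 0) (h : ∀ t ∈ Ico a b, 0 ≤ g t → g' t ≤ 0) : g b ≤ 0 := by
  by_contra hb
  obtain ⟨c, hcI, hc0, hpos⟩ := exists_last_crossing hab hc ha (not_le.1 hb)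
  have := le_of_rightDeriv_nonpos (g := g) (g' := g') hcI.2.le
    (hc.mono (Icc_subset_Icc_left hcI.1)) (fun t ht => hd t ⟨hcI.1.trans ht.1, ht.2⟩)
    (fun t ht => h t ⟨hcI.1.trans ht.1, ht.2⟩ (by
      rcases eq_or_lt_of_le ht.1 with rfl | h'
      · exact hc0.ge
      · exact (hpos t ⟨h', ht.2.le⟩).le))
  linarith

/-- The first time at which a continuous function reaches a level. -/
theorem exists_first_reaching {g : ℝ → ℝ} {a b c : ℝ} (hab : a ≤ b)
    (hc : ContinuousOn g (Icc a b)) (hb : c ≤ g b) :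
    ∃ t ∈ Icc a b, c ≤ g t ∧ ∀ s ∈ Ico a t, g s < c := by
  have hK : IsCompact (Icc a b ∩ g ⁻¹' Ici c) :=
    isCompact_Icc.of_isClosed_subset (hc.preimage_isClosed_of_isClosed isClosed_Icc isClosed_Ici)
      inter_subset_left
  obtain ⟨t, ⟨htI, ht0⟩, htm⟩ := hK.exists_isLeast ⟨b, ⟨hab, le_rfl⟩, hb⟩
  refine ⟨t, htI, ht0, fun s hs => ?_⟩
  by_contra hcon
  exact absurd (htm ⟨⟨hs.1, hs.2.le.trans htI.2⟩, not_lt.1 hcon⟩) (not_le.2 hs.2)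

theorem eq_left_of_eqOn_Ioc {g : ℝ → ℝ} {a b : ℝ} (hab : a < b) (hg : ContinuousOn g (Icc a b))
    (h : ∀ s ∈ Ioc a b, g b = g s) : g a = g b := by
  have hcl : closure (Ioc a b) = Icc a b := closure_Ioc hab.ne
  exact (show EqOn g (fun _ => g b) (Ioc a b) from fun y hy => (h y hy).symm).of_subset_closure
    hg continuousOn_const Ioc_subset_Icc_self hcl.ge ⟨le_rfl, hab.le⟩

theorem le_right_of_le_Ico {g k : ℝ → ℝ} {a b : ℝ} (hab : a < b) (hg : ContinuousOn g (Icc a b))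
    (hk : ContinuousOn k (Icc a b)) (h : ∀ s ∈ Ico a b, g s ≤ k s) : g b ≤ k b := by
  have hcl : closure (Ico a b) = Icc a b := closure_Ico hab.ne
  exact le_on_closure h (hcl.symm ▸ hg) (hcl.symm ▸ hk) (hcl.symm ▸ ⟨hab.le, le_rfl⟩)

end Trajectory

namespace Trajectory

open Set

variable {n : ℕ} {v B : Fin n → ℝ} {r : Trajectory n} {t : ℝ} {k : Fin n}

/-! ### The run of the auction on given reports -/

/-- A clinching trajectory on admissible reports of at least two bidders. -/
structure IsRun (v B : Fin n → ℝ) (r : Trajectory n) : Prop extends r.IsClinching v B where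
  two_le : 2 ≤ n
  adm : Admissible v B

/-- The total effective budget minus the value of the supply. -/
noncomputable def residual (r : Trajectory n) (t : ℝ) : ℝ := ∑ k, r.b k t - r.p t * r.S t

/-- The rate at which money is extracted from bidder `k`. -/
noncomputable def clinchRate (v : Fin n → ℝ) (r : Trajectory n) (k : Fin n) (t : ℝ) : ℝ :=
  if k ∈ r.C v t then r.rate v t else 0

open Classical in
/-- The rate at which the budget of an exiting bidder is destroyed. -/
noncomputable def drainRate (v : Fin n → ℝ) (r : Trajectory n) (k : Fin n) (t : ℝ) : ℝ :=
  if r.IsFirstExiting v t k then 1 else 0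

/-- The part of the budget of bidder `k` that has been destroyed. -/
noncomputable def drained (B : Fin n → ℝ) (r : Trajectory n) (k : Fin n) (t : ℝ) : ℝ :=
  B k - r.b k t - r.P k t

theorem mem_A : k ∈ r.A v t ↔ r.p t < v k ∧ 0 < r.b k t := by simp [A]

theorem mem_E : k ∈ r.E v t ↔ v k = r.p t ∧ 0 < r.b k t := by simp [E]

theorem sum_ne_eq (f : Fin n → ℝ) (k : Fin n) : ∑ j with j ≠ k, f j = ∑ j, f j - f k := by
  rw [Finset.filter_ne', ← Finset.add_sum_erase _ _ (Finset.mem_univ k)]; ring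

/-- The demand of the others is the total minus the bidder's own budget, so the clinching equation
compares her budget with the residual. -/
theorem mem_C : k ∈ r.C v t ↔ (r.p t < v k ∧ 0 < r.b k t) ∧ r.b k t = r.residual t := by
  rw [C, Finset.mem_filter, mem_A, sum_ne_eq, residual]
  constructor <;> rintro ⟨h1, h2⟩ <;> exact ⟨h1, by linarith⟩

theorem sum_drainRate_of_nonempty (h : r.E v t ≠ ∅) (s : Finset (Fin n)) (hs : r.E v t ⊆ s) :
    ∑ k ∈ s, r.drainRate v k t = 1 := by
  have hne := Finset.nonempty_iff_ne_empty.2 h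
  have hmin : r.IsFirstExiting v t ((r.E v t).min' hne) :=
    ⟨Finset.min'_mem _ _, fun k hk => Finset.min'_le _ _ hk⟩
  rw [Finset.sum_eq_single_of_mem _ (hs hmin.1)]
  · simp [drainRate, hmin]
  · intro b _ hb
    have : ¬ r.IsFirstExiting v t b := fun hb' => hb (le_antisymm (hb'.2 _ hmin.1) (hmin.2 _ hb'.1))
    simp [drainRate, this]

theorem drainRate_of_empty (h : r.E v t = ∅) (k : Fin n) : r.drainRate v k t = 0 := by
  simp [drainRate, IsFirstExiting, h]

theorem drainRate_of_ne (h : v k ≠ r.p t) : r.drainRate v k t = 0 := by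
  simp [drainRate, IsFirstExiting, mem_E, h]

theorem drainRate_nonneg (k : Fin n) (t : ℝ) : 0 ≤ r.drainRate v k t := by
  unfold drainRate; split_ifs <;> simp

theorem clinchRate_of_le (h : v k ≤ r.p t) : r.clinchRate v k t = 0 := by
  simp [clinchRate, mem_C, not_lt.2 h]

namespace IsRun

variable (h : r.IsRun v B)
include h

theorem p_deriv' (ht : t ∈ Ico 0 r.f) : RightDeriv r.p (if r.E v t = ∅ then 1 else 0) t :=
  h.p_deriv t ht

theorem P_deriv' (ht : t ∈ Ico 0 r.f) (k : Fin n) : RightDeriv (r.P k) (r.clinchRate v k t) t :=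
  h.P_deriv t ht k

theorem x_deriv' (ht : t ∈ Ico 0 r.f) (k : Fin n) :
    RightDeriv (r.x k) (r.clinchRate v k t / r.p t) t := by
  have := h.x_deriv t ht k
  unfold clinchRate
  split_ifs at this ⊢ <;> simpa using this

theorem b_deriv' (ht : t ∈ Ico 0 r.f) (k : Fin n) :
    RightDeriv (r.b k) (- r.clinchRate v k t - r.drainRate v k t) t := by
  have := h.b_deriv t ht k
  unfold clinchRate drainRate
  by_cases hC : k ∈ r.C v t
  · have hF : ¬ r.IsFirstExiting v t k := fun hF =>
      (mem_C.1 hC).1.1.ne' (mem_E.1 hF.1).1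
    simpa [hC, hF] using this
  · by_cases hF : r.IsFirstExiting v t k <;> simpa [hC, hF] using this

theorem drained_deriv (ht : t ∈ Ico 0 r.f) (k : Fin n) :
    RightDeriv (r.drained B k) (r.drainRate v k t) t := by
  have := HasDerivWithinAt.fun_sub ((h.b_deriv' ht k).const_sub (B k)) (h.P_deriv' ht k)
  refine HasDerivWithinAt.congr_deriv this ?_
  ring

theorem drained_cont (k : Fin n) : ContinuousOn (r.drained B k) (Icc 0 r.f) :=
  (continuousOn_const.sub (h.b_cont k)).sub (h.P_cont k)

theorem S_cont : ContinuousOn r.S (Icc 0 r.f) :=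
  continuousOn_const.sub (continuousOn_finsetSum _ fun k _ => h.x_cont k)

theorem S_deriv (ht : t ∈ Ico 0 r.f) :
    RightDeriv r.S (- ∑ k, r.clinchRate v k t / r.p t) t := by
  have := (HasDerivWithinAt.fun_sum (u := Finset.univ) fun k _ => h.x_deriv' ht k).const_sub 1
  exact this

theorem residual_cont : ContinuousOn r.residual (Icc 0 r.f) :=
  (continuousOn_finsetSum _ fun k _ => h.b_cont k).sub (h.p_cont.mul h.S_cont)

/-! ### Signs and monotonicity along a run. -/

theorem v_pos (k : Fin n) : 0 < v k := h.adm.1 k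

theorem B_pos (k : Fin n) : 0 < B k := h.adm.2 k

theorem b_nonneg (ht : t ∈ Icc 0 r.f) (k : Fin n) : 0 ≤ r.b k t := by
  have := nonpos_of_barrier (g := fun s => - r.b k s) ht.1
    ((h.b_cont k).mono (Icc_subset_Icc_right ht.2)).neg
    (fun s hs => (h.b_deriv' ⟨hs.1, hs.2.trans_le ht.2⟩ k).neg)
    (by simp [h.b_zero, (h.B_pos k).le])
    (by
      intro s _ hs0
      have hb : ¬ 0 < r.b k s := by simpa using hs0
      simp [clinchRate, drainRate, IsFirstExiting, mem_C, mem_E, hb])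
  simpa using this

theorem p_mono {s t : ℝ} (hs : 0 ≤ s) (hst : s ≤ t) (ht : t ≤ r.f) : r.p s ≤ r.p t := by
  refine le_of_rightDeriv_nonneg hst (h.p_cont.mono (Icc_subset_Icc hs ht))
    (fun u hu => h.p_deriv' ⟨hs.trans hu.1, hu.2.trans_le ht⟩) (fun u _ => ?_)
  split_ifs <;> simp

theorem p_nonneg (ht : t ∈ Icc 0 r.f) : 0 ≤ r.p t :=
  h.p_zero ▸ h.p_mono le_rfl ht.1 ht.2

omit h in
theorem E_eq_empty_of_lt (hp : ∀ k, r.p t < v k) : r.E v t = ∅ := by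
  ext k; simp [mem_E, (hp k).ne']

/-- At price zero nobody exits, since valuations are positive; the price would then have been equal
to time. -/
theorem p_pos (ht0 : 0 < t) (htf : t ≤ r.f) : 0 < r.p t := by
  refine lt_of_le_of_ne (h.p_nonneg ⟨ht0.le, htf⟩) fun h0 => ?_
  have hE : ∀ s ∈ Ico 0 t, r.E v s = ∅ := fun s hs => E_eq_empty_of_lt fun k =>
    ((h.p_mono hs.1 hs.2.le htf).trans h0.ge).trans_lt (h.v_pos k)
  have := eq_of_rightDeriv_eq (g := r.p) (k := fun s => s) (g' := fun _ => 1) ht0.le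
    (h.p_cont.mono (Icc_subset_Icc_right htf)) continuousOn_id
    (fun s hs => by simpa [hE s hs] using h.p_deriv' ⟨hs.1, hs.2.trans_le htf⟩)
    (fun s _ => hasDerivWithinAt_id _ _) h.p_zero
  linarith

theorem S_zero : r.S 0 = 1 := by simp [S, h.x_zero]

theorem lt_sum_B (k : Fin n) : B k < ∑ j, B j := by
  obtain ⟨j, hj⟩ : ∃ j : Fin n, j ≠ k := by
    have : Nontrivial (Fin n) := Fin.nontrivial_iff_two_le.2 h.two_le
    exact exists_ne k
  exact Finset.single_lt_sum hj (Finset.mem_univ k) (Finset.mem_univ j) (h.B_pos j)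
    (fun i _ _ => (h.B_pos i).le)

theorem residual_zero : r.residual 0 = ∑ k, B k := by simp [residual, h.b_zero, h.p_zero]

theorem clinchRate_zero (k : Fin n) : r.clinchRate v k 0 = 0 := by
  simp [clinchRate, mem_C, h.residual_zero, h.b_zero, (h.lt_sum_B k).ne]

/-- Once `S ≤ 0`, clinching at rate `S` cannot lower it further. During an exit phase nobody
clinches then, because the positive budget of an exiting bidder would force `p S > 0`. -/
theorem S_nonneg (ht : t ∈ Icc 0 r.f) : 0 ≤ r.S t := by
  have := nonpos_of_barrier (g := fun s => - r.S s) ht.1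
    (h.S_cont.mono (Icc_subset_Icc_right ht.2)).neg
    (fun s hs => (h.S_deriv ⟨hs.1, hs.2.trans_le ht.2⟩).neg)
    (by simp [h.S_zero])
    (by
      intro s hs hs0
      have hS : r.S s ≤ 0 := by simpa using hs0
      have hsI : s ∈ Icc 0 r.f := ⟨hs.1, hs.2.le.trans ht.2⟩
      have key : ∀ k, r.clinchRate v k s ≤ 0 := by
        intro k
        unfold clinchRate
        split_ifs with hC
        · unfold rate
          split_ifs with hE
          · exact hS
          · exfalso
            obtain ⟨j, hj⟩ := Finset.nonempty_iff_ne_empty.2 hE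
            rw [C, Finset.mem_filter] at hC
            have hjk : j ≠ k := by
              rintro rfl
              exact (mem_A.1 hC.1).1.ne' (mem_E.1 hj).1
            have h1 : r.b j s ≤ ∑ i with i ≠ k, r.b i s :=
              Finset.single_le_sum (f := fun i => r.b i s) (fun i _ => h.b_nonneg hsI i)
                (by simpa using hjk)
            have h2 := mul_nonpos_of_nonneg_of_nonpos (h.p_nonneg hsI) hS
            have := (mem_E.1 hj).2
            linarith [hC.2]
        · exact le_rfl
      simp only [neg_neg]
      exact Finset.sum_nonpos fun k _ => div_nonpos_of_nonpos_of_nonneg (key k) (h.p_nonneg hsI))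
  simpa using this

theorem rate_nonneg (ht : t ∈ Icc 0 r.f) : 0 ≤ r.rate v t := by
  unfold rate
  split_ifs
  · exact h.S_nonneg ht
  · exact zero_le_one

theorem clinchRate_nonneg (ht : t ∈ Icc 0 r.f) (k : Fin n) : 0 ≤ r.clinchRate v k t := by
  unfold clinchRate
  split_ifs
  · exact h.rate_nonneg ht
  · exact le_rfl

theorem P_mono {s t : ℝ} (hs : 0 ≤ s) (hst : s ≤ t) (ht : t ≤ r.f) (k : Fin n) :
    r.P k s ≤ r.P k t :=
  le_of_rightDeriv_nonneg hst ((h.P_cont k).mono (Icc_subset_Icc hs ht))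
    (fun _ hu => h.P_deriv' ⟨hs.trans hu.1, hu.2.trans_le ht⟩ k)
    (fun _ hu => h.clinchRate_nonneg ⟨hs.trans hu.1, hu.2.le.trans ht⟩ k)

theorem P_nonneg (ht : t ∈ Icc 0 r.f) (k : Fin n) : 0 ≤ r.P k t :=
  h.P_zero k ▸ h.P_mono le_rfl ht.1 ht.2 k

theorem x_mono {s t : ℝ} (hs : 0 ≤ s) (hst : s ≤ t) (ht : t ≤ r.f) (k : Fin n) :
    r.x k s ≤ r.x k t :=
  le_of_rightDeriv_nonneg hst ((h.x_cont k).mono (Icc_subset_Icc hs ht))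
    (fun _ hu => h.x_deriv' ⟨hs.trans hu.1, hu.2.trans_le ht⟩ k)
    (fun _ hu => div_nonneg (h.clinchRate_nonneg ⟨hs.trans hu.1, hu.2.le.trans ht⟩ k)
      (h.p_nonneg ⟨hs.trans hu.1, hu.2.le.trans ht⟩))

theorem x_nonneg (ht : t ∈ Icc 0 r.f) (k : Fin n) : 0 ≤ r.x k t :=
  h.x_zero k ▸ h.x_mono le_rfl ht.1 ht.2 k

theorem b_anti {s t : ℝ} (hs : 0 ≤ s) (hst : s ≤ t) (ht : t ≤ r.f) (k : Fin n) :
    r.b k t ≤ r.b k s :=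
  le_of_rightDeriv_nonpos hst ((h.b_cont k).mono (Icc_subset_Icc hs ht))
    (fun _ hu => h.b_deriv' ⟨hs.trans hu.1, hu.2.trans_le ht⟩ k)
    (fun u hu => by
      have := h.clinchRate_nonneg ⟨hs.trans hu.1, hu.2.le.trans ht⟩ k
      have := r.drainRate_nonneg (v := v) k u
      linarith)

theorem drained_mono {s t : ℝ} (hs : 0 ≤ s) (hst : s ≤ t) (ht : t ≤ r.f) (k : Fin n) :
    r.drained B k s ≤ r.drained B k t :=
  le_of_rightDeriv_nonneg hst ((h.drained_cont k).mono (Icc_subset_Icc hs ht))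
    (fun _ hu => h.drained_deriv ⟨hs.trans hu.1, hu.2.trans_le ht⟩ k)
    (fun u _ => r.drainRate_nonneg k u)

theorem drained_zero (k : Fin n) : r.drained B k 0 = 0 := by
  simp [drained, h.b_zero, h.P_zero]

theorem drained_nonneg (ht : t ∈ Icc 0 r.f) (k : Fin n) : 0 ≤ r.drained B k t :=
  h.drained_zero k ▸ h.drained_mono le_rfl ht.1 ht.2 k

theorem drained_le (ht : t ∈ Icc 0 r.f) (k : Fin n) : r.drained B k t ≤ B k := by
  have := h.b_nonneg ht k
  have := h.P_nonneg ht k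
  unfold drained
  linarith

omit h in
theorem sum_drainRate (s : ℝ) :
    ∑ k, r.drainRate v k s = if r.E v s = ∅ then 0 else 1 := by
  split_ifs with hE
  · simp [drainRate_of_empty hE]
  · exact sum_drainRate_of_nonempty hE _ (Finset.subset_univ _)

/-- The price and the destroyed budgets measure time. -/
theorem p_add_sum_drained (ht : t ∈ Icc 0 r.f) : r.p t + ∑ k, r.drained B k t = t := by
  refine eq_of_rightDeriv_eq (g := fun s => r.p s + ∑ k, r.drained B k s) (k := fun s => s)
    (g' := fun _ => 1) ht.1
    ((h.p_cont.add (continuousOn_finsetSum _ fun k _ => h.drained_cont k)).mono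
      (Icc_subset_Icc_right ht.2)) continuousOn_id (fun s hs => ?_)
    (fun s _ => hasDerivWithinAt_id _ _) (by simp [h.p_zero, h.drained_zero])
  have hs' : s ∈ Ico 0 r.f := ⟨hs.1, hs.2.trans_le ht.2⟩
  have := (h.p_deriv' hs').add
    (HasDerivWithinAt.fun_sum (u := Finset.univ) fun k _ => h.drained_deriv hs' k)
  rw [sum_drainRate] at this
  refine HasDerivWithinAt.congr_deriv this ?_
  split_ifs <;> simp

/-- The clinched money cancels between the budgets and the value of the supply. There remains the
growth `p' S` of that value, or the unit drain of a budget. -/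
theorem residual_deriv (ht : t ∈ Ico 0 r.f) : RightDeriv r.residual (- r.rate v t) t := by
  have h1 := (HasDerivWithinAt.fun_sum (u := Finset.univ) fun k _ => h.b_deriv' ht k).sub
    ((h.p_deriv' ht).mul (h.S_deriv ht))
  refine HasDerivWithinAt.congr_deriv h1 ?_
  have h2 : r.p t * ∑ k, r.clinchRate v k t / r.p t = ∑ k, r.clinchRate v k t := by
    rw [Finset.mul_sum]
    refine Finset.sum_congr rfl fun k _ => ?_
    -- At time `0` the division is by zero, but nobody clinches there.
    rcases eq_or_lt_of_le ht.1 with rfl | h0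
    · simp [h.clinchRate_zero]
    · field_simp [(h.p_pos h0 ht.2.le).ne']
  have h3 := sum_drainRate (v := v) (r := r) t
  rw [Finset.sum_sub_distrib, h3, Finset.sum_neg_distrib]
  unfold rate
  split_ifs <;> linarith

/-- The price cannot leave a valuation before the budgets there are destroyed. At the last time with
price `v k`, a positive budget would give slope zero, yet just afterwards the price meets no
valuation and has slope one. -/
theorem b_eq_zero_of_lt (ht : t ∈ Icc 0 r.f) (hk : v k < r.p t) : r.b k t = 0 := by
  obtain ⟨s, hs, hs0, hpos⟩ := exists_last_crossing (g := fun s => r.p s - v k) ht.1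
    ((h.p_cont.sub continuousOn_const).mono (Icc_subset_Icc_right ht.2))
    (by simp [h.p_zero, (h.v_pos k).le]) (by simpa using hk)
  by_contra hne
  have hb : 0 < r.b k s := lt_of_lt_of_le (lt_of_le_of_ne (h.b_nonneg ht k) (Ne.symm hne))
    (h.b_anti hs.1 hs.2.le ht.2 k)
  have hsf : s ∈ Ico 0 r.f := ⟨hs.1, hs.2.trans_le ht.2⟩
  have hE : r.E v s ≠ ∅ := by
    intro hE
    have : k ∈ r.E v s := mem_E.2 ⟨by linarith, hb⟩
    simp [hE] at this
  have hd := h.p_deriv' hsf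
  rw [if_neg hE] at hd
  -- a price interval above `v k` without valuations
  obtain ⟨u, hu, hu2⟩ : ∃ u, s < u ∧ u ≤ t ∧ ∀ w ∈ Ioo s u, r.E v w = ∅ := by
    have hev : ∀ᶠ w in nhdsWithin s (Ici s), ∀ j, r.p s < v j → r.p w < v j := by
      rw [Filter.eventually_all]
      intro j
      by_cases hj : r.p s < v j
      · have := hd.continuousWithinAt.eventually_lt_const hj
        filter_upwards [this] with w hw _ using hw
      · simp [hj]
    obtain ⟨u, hu, hu'⟩ := (mem_nhdsGE_iff_exists_Ico_subset' hs.2).1 hev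
    refine ⟨min u t, lt_min hu hs.2, min_le_right _ _, fun w hw => ?_⟩
    ext j
    simp only [mem_E, Finset.notMem_empty, iff_false, not_and, not_lt]
    intro hj
    exfalso
    have h1 : r.p s < r.p w := by
      have := hpos w ⟨hw.1, hw.2.le.trans (min_le_right _ _)⟩
      linarith
    have := hu' ⟨hw.1.le, hw.2.trans_le (min_le_left _ _)⟩ j (hj ▸ h1)
    exact this.ne hj.symm
  have hlin : ∀ w ∈ Ico s u, r.p w = r.p s + (w - s) := by
    intro w hw
    rcases eq_or_lt_of_le hw.1 with rfl | hsw
    · simp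
    have : ∀ w' ∈ Ioc s w, r.p w - w = r.p w' - w' := by
      intro w' hw'
      refine eq_of_rightDeriv_zero (g := fun y => r.p y - y) hw'.2
        ((h.p_cont.sub continuousOn_id).mono (Icc_subset_Icc (hs.1.trans hw'.1.le)
          (hw.2.le.trans (hu2.1.trans ht.2)))) (fun y hy => ?_)
      have h1 := h.p_deriv' (t := y) ⟨hs.1.trans (hw'.1.le.trans hy.1),
        hy.2.trans (hw.2.trans_le (hu2.1.trans ht.2))⟩
      rw [if_pos (hu2.2 y ⟨hw'.1.trans_le hy.1, hy.2.trans hw.2⟩)] at h1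
      simpa [RightDeriv] using HasDerivWithinAt.fun_sub h1 (hasDerivWithinAt_id y (Ici y))
    have hc : ContinuousOn (fun y => r.p y - y) (Icc s w) :=
      (h.p_cont.sub continuousOn_id).mono (Icc_subset_Icc hs.1
          (hw.2.le.trans (hu2.1.trans ht.2)))
    have := eq_left_of_eqOn_Ioc hsw hc this
    linarith
  have h1 : RightDeriv r.p 1 s := by
    have h2 : RightDeriv (fun w => r.p s + (w - s)) 1 s := by
      simpa [RightDeriv] using
        ((hasDerivWithinAt_id s (Ici s)).sub_const s).const_add (r.p s)
    exact h2.congr_Ico hu hlin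
  exact zero_ne_one (hd.unique h1)

/-! ### The stopping condition in terms of the residual. -/

theorem sum_b_eq (ht : t ∈ Icc 0 r.f) :
    ∑ k, r.b k t = ∑ k with v k ≤ r.p t, r.b k t + ∑ k ∈ r.A v t, r.b k t := by
  rw [← Finset.sum_filter_add_sum_filter_not Finset.univ (fun k => v k ≤ r.p t)]
  congr 1
  symm
  refine Finset.sum_subset (fun k hk => by simpa using (mem_A.1 hk).1) (fun k hk hk' => ?_)
  have hk1 : r.p t < v k := by simpa using hk
  exact le_antisymm (not_lt.1 fun h0 => hk' (mem_A.2 ⟨hk1, h0⟩)) (h.b_nonneg ht k)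

theorem not_stops' (ht : t ∈ Ico 0 r.f) : ∑ k with v k ≤ r.p t, r.b k t < r.residual t := by
  have h1 := h.not_stops t ht
  rw [Stops, not_le] at h1
  have h2 := h.sum_b_eq ⟨ht.1, ht.2.le⟩
  unfold residual
  linarith

theorem stops' : r.residual r.f ≤ ∑ k with v k ≤ r.p r.f, r.b k r.f := by
  have h1 := h.stops
  rw [Stops] at h1
  have h2 := h.sum_b_eq ⟨h.f_nonneg, le_rfl⟩
  unfold residual
  linarith

theorem residual_pos (ht : t ∈ Ico 0 r.f) : 0 < r.residual t :=
  (Finset.sum_nonneg fun k _ => h.b_nonneg ⟨ht.1, ht.2.le⟩ k).trans_lt (h.not_stops' ht)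

theorem f_pos : 0 < r.f := by
  refine lt_of_le_of_ne h.f_nonneg fun h0 => ?_
  have h1 := h.stops'
  rw [← h0, h.residual_zero, h.p_zero] at h1
  have h2 : ∑ k with v k ≤ 0, r.b k 0 = 0 :=
    Finset.sum_eq_zero fun k hk => absurd (Finset.mem_filter.1 hk).2 (not_le.2 (h.v_pos k))
  have h3 := (h.B_pos ⟨0, by have := h.two_le; omega⟩).trans (h.lt_sum_B _)
  linarith

theorem residual_nonneg (ht : t ∈ Icc 0 r.f) : 0 ≤ r.residual t := by
  rcases eq_or_lt_of_le ht.2 with rfl | hlt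
  · exact le_right_of_le_Ico h.f_pos continuousOn_const h.residual_cont
      (fun s hs => (h.residual_pos hs).le)
  · exact (h.residual_pos ⟨ht.1, hlt⟩).le

theorem residual_anti {s t : ℝ} (hs : 0 ≤ s) (hst : s ≤ t) (ht : t ≤ r.f) :
    r.residual t ≤ r.residual s :=
  le_of_rightDeriv_nonpos hst (h.residual_cont.mono (Icc_subset_Icc hs ht))
    (fun _ hu => h.residual_deriv ⟨hs.trans hu.1, hu.2.trans_le ht⟩)
    (fun _ (hu : _ ∈ Ico s t) => neg_nonpos.2 (h.rate_nonneg ⟨hs.trans hu.1, hu.2.le.trans ht⟩))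

theorem S_anti {s t : ℝ} (hs : 0 ≤ s) (hst : s ≤ t) (ht : t ≤ r.f) : r.S t ≤ r.S s := by
  unfold S
  have := Finset.sum_le_sum (s := Finset.univ) fun k _ => h.x_mono hs hst ht k
  linarith

/-- Until her exit, a bidder is clinching exactly while her budget equals the residual. -/
theorem clinchRate_of_lt (ht : t ∈ Ico 0 r.f) (hk : r.p t < v k) :
    r.clinchRate v k t = if r.b k t = r.residual t then r.rate v t else 0 := by
  unfold clinchRate
  congr 1
  simp only [mem_C, hk, true_and, eq_iff_iff, and_iff_right_iff_imp]
  intro hb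
  rw [hb]
  exact h.residual_pos ht

/-- After a last crossing of the residual from below she would not clinch, so her budget would be
constant. At the crossing itself she clinches, so the rate is zero there; hence the supply is
exhausted, and the residual, then the sum of all budgets, is at least hers. -/
theorem b_le_residual (ht : t ∈ Icc 0 r.f) (hk : ∀ s ∈ Ico 0 t, r.p s < v k) :
    r.b k t ≤ r.residual t := by
  by_contra hcon
  have hcon := not_le.1 hcon
  obtain ⟨s, hs, hs0, hpos⟩ := exists_last_crossing (g := fun s => r.b k s - r.residual s) ht.1
    (((h.b_cont k).sub h.residual_cont).mono (Icc_subset_Icc_right ht.2))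
    (by simpa [h.residual_zero, h.b_zero] using (h.lt_sum_B k).le) (by simpa using hcon)
  have hconst : ∀ u ∈ Ioc s t, r.b k t = r.b k u := fun u hu => by
    refine eq_of_rightDeriv_zero hu.2 ((h.b_cont k).mono (Icc_subset_Icc (hs.1.trans hu.1.le) ht.2))
      (fun w hw => ?_)
    have hw0 : 0 ≤ w := hs.1.trans (hu.1.le.trans hw.1)
    have hd := h.b_deriv' (t := w) ⟨hw0, hw.2.trans_le ht.2⟩ k
    have hne : r.b k w ≠ r.residual w := by
      have := hpos w ⟨hu.1.trans_le hw.1, hw.2.le⟩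
      intro; linarith
    rwa [h.clinchRate_of_lt ⟨hw0, hw.2.trans_le ht.2⟩ (hk w ⟨hw0, hw.2⟩), if_neg hne,
      drainRate_of_ne (hk w ⟨hw0, hw.2⟩).ne', neg_zero, sub_zero] at hd
  have hconst' : r.b k s = r.b k t :=
    eq_left_of_eqOn_Ioc hs.2 ((h.b_cont k).mono (Icc_subset_Icc hs.1 ht.2)) hconst
  have hsI : s ∈ Ico 0 r.f := ⟨hs.1, hs.2.trans_le ht.2⟩
  have hd := h.b_deriv' hsI k
  rw [h.clinchRate_of_lt hsI (hk s ⟨hs.1, hs.2⟩), if_pos (by linarith),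
      drainRate_of_ne (hk s ⟨hs.1, hs.2⟩).ne', sub_zero] at hd
  have hd0 : RightDeriv (r.b k) 0 s := by
    refine RightDeriv.congr_Ico (g := fun _ => r.b k t) (hasDerivWithinAt_const _ _ _) hs.2
      (fun u hu => ?_)
    rcases eq_or_lt_of_le hu.1 with rfl | hsu
    · exact hconst'
    · exact (hconst u ⟨hsu, hu.2.le⟩).symm
  have hr0 : r.rate v s = 0 := by
    have := hd.unique hd0
    linarith
  have hS0 : r.S s = 0 := by
    unfold rate at hr0
    split_ifs at hr0 with hE
    · exact hr0
    · exact absurd hr0 one_ne_zero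
  have hSt : r.S t = 0 := le_antisymm (hS0 ▸ h.S_anti hs.1 hs.2.le ht.2) (h.S_nonneg ht)
  have : r.b k t ≤ r.residual t := by
    unfold residual
    rw [hSt, mul_zero, sub_zero]
    exact Finset.single_le_sum (f := fun i => r.b i t) (fun i _ => h.b_nonneg ht i)
      (Finset.mem_univ k)
  linarith

/-- Until her exit, the budget of a bidder is the reported one, capped by the residual. -/
theorem b_eq_min (ht : t ∈ Icc 0 r.f) (hk : ∀ s ∈ Ico 0 t, r.p s < v k) :
    r.b k t = min (B k) (r.residual t) := by
  have h1 : r.b k t ≤ B k := h.b_zero k ▸ h.b_anti le_rfl ht.1 ht.2 k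
  refine le_antisymm (le_min h1 (h.b_le_residual ht hk)) ?_
  by_contra hcon
  obtain ⟨h2, h3⟩ := lt_min_iff.1 (not_le.1 hcon)
  have hle : ∀ s ∈ Icc 0 t, r.b k s ≤ r.residual s := fun s hs =>
    h.b_le_residual ⟨hs.1, hs.2.trans ht.2⟩ fun u hu => hk u ⟨hu.1, hu.2.trans_le hs.2⟩
  have hd : ∀ a, 0 ≤ a → a ≤ t → (∀ s ∈ Ico a t, r.b k s ≠ r.residual s) →
      r.b k t = r.b k a := fun a ha hat hne => by
    refine eq_of_rightDeriv_zero hat ((h.b_cont k).mono (Icc_subset_Icc ha ht.2)) (fun w hw => ?_)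
    have hw0 : 0 ≤ w := ha.trans hw.1
    have hd := h.b_deriv' (t := w) ⟨hw0, hw.2.trans_le ht.2⟩ k
    rwa [h.clinchRate_of_lt ⟨hw0, hw.2.trans_le ht.2⟩ (hk w ⟨hw0, hw.2⟩), if_neg (hne w hw),
      drainRate_of_ne (hk w ⟨hw0, hw.2⟩).ne', neg_zero, sub_zero] at hd
  -- If the budget ever reached the residual, it is constant after the last meeting while the
  -- residual does not increase; otherwise she never clinched and still has `B k`.
  by_cases hex : ∃ a ∈ Icc 0 t, r.residual a - r.b k a ≤ 0
  · obtain ⟨a, ha, ha0⟩ := hex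
    obtain ⟨s, hs, hs0, hpos⟩ := exists_last_crossing (g := fun s => r.residual s - r.b k s) ha.2
      ((h.residual_cont.sub (h.b_cont k)).mono (Icc_subset_Icc ha.1 ht.2)) ha0 (by linarith)
    have hs0' : 0 ≤ s := ha.1.trans hs.1
    have hconst : ∀ u ∈ Ioc s t, r.b k t = r.b k u := fun u hu =>
      hd u (hs0'.trans hu.1.le) hu.2 fun w hw => by
        have := hpos w ⟨hu.1.trans_le hw.1, hw.2.le⟩
        intro; linarith
    have hconst' : r.b k s = r.b k t :=
      eq_left_of_eqOn_Ioc hs.2 ((h.b_cont k).mono (Icc_subset_Icc hs0' ht.2)) hconst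
    have := h.residual_anti hs0' hs.2.le ht.2
    linarith
  · have := hd 0 le_rfl ht.1 fun s hs hs' =>
      hex ⟨s, ⟨hs.1, hs.2.le⟩, by linarith⟩
    rw [h.b_zero] at this
    linarith

end IsRun

end Trajectory

namespace Trajectory

open Set

variable {n : ℕ} {v B : Fin n → ℝ} {r : Trajectory n} {t : ℝ} {k : Fin n} {y : Fin n → ℝ}

/-- The value, in units of the good at the current price, of what bidder `i` has gained. -/
noncomputable def gain (r : Trajectory n) (i : Fin n) (t : ℝ) : ℝ := r.x i t - r.P i t / r.p t

/-- The quasilinear utility of bidder `i` from the outcome of a trajectory with a final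
allocation. -/
noncomputable def surplus (r : Trajectory n) (y : Fin n → ℝ) (η : ℝ) (i : Fin n) : ℝ :=
  η * (r.x i r.f + y i) - (r.P i r.f + r.p r.f * y i)

namespace IsRun

variable (h : r.IsRun v B)
include h

/-! ### Bidders before and after their exit -/

theorem p_lt_of_le {s : ℝ} (hs : s ∈ Icc 0 t) (ht : t ≤ r.f) {c : ℝ} (hc : r.p t < c) :
    r.p s < c :=
  (h.p_mono hs.1 hs.2 ht).trans_lt hc

theorem drained_eq_zero (ht : t ∈ Icc 0 r.f) (hk : ∀ s ∈ Ico 0 t, r.p s < v k) :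
    r.drained B k t = 0 := by
  rw [eq_of_rightDeriv_zero ht.1 ((h.drained_cont k).mono (Icc_subset_Icc_right ht.2))
    (fun s hs => ?_), h.drained_zero]
  have := h.drained_deriv ⟨hs.1, hs.2.trans_le ht.2⟩ k
  rwa [drainRate_of_ne (hk s hs).ne'] at this

theorem P_add_b (ht : t ∈ Icc 0 r.f) (hk : ∀ s ∈ Ico 0 t, r.p s < v k) :
    r.P k t + r.b k t = B k := by
  have := h.drained_eq_zero ht hk
  unfold drained at this
  linarith

theorem P_eq_max (ht : t ∈ Icc 0 r.f) (hk : ∀ s ∈ Ico 0 t, r.p s < v k) :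
    r.P k t = max 0 (B k - r.residual t) := by
  have h1 := h.P_add_b ht hk
  rw [h.b_eq_min ht hk] at h1
  rcases le_total (B k) (r.residual t) with h2 | h2
  · rw [min_eq_left h2] at h1
    rw [max_eq_left (by linarith)]
    linarith
  · rw [min_eq_right h2] at h1
    rw [max_eq_right (by linarith)]
    linarith

theorem P_eq_of_exit {s t : ℝ} (hs : 0 ≤ s) (hst : s ≤ t) (ht : t ≤ r.f) (hk : v k ≤ r.p s) :
    r.P k t = r.P k s := by
  refine eq_of_rightDeriv_zero hst ((h.P_cont k).mono (Icc_subset_Icc hs ht)) (fun u hu => ?_)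
  have := h.P_deriv' ⟨hs.trans hu.1, hu.2.trans_le ht⟩ k
  rwa [clinchRate_of_le (hk.trans (h.p_mono hs hu.1 (hu.2.le.trans ht)))] at this

theorem exists_exit (ht : t ∈ Icc 0 r.f) (hk : v k ≤ r.p t) :
    ∃ s ∈ Icc 0 t, 0 < s ∧ r.p s = v k ∧ ∀ u ∈ Ico 0 s, r.p u < v k := by
  obtain ⟨s, hs, hs1, hs2⟩ := exists_first_reaching ht.1
    (h.p_cont.mono (Icc_subset_Icc_right ht.2)) hk
  have hs0 : 0 < s := by
    refine lt_of_le_of_ne hs.1 ?_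
    rintro rfl
    rw [h.p_zero] at hs1
    exact absurd hs1 (not_le.2 (h.v_pos k))
  refine ⟨s, hs, hs0, le_antisymm ?_ hs1, hs2⟩
  exact le_right_of_le_Ico hs0 (h.p_cont.mono (Icc_subset_Icc_right (hs.2.trans ht.2)))
    continuousOn_const (fun u hu => (hs2 u hu).le)

/-- A bidder who exits before the auction stops has paid nothing. -/
theorem P_eq_zero_of_exit (ht : t ∈ Ico 0 r.f) (hk : v k ≤ r.p t) : r.P k t = 0 := by
  obtain ⟨s, hs, -, hps, hs2⟩ := h.exists_exit ⟨ht.1, ht.2.le⟩ hk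
  have hsf : s ∈ Ico 0 r.f := ⟨hs.1, hs.2.trans_lt ht.2⟩
  have hsI : s ∈ Icc 0 r.f := ⟨hs.1, hsf.2.le⟩
  rw [h.P_eq_of_exit hs.1 hs.2 ht.2.le hps.ge, h.P_eq_max hsI hs2, max_eq_left]
  -- Before stopping, the budgets at the exit price together are below the residual, so the cap is
  -- not active for `k`.
  have h1 : r.b k s ≤ ∑ j with v j ≤ r.p s, r.b j s :=
    Finset.single_le_sum (f := fun j => r.b j s) (fun j _ => h.b_nonneg hsI j)
      (by simp [hps])
  have h2 := h.not_stops' hsf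
  have h3 := h.b_eq_min hsI hs2
  rcases le_total (B k) (r.residual s) with h4 | h4
  · linarith
  · rw [min_eq_right h4] at h3
    linarith

theorem P_eq_zero_of_lt (ht : t ∈ Icc 0 r.f) (hk : v k < r.p t) : r.P k t = 0 := by
  obtain ⟨s, hs, -, hps, hs2⟩ := h.exists_exit ht hk.le
  have hst : s < t := lt_of_le_of_ne hs.2 (by rintro rfl; exact hk.ne' hps)
  rw [h.P_eq_of_exit hs.1 hs.2 ht.2 hps.ge]
  exact h.P_eq_zero_of_exit ⟨hs.1, hst.trans_le ht.2⟩ hps.ge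

theorem drained_of_lt (ht : t ∈ Icc 0 r.f) (hk : v k < r.p t) : r.drained B k t = B k := by
  simp [drained, h.P_eq_zero_of_lt ht hk, h.b_eq_zero_of_lt ht hk]

/-- By monotonicity nothing was extracted on `[0, t]`, so the clinching rate vanishes before `t`,
and with it the rate of allocation. -/
theorem x_eq_zero (ht : t ∈ Icc 0 r.f) (hP : r.P k t = 0) : r.x k t = 0 := by
  have hP0 : ∀ s ∈ Icc 0 t, r.P k s = 0 := fun s hs =>
    le_antisymm (hP ▸ h.P_mono hs.1 hs.2 ht.2 k) (h.P_nonneg ⟨hs.1, hs.2.trans ht.2⟩ k)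
  rw [eq_of_rightDeriv_zero ht.1 ((h.x_cont k).mono (Icc_subset_Icc_right ht.2))
    (fun s hs => ?_), h.x_zero]
  have hsI : s ∈ Ico 0 r.f := ⟨hs.1, hs.2.trans_le ht.2⟩
  have h1 : RightDeriv (r.P k) 0 s :=
    RightDeriv.congr_Ico (g := fun _ => 0) (hasDerivWithinAt_const _ _ _) hs.2
      (fun u hu => hP0 u ⟨hs.1.trans hu.1, hu.2.le⟩)
  have h2 := h.x_deriv' hsI k
  rwa [(h.P_deriv' hsI k).unique h1, zero_div] at h2

/-! ### The final allocation -/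

theorem p_f_pos : 0 < r.p r.f := h.p_pos h.f_pos le_rfl

theorem f_mem : r.f ∈ Icc 0 r.f := ⟨h.f_nonneg, le_rfl⟩

/-- Each share is bounded by the demand and the shares add up to the total demand, so every bound is
attained. -/
theorem payment_of_active (hy : r.IsFinalAllocation v y) (hk : r.p r.f < v k) :
    r.p r.f * y k = r.b k r.f := by
  have hp := h.p_f_pos
  by_cases hb : 0 < r.b k r.f
  · have h1 : ∀ j ∈ r.A v r.f, y j ≤ r.b j r.f / r.p r.f := fun j _ => by
      rw [le_div_iff₀ hp, mul_comm]; exact hy.budget j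
    have h2 := (Finset.sum_eq_sum_iff_of_le h1).1 hy.active k (mem_A.2 ⟨hk, hb⟩)
    rw [h2]
    field_simp
  · have h0 : r.b k r.f = 0 := le_antisymm (not_lt.1 hb) (h.b_nonneg h.f_mem k)
    have h1 := hy.budget k
    have h2 := mul_nonneg hp.le (hy.nonneg k)
    linarith

omit h in
theorem final_eq_zero_of_lt (hy : r.IsFinalAllocation v y) (hk : v k < r.p r.f) : y k = 0 := by
  refine hy.others k (fun hA => ?_) (fun hE => ?_)
  · exact hk.not_gt (mem_A.1 hA).1
  · exact hk.ne (mem_E.1 hE).1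

theorem total_nonneg (hy : r.IsFinalAllocation v y) (k : Fin n) : 0 ≤ r.x k r.f + y k :=
  add_nonneg (h.x_nonneg h.f_mem k) (hy.nonneg k)

omit h in
theorem sum_total (hy : r.IsFinalAllocation v y) : ∑ k, (r.x k r.f + y k) = 1 := by
  have hdisj : Disjoint (r.A v r.f) (r.E v r.f) :=
    Finset.disjoint_left.2 fun k hA hE => (mem_A.1 hA).1.ne' (mem_E.1 hE).1
  have h1 : ∑ k, y k = ∑ k ∈ r.A v r.f ∪ r.E v r.f, y k := by
    symm
    refine Finset.sum_subset (Finset.subset_univ _) fun k _ hk => ?_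
    rw [Finset.mem_union, not_or] at hk
    exact hy.others k hk.1 hk.2
  rw [Finset.sum_add_distrib, h1, Finset.sum_union hdisj, hy.active, hy.exiting, S]
  ring

theorem payment_nonneg (hy : r.IsFinalAllocation v y) (k : Fin n) :
    0 ≤ r.P k r.f + r.p r.f * y k :=
  add_nonneg (h.P_nonneg h.f_mem k) (mul_nonneg h.p_f_pos.le (hy.nonneg k))

theorem payment_le (hy : r.IsFinalAllocation v y) (k : Fin n) :
    r.P k r.f + r.p r.f * y k ≤ B k := by
  have h1 := hy.budget k
  have h2 := h.drained_nonneg h.f_mem k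
  unfold drained at h2
  linarith

theorem payment_eq_of_active (hy : r.IsFinalAllocation v y) (hk : r.p r.f < v k) :
    r.P k r.f + r.p r.f * y k = B k := by
  rw [h.payment_of_active hy hk]
  exact h.P_add_b h.f_mem fun s hs => h.p_lt_of_le ⟨hs.1, hs.2.le⟩ le_rfl hk

theorem total_eq_zero_of_lt (hy : r.IsFinalAllocation v y) (hk : v k < r.p r.f) :
    r.x k r.f + y k = 0 := by
  rw [final_eq_zero_of_lt hy hk, h.x_eq_zero h.f_mem (h.P_eq_zero_of_lt h.f_mem hk), add_zero]

theorem total_eq_zero_of_payment (hy : r.IsFinalAllocation v y)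
    (hk : r.P k r.f + r.p r.f * y k = 0) : r.x k r.f + y k = 0 := by
  have h1 := h.P_nonneg h.f_mem k
  have h2 := mul_nonneg h.p_f_pos.le (hy.nonneg k)
  have h3 : y k = 0 := by
    have : r.p r.f * y k = 0 := by linarith
    simpa [h.p_f_pos.ne'] using this
  rw [h.x_eq_zero h.f_mem (by linarith), h3, add_zero]

theorem payment_eq_of_higher {j : Fin n} (hy : r.IsFinalAllocation v y)
    (hk : 0 < r.x k r.f + y k) (hj : v k < v j) : r.P j r.f + r.p r.f * y j = B j := by
  refine h.payment_eq_of_active hy (lt_of_le_of_lt ?_ hj)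
  by_contra hlt
  exact hk.ne' (h.total_eq_zero_of_lt hy (not_le.1 hlt))

/-! ### Bounds on the surplus -/

/-- A bidder who reports her valuation never loses from continuing. -/
theorem le_surplus (hy : r.IsFinalAllocation v y) (ht : t ∈ Icc 0 r.f) :
    v k * r.x k t - r.P k t ≤ r.surplus y (v k) k := by
  have h1 : v k * r.x k t - r.P k t ≤ v k * r.x k r.f - r.P k r.f := by
    refine le_of_rightDeriv_nonneg (g := fun s => v k * r.x k s - r.P k s) ht.2
      (((continuousOn_const.mul (h.x_cont k)).sub (h.P_cont k)).mono (Icc_subset_Icc_left ht.1))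
      (fun s hs => HasDerivWithinAt.fun_sub ((h.x_deriv' ⟨ht.1.trans hs.1, hs.2⟩ k).const_mul _)
        (h.P_deriv' ⟨ht.1.trans hs.1, hs.2⟩ k)) (fun s hs => ?_)
    have hs0 : 0 ≤ s := ht.1.trans hs.1
    -- Clinching takes place only at prices below `v k`, so it never lowers the surplus.
    rcases le_or_gt (v k) (r.p s) with hle | hlt
    · simp [clinchRate_of_le hle]
    rcases eq_or_lt_of_le hs0 with rfl | hs0'
    · simp [h.clinchRate_zero]
    have hp := h.p_pos hs0' hs.2.le
    have hc := h.clinchRate_nonneg ⟨hs0, hs.2.le⟩ k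
    have : v k * (r.clinchRate v k s / r.p s) - r.clinchRate v k s =
        r.clinchRate v k s * (v k - r.p s) / r.p s := by field_simp
    rw [this]
    exact div_nonneg (mul_nonneg hc (by linarith)) hp.le
  have h2 : r.p r.f * y k ≤ v k * y k := by
    rcases lt_or_ge (v k) (r.p r.f) with hlt | hle
    · simp [final_eq_zero_of_lt hy hlt]
    · exact mul_le_mul_of_nonneg_right hle (hy.nonneg k)
  unfold surplus
  linarith

theorem surplus_nonneg (hy : r.IsFinalAllocation v y) (k : Fin n) : 0 ≤ r.surplus y (v k) k := by
  have := h.le_surplus (k := k) hy ⟨le_rfl, h.f_nonneg⟩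
  simpa [h.x_zero, h.P_zero] using this

/-- With the whole budget spent, the past matters only through the gain; the form matches the upper
bound `surplus_le`. -/
theorem surplus_of_active (hy : r.IsFinalAllocation v y) (hk : r.p r.f < v k) (η : ℝ) :
    r.surplus y η k = η * r.gain k r.f + (η / r.p r.f - 1) * B k := by
  have hp := h.p_f_pos
  have h1 := h.payment_eq_of_active hy hk
  have h2 : y k = (B k - r.P k r.f) / r.p r.f := by
    field_simp
    linarith
  unfold surplus gain
  rw [h1, h2]
  field_simp
  ring

/-- All that is bought after time `t` costs at least the price at time `t`. -/
theorem surplus_le (hy : r.IsFinalAllocation v y) (ht0 : 0 < t) (htf : t ≤ r.f) {η : ℝ}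
    (hη : 0 ≤ η) (k : Fin n) :
    r.surplus y η k ≤ η * r.gain k t + (η / r.p t - 1) * (r.P k r.f + r.p r.f * y k) := by
  have hp := h.p_pos ht0 htf
  have h1 : r.P k t / r.p t - r.x k t ≤ r.P k r.f / r.p t - r.x k r.f := by
    refine le_of_rightDeriv_nonneg (g := fun s => r.P k s / r.p t - r.x k s) htf
      ((((h.P_cont k).div_const _).sub (h.x_cont k)).mono (Icc_subset_Icc_left ht0.le))
      (fun s hs => HasDerivWithinAt.fun_sub ((h.P_deriv' ⟨ht0.le.trans hs.1, hs.2⟩ k).div_const _)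
        (h.x_deriv' ⟨ht0.le.trans hs.1, hs.2⟩ k)) (fun s hs => ?_)
    have := div_le_div_of_nonneg_left (h.clinchRate_nonneg ⟨ht0.le.trans hs.1, hs.2.le⟩ k) hp
      (h.p_mono ht0.le hs.1 hs.2.le)
    linarith
  have h2 : y k ≤ r.p r.f * y k / r.p t := by
    rw [le_div_iff₀ hp, mul_comm]
    exact mul_le_mul_of_nonneg_right (h.p_mono ht0.le htf le_rfl) (hy.nonneg k)
  have h3 : r.x k r.f + y k ≤ r.gain k t + (r.P k r.f + r.p r.f * y k) / r.p t := by
    unfold gain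
    rw [add_div]
    linarith
  have h4 := mul_le_mul_of_nonneg_left h3 hη
  unfold surplus
  have h5 : η * (r.gain k t + (r.P k r.f + r.p r.f * y k) / r.p t) =
    η * r.gain k t + η / r.p t * (r.P k r.f + r.p r.f * y k) := by ring
  linarith

theorem gain_eq (ht0 : 0 < t) (htf : t ≤ r.f) (η : ℝ) (k : Fin n) :
    η * r.x k t - r.P k t = η * r.gain k t + (η / r.p t - 1) * r.P k t := by
  have hp := h.p_pos ht0 htf
  unfold gain
  field_simp
  ring

theorem gain_cont {s : ℝ} (hs : 0 < s) (k : Fin n) : ContinuousOn (r.gain k) (Icc s r.f) :=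
  ((h.x_cont k).mono (Icc_subset_Icc_left hs.le)).sub
    (((h.P_cont k).mono (Icc_subset_Icc_left hs.le)).div (h.p_cont.mono (Icc_subset_Icc_left hs.le))
      fun _ hu => (h.p_pos (hs.trans_le hu.1) hu.2).ne')

/-- Buying at the current price leaves the gain unchanged. Only the growth of the price, which
divides the past payments, contributes. -/
theorem gain_deriv (ht0 : 0 < t) (htf : t < r.f) (k : Fin n) :
    RightDeriv (r.gain k) ((if r.E v t = ∅ then 1 else 0) * (r.P k t / r.p t ^ 2)) t := by
  have hp := h.p_pos ht0 htf.le
  have := HasDerivWithinAt.fun_sub (h.x_deriv' ⟨ht0.le, htf⟩ k)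
    (HasDerivWithinAt.fun_div (h.P_deriv' ⟨ht0.le, htf⟩ k) (h.p_deriv' ⟨ht0.le, htf⟩) hp.ne')
  refine HasDerivWithinAt.congr_deriv this ?_
  field_simp
  ring

/-! ### The end of an exit phase and the beginning of the auction -/

theorem sum_exiting_eq (ht : t ∈ Icc 0 r.f) :
    ∑ k with v k ≤ r.p t, r.b k t = ∑ k with v k = r.p t, r.b k t := by
  symm
  refine Finset.sum_subset (fun k hk => ?_) (fun k hk hk' => ?_)
  · simp only [Finset.mem_filter, Finset.mem_univ, true_and] at hk ⊢
    exact hk.le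
  · simp only [Finset.mem_filter, Finset.mem_univ, true_and] at hk hk'
    exact h.b_eq_zero_of_lt ht (lt_of_le_of_ne hk hk')

/-- An exit phase that begins before the auction stops also ends before: at the last time with the
current price, the exiting bidders have lost their budgets, the residual has dropped by the same
amount and the gains are unchanged. -/
theorem exists_last_same_price (ht0 : 0 < t) (htf : t < r.f) :
    ∃ s ∈ Ico t r.f, r.p s = r.p t ∧ (∀ u ∈ Ioc s r.f, r.p t < r.p u) ∧
      (∀ k, r.gain k s = r.gain k t) ∧
      r.residual s = r.residual t - ∑ k with v k = r.p t, r.b k t := by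
  have hK : IsCompact (Icc t r.f ∩ r.p ⁻¹' Iic (r.p t)) :=
    isCompact_Icc.of_isClosed_subset ((h.p_cont.mono (Icc_subset_Icc_left
      ht0.le)).preimage_isClosed_of_isClosed isClosed_Icc isClosed_Iic) inter_subset_left
  obtain ⟨s, ⟨hsI, hsp⟩, hsm⟩ := hK.exists_isGreatest ⟨t, ⟨le_rfl, htf.le⟩, le_refl (r.p t)⟩
  have hps : ∀ u ∈ Icc t s, r.p u = r.p t := fun u hu => le_antisymm
    ((h.p_mono (ht0.le.trans hu.1) hu.2 hsI.2).trans hsp)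
    (h.p_mono ht0.le hu.1 (hu.2.trans hsI.2))
  have hE : ∀ u ∈ Ico t s, r.E v u ≠ ∅ := by
    intro u hu hE
    have h1 := h.p_deriv' ⟨ht0.le.trans hu.1, hu.2.trans_le hsI.2⟩
    rw [if_pos hE] at h1
    have h2 : RightDeriv r.p 0 u := RightDeriv.congr_Ico (g := fun _ => r.p t)
      (hasDerivWithinAt_const _ _ _) hu.2 (fun w hw => hps w ⟨hu.1.trans hw.1, hw.2.le⟩)
    exact one_ne_zero (h1.unique h2)
  have hgt : ∀ u ∈ Ioc s r.f, r.p t < r.p u := fun u hu => by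
    by_contra hcon
    exact absurd (hsm ⟨⟨hsI.1.trans hu.1.le, hu.2⟩, not_lt.1 hcon⟩) (not_le.2 hu.1)
  -- During the phase the residual and the exiting budgets both fall at unit rate.
  have hconst : r.residual s - ∑ k with v k = r.p t, r.b k s =
      r.residual t - ∑ k with v k = r.p t, r.b k t := by
    refine eq_of_rightDeriv_zero
      (g := fun u => r.residual u - ∑ k with v k = r.p t, r.b k u) hsI.1
      ((h.residual_cont.sub (continuousOn_finsetSum _ fun k _ => h.b_cont k)).mono
        (Icc_subset_Icc ht0.le hsI.2)) (fun u hu => ?_)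
    have huI : u ∈ Ico 0 r.f := ⟨ht0.le.trans hu.1, hu.2.trans_le hsI.2⟩
    have := HasDerivWithinAt.fun_sub (h.residual_deriv huI) (HasDerivWithinAt.fun_sum
      (u := {k | v k = r.p t}) fun k _ => h.b_deriv' huI k)
    refine HasDerivWithinAt.congr_deriv this ?_
    have hpu := hps u ⟨hu.1, hu.2.le⟩
    have h2 := sum_drainRate_of_nonempty (hE u hu) {k | v k = r.p t} (fun k hk => by
      simpa [hpu] using (mem_E.1 hk).1)
    rw [Finset.sum_sub_distrib, h2, rate, if_neg (hE u hu), Finset.sum_eq_zero]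
    · ring
    · intro k hk
      rw [clinchRate_of_le, neg_zero]
      rw [hpu]
      exact (Finset.mem_filter.1 hk).2.le
  -- The conserved difference is positive before stopping, while stopping at the same price would
  -- make it nonpositive.
  have hsf : s < r.f := by
    refine lt_of_le_of_ne hsI.2 ?_
    rintro rfl
    have h1 := h.not_stops' ⟨ht0.le, htf⟩
    have h2 := h.stops'
    rw [h.sum_exiting_eq ⟨ht0.le, htf.le⟩] at h1
    rw [h.sum_exiting_eq h.f_mem, hps _ ⟨hsI.1, le_rfl⟩] at h2
    linarith
  refine ⟨s, ⟨hsI.1, hsf⟩, hps s ⟨hsI.1, le_rfl⟩, hgt, fun k => ?_, ?_⟩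
  · refine eq_of_rightDeriv_zero hsI.1 ((h.gain_cont ht0 k).mono (Icc_subset_Icc_right hsI.2))
      (fun u hu => ?_)
    have := h.gain_deriv (ht0.trans_le hu.1) (hu.2.trans_le hsI.2) k
    rwa [if_neg (hE u hu), zero_mul] at this
  · have h2 : ∑ k with v k = r.p t, r.b k s = 0 := by
      refine Finset.sum_eq_zero fun k hk => ?_
      have h3 : ∀ u ∈ Ioc s r.f, r.b k u = 0 := fun u hu =>
        h.b_eq_zero_of_lt ⟨(ht0.le.trans hsI.1).trans hu.1.le, hu.2⟩
          ((Finset.mem_filter.1 hk).2 ▸ hgt u hu)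
      have hf0 := h3 _ ⟨hsf, le_rfl⟩
      exact (eq_left_of_eqOn_Ioc hsf ((h.b_cont k).mono
        (Icc_subset_Icc_left (ht0.le.trans hsI.1))) (fun u hu => hf0.trans (h3 u hu).symm)).trans hf0
    linarith

/-- Nobody clinches at the beginning. -/
theorem exists_initial_phase : ∃ ε, 0 < ε ∧ ε ≤ r.f ∧ ∀ t ∈ Icc 0 ε,
    (∀ k, r.P k t = 0 ∧ r.x k t = 0) ∧ r.residual t = ∑ k, B k - t := by
  -- With two bidders each budget starts strictly below the residual, and stays so for a while by
  -- continuity.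
  have hev : ∀ᶠ t in nhdsWithin 0 (Icc 0 r.f), ∀ k, r.b k t < r.residual t := by
    rw [Filter.eventually_all]
    intro k
    have h0 : (0 : ℝ) ∈ Icc 0 r.f := ⟨le_rfl, h.f_nonneg⟩
    refine (h.b_cont k 0 h0).eventually_lt (h.residual_cont 0 h0) ?_
    rw [h.b_zero, h.residual_zero]
    exact h.lt_sum_B k
  rw [nhdsWithin_Icc_eq_nhdsGE h.f_pos] at hev
  obtain ⟨u, hu, hu'⟩ := (mem_nhdsGE_iff_exists_Ico_subset' h.f_pos).1 hev
  have hu0 : 0 < u := hu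
  refine ⟨min u r.f, lt_min hu0 h.f_pos, min_le_right _ _, fun t ht => ?_⟩
  have htf : t ≤ r.f := ht.2.trans (min_le_right _ _)
  have hP : ∀ k, r.P k t = 0 := fun k => by
    rw [eq_of_rightDeriv_zero ht.1 ((h.P_cont k).mono (Icc_subset_Icc_right htf)) (fun s hs => ?_),
      h.P_zero]
    have h1 := h.P_deriv' ⟨hs.1, hs.2.trans_le htf⟩ k
    have h2 : r.b k s < r.residual s :=
      hu' ⟨hs.1, hs.2.trans_le (ht.2.trans (min_le_left _ _))⟩ k
    have h3 : r.clinchRate v k s = 0 := by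
      simp [clinchRate, mem_C, h2.ne]
    rwa [h3] at h1
  have hx : ∀ k, r.x k t = 0 := fun k => h.x_eq_zero ⟨ht.1, htf⟩ (hP k)
  refine ⟨fun k => ⟨hP k, hx k⟩, ?_⟩
  have h1 := h.p_add_sum_drained ⟨ht.1, htf⟩
  unfold residual S
  simp only [drained, hP, hx, Finset.sum_sub_distrib, Finset.sum_const_zero] at h1 ⊢
  linarith

end IsRun

end Trajectory

namespace Trajectory

open Set

namespace IsRun

variable {n : ℕ} {v B v' B' : Fin n → ℝ} {r r' : Trajectory n} {t : ℝ} {i : Fin n}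
  {y y' : Fin n → ℝ}

/-! ### Comparison of two runs that differ in the report of one bidder -/

/-- Whoever has exited at the lower price lies strictly below the higher price, hence is fully
drained in the second run; everyone else, including `i`, has lost nothing in the first. -/
theorem drained_le_drained (h : r.IsRun v B) (h' : r'.IsRun v' B') (hv : ∀ k, k ≠ i → v k = v' k)
    (hB : ∀ k, k ≠ i → B k = B' k) (ht : t ∈ Icc 0 r.f) (ht' : t ∈ Icc 0 r'.f)
    (hi : ∀ s ∈ Ico 0 t, r.p s < v i) (hp : r.p t < r'.p t) (k : Fin n) :
    r.drained B k t ≤ r'.drained B' k t := by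
  by_cases hk : k = i
  · rw [hk, h.drained_eq_zero ht hi]
    exact h'.drained_nonneg ht' i
  rcases le_or_gt (v k) (r.p t) with hle | hlt
  · rw [h'.drained_of_lt ht' (hv k hk ▸ hle.trans_lt hp), ← hB k hk]
    exact h.drained_le ht k
  · rw [h.drained_eq_zero ht fun s hs => h.p_lt_of_le ⟨hs.1, hs.2.le⟩ ht.2 hlt]
    exact h'.drained_nonneg ht' k

/-- Otherwise the second run would have, at the same time, a higher price and at least as much
destroyed budget, against `p_add_sum_drained`. -/
theorem p_le_p (h : r.IsRun v B) (h' : r'.IsRun v' B') (hv : ∀ k, k ≠ i → v k = v' k)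
    (hB : ∀ k, k ≠ i → B k = B' k) (ht : t ∈ Icc 0 r.f) (ht' : t ∈ Icc 0 r'.f)
    (hi : ∀ s ∈ Ico 0 t, r.p s < v i) : r'.p t ≤ r.p t := by
  by_contra hlt
  have h1 := Finset.sum_le_sum (s := Finset.univ) fun k _ =>
    h.drained_le_drained h' hv hB ht ht' hi (not_le.1 hlt) k
  have h2 := h.p_add_sum_drained ht
  have h3 := h'.p_add_sum_drained ht'
  linarith

/-- The price path does not depend on the report of a bidder who has not exited. -/
theorem p_eq_p (h : r.IsRun v B) (h' : r'.IsRun v' B') (hv : ∀ k, k ≠ i → v k = v' k)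
    (hB : ∀ k, k ≠ i → B k = B' k) (ht : t ∈ Icc 0 r.f) (ht' : t ∈ Icc 0 r'.f)
    (hi : ∀ s ∈ Ico 0 t, r.p s < v i) (hi' : ∀ s ∈ Ico 0 t, r'.p s < v' i) : r.p t = r'.p t :=
  le_antisymm
    (h'.p_le_p h (fun k hk => (hv k hk).symm) (fun k hk => (hB k hk).symm) ht' ht hi')
    (h.p_le_p h' hv hB ht ht' hi)

/-- The total destroyed is time minus price in both runs. Away from the current price a budget is
intact or wholly destroyed, in the same way in both. -/
theorem sum_drained_eq (h : r.IsRun v B) (h' : r'.IsRun v' B') (hv : ∀ k, k ≠ i → v k = v' k)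
    (hB : ∀ k, k ≠ i → B k = B' k) (ht : t ∈ Icc 0 r.f) (ht' : t ∈ Icc 0 r'.f)
    (hi : ∀ s ∈ Ico 0 t, r.p s < v i) (hi' : ∀ s ∈ Ico 0 t, r'.p s < v' i) :
    ∑ k with k ≠ i ∧ v k = r.p t, r.drained B k t =
      ∑ k with k ≠ i ∧ v k = r.p t, r'.drained B' k t := by
  have hp := h.p_eq_p h' hv hB ht ht' hi hi'
  have h2 := h.p_add_sum_drained ht
  have h3 := h'.p_add_sum_drained ht'
  rw [← Finset.sum_filter_add_sum_filter_not Finset.univ (fun k => k ≠ i ∧ v k = r.p t)] at h2 h3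
  have h4 : ∑ k with ¬ (k ≠ i ∧ v k = r.p t), r.drained B k t =
      ∑ k with ¬ (k ≠ i ∧ v k = r.p t), r'.drained B' k t := by
    refine Finset.sum_congr rfl fun k hk => ?_
    have hk := (Finset.mem_filter.1 hk).2
    by_cases hki : k = i
    · rw [hki, h.drained_eq_zero ht hi, h'.drained_eq_zero ht' hi']
    · have hne : v k ≠ r.p t := fun hvk => hk ⟨hki, hvk⟩
      rcases lt_or_gt_of_ne hne with hlt | hlt
      · rw [h.drained_of_lt ht hlt, h'.drained_of_lt ht' (by rw [← hv k hki, ← hp]; exact hlt),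
          hB k hki]
      · rw [h.drained_eq_zero ht fun s hs => h.p_lt_of_le ⟨hs.1, hs.2.le⟩ ht.2 hlt,
          h'.drained_eq_zero ht' fun s hs => h'.p_lt_of_le ⟨hs.1, hs.2.le⟩ ht'.2
            (by rw [← hv k hki, ← hp]; exact hlt)]
  linarith

/-- The budgets of the other exiting bidders do not depend on the report of a bidder who has not
exited. -/
theorem sum_exiting_le (h : r.IsRun v B) (h' : r'.IsRun v' B') (hv : ∀ k, k ≠ i → v k = v' k)
    (hB : ∀ k, k ≠ i → B k = B' k) (ht : t ∈ Ico 0 r.f) (ht' : t ∈ Icc 0 r'.f)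
    (hi : ∀ s ∈ Ico 0 t, r.p s < v i) (hi' : ∀ s ∈ Ico 0 t, r'.p s < v' i) :
    ∑ k with k ≠ i ∧ v k = r.p t, r'.b k t ≤ ∑ k with k ≠ i ∧ v k = r.p t, r.b k t := by
  have h1 := h.sum_drained_eq h' hv hB ⟨ht.1, ht.2.le⟩ ht' hi hi'
  -- The first run has not stopped, so its exiting bidders have paid nothing. The second may stop at
  -- `t`, and then they may have paid, whence only an inequality.
  have h2 : ∑ k with k ≠ i ∧ v k = r.p t, r.b k t =
      ∑ k with k ≠ i ∧ v k = r.p t, (B k - r.drained B k t) := by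
    refine Finset.sum_congr rfl fun k hk => ?_
    have hk := (Finset.mem_filter.1 hk).2
    simp [drained, h.P_eq_zero_of_exit ht hk.2.le]
  have h3 : ∑ k with k ≠ i ∧ v k = r.p t, r'.b k t ≤
      ∑ k with k ≠ i ∧ v k = r.p t, (B k - r'.drained B' k t) := by
    refine Finset.sum_le_sum fun k hk => ?_
    have hk := (Finset.mem_filter.1 hk).2
    have := h'.P_nonneg ht' k
    rw [hB k hk.1]
    unfold drained
    linarith
  rw [Finset.sum_sub_distrib] at h2 h3
  linarith

theorem E_eq_empty_of_E_eq_empty (h : r.IsRun v B) (h' : r'.IsRun v' B')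
    (hv : ∀ k, k ≠ i → v k = v' k) (hB : ∀ k, k ≠ i → B k = B' k) (ht : t ∈ Ico 0 r.f)
    (ht' : t ∈ Ico 0 r'.f) (hi : r.p t < v i) (hi' : r'.p t < v' i) (hE : r.E v t = ∅) :
    r'.E v' t = ∅ := by
  have hI : t ∈ Icc 0 r.f := ⟨ht.1, ht.2.le⟩
  have hI' : t ∈ Icc 0 r'.f := ⟨ht'.1, ht'.2.le⟩
  have hs : ∀ s ∈ Ico 0 t, r.p s < v i := fun s hs => h.p_lt_of_le ⟨hs.1, hs.2.le⟩ ht.2.le hi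
  have hs' : ∀ s ∈ Ico 0 t, r'.p s < v' i := fun s hs =>
    h'.p_lt_of_le ⟨hs.1, hs.2.le⟩ ht'.2.le hi'
  have hp := h.p_eq_p h' hv hB hI hI' hs hs'
  have h1 := h.sum_exiting_le h' hv hB ht hI' hs hs'
  have h2 : ∑ k with k ≠ i ∧ v k = r.p t, r.b k t = 0 := by
    refine Finset.sum_eq_zero fun k hk => le_antisymm (not_lt.1 fun hb => ?_) (h.b_nonneg hI k)
    have : k ∈ r.E v t := mem_E.2 ⟨(Finset.mem_filter.1 hk).2.2, hb⟩
    simp [hE] at this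
  ext k
  simp only [mem_E, Finset.notMem_empty, iff_false, not_and, not_lt]
  intro hk
  have hki : k ≠ i := by rintro rfl; exact hi'.ne' hk
  rw [h2] at h1
  refine le_trans ?_ h1
  exact Finset.single_le_sum (f := fun k => r'.b k t) (fun j _ => h'.b_nonneg hI' j)
    (by simp [hki, hv k hki, hp, hk])

/-- If the residual minus the budget of bidder `i` is at least as large in the first run, then it
decreases at least as fast relative to the price. -/
theorem S_sub_S_le (h : r.IsRun v B) (h' : r'.IsRun v' B') (hv : ∀ k, k ≠ i → v k = v' k)
    (hB : ∀ k, k ≠ i → B k = B' k) (hBi : B' i ≤ B i) (ht : t ∈ Ico 0 r.f) (ht' : t ∈ Ico 0 r'.f)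
    (hi : r.p t < v i) (hi' : r'.p t < v' i) (hE : r.E v t = ∅)
    (hw : r'.residual t - B' i ≤ r.residual t - B i) :
    r.p t * (r'.S t - r.S t) ≤ (r.residual t - B i) - (r'.residual t - B' i) := by
  have hI : t ∈ Icc 0 r.f := ⟨ht.1, ht.2.le⟩
  have hI' : t ∈ Icc 0 r'.f := ⟨ht'.1, ht'.2.le⟩
  have hs : ∀ s ∈ Ico 0 t, r.p s < v i := fun s hs => h.p_lt_of_le ⟨hs.1, hs.2.le⟩ ht.2.le hi
  have hs' : ∀ s ∈ Ico 0 t, r'.p s < v' i := fun s hs =>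
    h'.p_lt_of_le ⟨hs.1, hs.2.le⟩ ht'.2.le hi'
  have hp := h.p_eq_p h' hv hB hI hI' hs hs'
  have hE' := h.E_eq_empty_of_E_eq_empty h' hv hB ht ht' hi hi' hE
  -- `hw` and `hBi` make the residual larger in the first run, so the cap leaves the others at least
  -- as much there.
  have hb : ∀ k, k ≠ i → r'.b k t ≤ r.b k t := by
    intro k hk
    rcases lt_trichotomy (v k) (r.p t) with hlt | heq | hgt
    · rw [h'.b_eq_zero_of_lt hI' (by rw [← hv k hk, ← hp]; exact hlt)]
      exact h.b_nonneg hI k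
    · refine le_trans (not_lt.1 fun hb => ?_) (h.b_nonneg hI k)
      have : k ∈ r'.E v' t := mem_E.2 ⟨by rw [← hv k hk, ← hp, heq], hb⟩
      simp [hE'] at this
    · rw [h.b_eq_min hI fun s hs => h.p_lt_of_le ⟨hs.1, hs.2.le⟩ ht.2.le hgt,
        h'.b_eq_min hI' fun s hs => h'.p_lt_of_le ⟨hs.1, hs.2.le⟩ ht'.2.le
          (by rw [← hv k hk, ← hp]; exact hgt), hB k hk]
      exact min_le_min_left _ (by linarith)
  have hsum : ∑ k with k ≠ i, r'.b k t ≤ ∑ k with k ≠ i, r.b k t :=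
    Finset.sum_le_sum fun k hk => hb k (Finset.mem_filter.1 hk).2
  rw [sum_ne_eq, sum_ne_eq, h.b_eq_min hI hs, h'.b_eq_min hI' hs'] at hsum
  have h1 : r.residual t = ∑ k, r.b k t - r.p t * r.S t := rfl
  have h2 : r'.residual t = ∑ k, r'.b k t - r.p t * r'.S t := by rw [hp]; rfl
  -- The left side is the difference of the positive parts of the two excesses; by `hw` it is at
  -- most the difference of the excesses.
  have h3 : min (B' i) (r'.residual t) - r'.residual t - (min (B i) (r.residual t) - r.residual t) ≤
      (r.residual t - B i) - (r'.residual t - B' i) := by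
    rcases le_total (B i) (r.residual t) with h4 | h4 <;>
    rcases le_total (B' i) (r'.residual t) with h5 | h5 <;>
    simp only [min_eq_left, min_eq_right, h4, h5] <;> linarith
  linarith

/-- Up to the first exit or stop, a higher reported budget lowers the residual in excess of the
budget. -/
theorem residual_sub_le (h : r.IsRun v B) (h' : r'.IsRun v' B') (hv : ∀ k, k ≠ i → v k = v' k)
    (hB : ∀ k, k ≠ i → B k = B' k) (hBi : B' i ≤ B i) (ht : t ∈ Icc 0 r.f) (ht' : t ∈ Icc 0 r'.f)
    (hi : ∀ s ∈ Ico 0 t, r.p s < v i) (hi' : ∀ s ∈ Ico 0 t, r'.p s < v' i) :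
    r.residual t - B i ≤ r'.residual t - B' i := by
  obtain ⟨ε, hε, hεf, h0⟩ := h.exists_initial_phase
  obtain ⟨ε', hε', hεf', h0'⟩ := h'.exists_initial_phase
  have hsum : ∑ k, B k - B i = ∑ k, B' k - B' i := by
    rw [← sum_ne_eq, ← sum_ne_eq]
    exact Finset.sum_congr rfl fun k hk => hB k (Finset.mem_filter.1 hk).2
  have hinit : ∀ s ∈ Icc 0 (min ε ε'), r.residual s - B i = r'.residual s - B' i := fun s hs => by
    rw [(h0 s ⟨hs.1, hs.2.trans (min_le_left _ _)⟩).2,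
      (h0' s ⟨hs.1, hs.2.trans (min_le_right _ _)⟩).2]
    linarith
  rcases le_total t (min ε ε') with hle | hle
  · exact (hinit t ⟨ht.1, hle⟩).le
  have hε0 : 0 < min ε ε' := lt_min hε hε'
  have hp0 : ∀ s ∈ Icc (min ε ε') t, 0 < r.p s := fun s hs =>
    h.p_pos (hε0.trans_le hs.1) (hs.2.trans ht.2)
  have hc1 : Icc (min ε ε') t ⊆ Icc 0 r.f := Icc_subset_Icc hε0.le ht.2
  have hc2 : Icc (min ε ε') t ⊆ Icc 0 r'.f := Icc_subset_Icc hε0.le ht'.2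
  -- `S_sub_S_le` bounds the slope of the difference by the difference over the price. This is what
  -- dividing by the price absorbs, and why the barrier starts at a positive time at which the
  -- difference is still zero.
  have key := nonpos_of_barrier
    (g := fun s => ((r.residual s - B i) - (r'.residual s - B' i)) / r.p s)
    (g' := fun s => ((-r.rate v s - -r'.rate v' s) * r.p s -
      ((r.residual s - B i) - (r'.residual s - B' i)) * (if r.E v s = ∅ then 1 else 0)) /
        r.p s ^ 2) hle
    ((((h.residual_cont.mono hc1).sub continuousOn_const).sub
      ((h'.residual_cont.mono hc2).sub continuousOn_const)).div (h.p_cont.mono hc1)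
        fun s hs => (hp0 s hs).ne')
    (fun s hs => HasDerivWithinAt.fun_div (HasDerivWithinAt.fun_sub
      (HasDerivWithinAt.sub_const (B i) (h.residual_deriv ⟨hε0.le.trans hs.1, hs.2.trans_le ht.2⟩))
      (HasDerivWithinAt.sub_const (B' i)
        (h'.residual_deriv ⟨hε0.le.trans hs.1, hs.2.trans_le ht'.2⟩)))
      (h.p_deriv' ⟨hε0.le.trans hs.1, hs.2.trans_le ht.2⟩) (hp0 s ⟨hs.1, hs.2.le⟩).ne')
    (by simp [hinit _ ⟨hε0.le, le_rfl⟩])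
    (by
      intro s hs hg
      have hs0 : 0 ≤ s := hε0.le.trans hs.1
      have hp := hp0 s ⟨hs.1, hs.2.le⟩
      have hsf : s ∈ Ico 0 r.f := ⟨hs0, hs.2.trans_le ht.2⟩
      have hsf' : s ∈ Ico 0 r'.f := ⟨hs0, hs.2.trans_le ht'.2⟩
      have hw : 0 ≤ (r.residual s - B i) - (r'.residual s - B' i) := by
        by_contra hneg
        exact absurd hg (not_le.2 (div_neg_of_neg_of_pos (not_le.1 hneg) hp))
      refine div_nonpos_of_nonpos_of_nonneg ?_ (sq_nonneg _)
      by_cases hE : r.E v s = ∅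
      · have hE' := h.E_eq_empty_of_E_eq_empty h' hv hB hsf hsf' (hi s ⟨hs0, hs.2⟩)
          (hi' s ⟨hs0, hs.2⟩) hE
        have := h.S_sub_S_le h' hv hB hBi hsf hsf' (hi s ⟨hs0, hs.2⟩) (hi' s ⟨hs0, hs.2⟩) hE
          (by linarith)
        rw [rate, rate, if_pos hE, if_pos hE, if_pos hE']
        linarith
      · have hE' : r'.E v' s ≠ ∅ := fun hE' => hE <| h'.E_eq_empty_of_E_eq_empty h
          (fun k hk => (hv k hk).symm) (fun k hk => (hB k hk).symm) hsf' hsf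
          (hi' s ⟨hs0, hs.2⟩) (hi s ⟨hs0, hs.2⟩) hE'
        rw [rate, rate, if_neg hE, if_neg hE, if_neg hE']
        linarith)
  by_contra hcon
  exact absurd key (not_le.2 (div_pos (by linarith) (hp0 t ⟨hle, le_rfl⟩)))

theorem P_le_P (h : r.IsRun v B) (h' : r'.IsRun v' B') (hv : ∀ k, k ≠ i → v k = v' k)
    (hB : ∀ k, k ≠ i → B k = B' k) (hBi : B' i ≤ B i) (ht : t ∈ Icc 0 r.f) (ht' : t ∈ Icc 0 r'.f)
    (hi : ∀ s ∈ Ico 0 t, r.p s < v i) (hi' : ∀ s ∈ Ico 0 t, r'.p s < v' i) :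
    r'.P i t ≤ r.P i t := by
  rw [h.P_eq_max ht hi, h'.P_eq_max ht' hi']
  have := h.residual_sub_le h' hv hB hBi ht ht' hi hi'
  exact max_le_max_left _ (by linarith)

theorem gain_le_gain (h : r.IsRun v B) (h' : r'.IsRun v' B') (hv : ∀ k, k ≠ i → v k = v' k)
    (hB : ∀ k, k ≠ i → B k = B' k) (hBi : B' i ≤ B i) (ht : t ∈ Icc 0 r.f) (ht' : t ∈ Icc 0 r'.f)
    (hi : ∀ s ∈ Ico 0 t, r.p s < v i) (hi' : ∀ s ∈ Ico 0 t, r'.p s < v' i) :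
    r'.gain i t ≤ r.gain i t := by
  obtain ⟨ε, hε, hεf, h0⟩ := h.exists_initial_phase
  obtain ⟨ε', hε', hεf', h0'⟩ := h'.exists_initial_phase
  have hinit : ∀ s ∈ Icc 0 (min ε ε'), r.gain i s = 0 ∧ r'.gain i s = 0 := fun s hs => by
    have h1 := (h0 s ⟨hs.1, hs.2.trans (min_le_left _ _)⟩).1 i
    have h2 := (h0' s ⟨hs.1, hs.2.trans (min_le_right _ _)⟩).1 i
    simp [gain, h1, h2]
  rcases le_total t (min ε ε') with hle | hle
  · obtain ⟨h1, h2⟩ := hinit t ⟨ht.1, hle⟩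
    rw [h1, h2]
  have hε0 : 0 < min ε ε' := lt_min hε hε'
  obtain ⟨h1, h2⟩ := hinit _ ⟨hε0.le, le_rfl⟩
  have key := le_of_rightDeriv_nonneg (g := fun s => r.gain i s - r'.gain i s) hle
    (((h.gain_cont hε0 i).mono (Icc_subset_Icc_right ht.2)).sub
      ((h'.gain_cont hε0 i).mono (Icc_subset_Icc_right ht'.2)))
    (fun s hs => HasDerivWithinAt.fun_sub
      (h.gain_deriv (hε0.trans_le hs.1) (hs.2.trans_le ht.2) i)
      (h'.gain_deriv (hε0.trans_le hs.1) (hs.2.trans_le ht'.2) i))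
    (fun s hs => by
      have hs0 : 0 ≤ s := hε0.le.trans hs.1
      have hsf : s ∈ Ico 0 r.f := ⟨hs0, hs.2.trans_le ht.2⟩
      have hsf' : s ∈ Ico 0 r'.f := ⟨hs0, hs.2.trans_le ht'.2⟩
      have hI : s ∈ Icc 0 r.f := ⟨hs0, hsf.2.le⟩
      have hI' : s ∈ Icc 0 r'.f := ⟨hs0, hsf'.2.le⟩
      have hj : ∀ u ∈ Ico 0 s, r.p u < v i := fun u hu => hi u ⟨hu.1, hu.2.trans hs.2⟩
      have hj' : ∀ u ∈ Ico 0 s, r'.p u < v' i := fun u hu => hi' u ⟨hu.1, hu.2.trans hs.2⟩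
      by_cases hE : r.E v s = ∅
      · have hE' := h.E_eq_empty_of_E_eq_empty h' hv hB hsf hsf' (hi s ⟨hs0, hs.2⟩)
          (hi' s ⟨hs0, hs.2⟩) hE
        rw [if_pos hE, if_pos hE', ← h.p_eq_p h' hv hB hI hI' hj hj', one_mul, one_mul, sub_nonneg]
        have := h.P_le_P h' hv hB hBi hI hI' hj hj'
        gcongr
      · have hE' : r'.E v' s ≠ ∅ := fun hE' => hE <| h'.E_eq_empty_of_E_eq_empty h
          (fun k hk => (hv k hk).symm) (fun k hk => (hB k hk).symm) hsf' hsf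
          (hi' s ⟨hs0, hs.2⟩) (hi s ⟨hs0, hs.2⟩) hE'
        rw [if_neg hE, if_neg hE']
        simp)
  simp only [h1, h2] at key
  linarith

/-- A bidder pays at most what the others' exiting budgets release when the auction stops. -/
theorem payment_le_at_end (h : r.IsRun v B) (hy : r.IsFinalAllocation v y)
    (hi : ∀ s ∈ Ico 0 r.f, r.p s < v i) :
    r.P i r.f + r.p r.f * y i ≤
      B i - r.residual r.f + ∑ k with k ≠ i ∧ v k = r.p r.f, r.b k r.f := by
  have hPb := h.P_add_b h.f_mem hi
  have hle_end := h.stops'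
  rw [h.sum_exiting_eq h.f_mem] at hle_end
  -- An exiting bidder gets at most all that the exiting bidders share, worth their budgets minus
  -- the residual. Otherwise her own budget constraint and the stopping condition suffice.
  by_cases hE : i ∈ r.E v r.f
  · have h1 := hy.exiting
    have h2 : r.p r.f * ∑ k ∈ r.E v r.f, y k =
        r.p r.f * r.S r.f - ∑ k ∈ r.A v r.f, r.b k r.f := by
      rw [h1, mul_sub, Finset.mul_sum]
      congr 1
      refine Finset.sum_congr rfl fun k _ => ?_
      field_simp [h.p_f_pos.ne']
    have h3 := h.sum_b_eq h.f_mem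
    rw [h.sum_exiting_eq h.f_mem] at h3
    have h4 : r.p r.f * y i ≤ r.p r.f * ∑ k ∈ r.E v r.f, y k :=
      mul_le_mul_of_nonneg_left (Finset.single_le_sum (fun k _ => hy.nonneg k) hE) h.p_f_pos.le
    have h5 : ∑ k with v k = r.p r.f, r.b k r.f =
        r.b i r.f + ∑ k with k ≠ i ∧ v k = r.p r.f, r.b k r.f := by
      rw [← Finset.add_sum_erase _ _ (show i ∈ ({k | v k = r.p r.f} : Finset (Fin n)) by
        simpa using (mem_E.1 hE).1)]
      congr 1
      refine Finset.sum_congr ?_ fun _ _ => rfl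
      ext k
      simp
    have h6 : r.residual r.f = ∑ k, r.b k r.f - r.p r.f * r.S r.f := rfl
    linarith
  · have h5 : ∑ k with v k = r.p r.f, r.b k r.f =
        ∑ k with k ≠ i ∧ v k = r.p r.f, r.b k r.f := by
      symm
      refine Finset.sum_subset (fun k hk => ?_) (fun k hk hk' => ?_)
      · simp only [Finset.mem_filter, Finset.mem_univ, true_and] at hk ⊢
        exact hk.2
      · simp only [Finset.mem_filter, Finset.mem_univ, true_and] at hk hk'
        have hki : k = i := by
          by_contra hne
          exact hk' ⟨hne, hk⟩
        subst hki
        exact le_antisymm (not_lt.1 fun hb => hE (mem_E.2 ⟨hk, hb⟩)) (h.b_nonneg h.f_mem k)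
    have := hy.budget i
    linarith

/-- In the deterministic auction no report with a budget at most the true one is better than the
true report. -/
theorem surplus_le_surplus (h : r.IsRun v B) (h' : r'.IsRun v' B')
    (hv : ∀ k, k ≠ i → v k = v' k) (hB : ∀ k, k ≠ i → B k = B' k) (hBi : B' i ≤ B i)
    (hy : r.IsFinalAllocation v y) (hy' : r'.IsFinalAllocation v' y') :
    r'.surplus y' (v i) i ≤ r.surplus y (v i) i := by
  -- the first time at which a run stops or bidder `i` exits
  have hf := h.f_pos
  have hf' := h'.f_pos
  have hM0 : 0 ≤ min r.f r'.f := (lt_min hf hf').le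
  have hc1 : ContinuousOn r.p (Icc 0 (min r.f r'.f)) :=
    h.p_cont.mono (Icc_subset_Icc_right (min_le_left _ _))
  have hc2 : ContinuousOn r'.p (Icc 0 (min r.f r'.f)) :=
    h'.p_cont.mono (Icc_subset_Icc_right (min_le_right _ _))
  obtain ⟨σ, hσI, hσ, hlt⟩ : ∃ σ ∈ Icc 0 (min r.f r'.f),
      (σ = min r.f r'.f ∨ v i ≤ r.p σ ∨ v' i ≤ r'.p σ) ∧
      ∀ s ∈ Ico 0 σ, r.p s < v i ∧ r'.p s < v' i := by
    by_cases hex : 0 ≤ max (r.p (min r.f r'.f) - v i) (r'.p (min r.f r'.f) - v' i)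
    · obtain ⟨σ, hσ, h1, h2⟩ := exists_first_reaching hM0
        (g := fun s => max (r.p s - v i) (r'.p s - v' i))
        ((hc1.sub continuousOn_const).sup (hc2.sub continuousOn_const)) hex
      refine ⟨σ, hσ, Or.inr ?_, fun s hs => ?_⟩
      · rcases le_max_iff.1 h1 with h3 | h3
        · exact Or.inl (by linarith)
        · exact Or.inr (by linarith)
      · obtain ⟨h3, h4⟩ := max_lt_iff.1 (h2 s hs)
        exact ⟨by linarith, by linarith⟩
    · obtain ⟨h3, h4⟩ := max_lt_iff.1 (not_le.1 hex)
      refine ⟨min r.f r'.f, ⟨hM0, le_rfl⟩, Or.inl rfl, fun s hs => ⟨?_, ?_⟩⟩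
      · exact h.p_lt_of_le ⟨hs.1, hs.2.le⟩ (min_le_left _ _) (by linarith)
      · exact h'.p_lt_of_le ⟨hs.1, hs.2.le⟩ (min_le_right _ _) (by linarith)
  have hσf : σ ≤ r.f := hσI.2.trans (min_le_left _ _)
  have hσf' : σ ≤ r'.f := hσI.2.trans (min_le_right _ _)
  have hi : ∀ s ∈ Ico 0 σ, r.p s < v i := fun s hs => (hlt s hs).1
  have hi' : ∀ s ∈ Ico 0 σ, r'.p s < v' i := fun s hs => (hlt s hs).2
  have hσ0 : 0 < σ := by
    refine lt_of_le_of_ne hσI.1 ?_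
    rintro rfl
    rcases hσ with h1 | h1 | h1
    · exact (lt_min hf hf').ne h1
    · exact absurd h1 (not_le.2 (by rw [h.p_zero]; exact h.v_pos i))
    · exact absurd h1 (not_le.2 (by rw [h'.p_zero]; exact h'.v_pos i))
  have hI : σ ∈ Icc 0 r.f := ⟨hσ0.le, hσf⟩
  have hI' : σ ∈ Icc 0 r'.f := ⟨hσ0.le, hσf'⟩
  have hp := h.p_eq_p h' hv hB hI hI' hi hi'
  have hq0 := h.p_pos hσ0 hσf
  have hqv : r.p σ ≤ v i := le_right_of_le_Ico hσ0 (h.p_cont.mono (Icc_subset_Icc_right hσf))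
    continuousOn_const fun s hs => (hi s hs).le
  have hgain := mul_le_mul_of_nonneg_left (h.gain_le_gain h' hv hB hBi hI hI' hi hi')
    (h.v_pos i).le
  have hub := h'.surplus_le hy' hσ0 hσf' (h.v_pos i).le i
  rw [← hp] at hub
  have hpay : r'.P i r'.f + r'.p r'.f * y' i ≤ B i := (h'.payment_le hy' i).trans hBi
  have hfac : 0 ≤ v i / r.p σ - 1 := by
    rw [sub_nonneg, le_div_iff₀ hq0]; linarith
  rcases eq_or_lt_of_le hqv with hq | hq
  · -- the price has reached the true valuation
    have h1 := h.le_surplus (k := i) hy hI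
    rw [h.gain_eq hσ0 hσf, hq, div_self (h.v_pos i).ne'] at h1
    rw [hq, div_self (h.v_pos i).ne'] at hub
    linarith
  rcases eq_or_lt_of_le hσf with hσr | hσr
  · -- the truthful run stops
    have h1 := h.surplus_of_active (y := y) hy (hσr ▸ hq) (v i)
    rw [← hσr] at h1
    have := mul_le_mul_of_nonneg_left hpay hfac
    linarith
  rcases eq_or_lt_of_le hσf' with hσr' | hσr'
  · -- the other run stops
    obtain ⟨s, hs, hps, -, hg, hres⟩ := h.exists_last_same_price hσ0 hσr
    have hs0 : 0 < s := hσ0.trans_le hs.1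
    have h1 := h.le_surplus (k := i) hy ⟨hs0.le, hs.2.le⟩
    rw [h.gain_eq hs0 hs.2.le, hps, hg] at h1
    -- The stopping run can still collect what the exiting budgets of the others release. In the
    -- truthful run, by the end `s` of the exit phase, the residual has dropped by at least as much,
    -- so the payment up to `s` is no smaller.
    have h2 := h'.payment_le_at_end hy' (hσr' ▸ hi')
    have h3 := h.sum_exiting_le h' hv hB ⟨hσ0.le, hσr⟩ hI' hi hi'
    have h4 := h.residual_sub_le h' hv hB hBi hI hI' hi hi'
    have h5 : r.P i s = max 0 (B i - r.residual s) :=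
      h.P_eq_max ⟨hs0.le, hs.2.le⟩ fun u hu =>
        h.p_lt_of_le ⟨hu.1, hu.2.le⟩ hs.2.le (hps ▸ hq)
    have h6 := le_max_right 0 (B i - r.residual s)
    rw [hres] at h6
    have h7 : ∑ k with k ≠ i ∧ v k = r.p σ, r.b k σ = ∑ k with v k = r.p σ, r.b k σ := by
      refine Finset.sum_congr ?_ fun _ _ => rfl
      ext k
      simp only [Finset.mem_filter, Finset.mem_univ, true_and, and_iff_right_iff_imp]
      rintro hk rfl
      exact hq.ne' hk
    have h8 : ∑ k with k ≠ i ∧ v' k = r'.p r'.f, r'.b k r'.f =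
        ∑ k with k ≠ i ∧ v k = r.p σ, r'.b k σ := by
      rw [← hσr', hp]
      refine Finset.sum_congr ?_ fun _ _ => rfl
      ext k
      simp only [Finset.mem_filter, Finset.mem_univ, true_and, and_congr_right_iff]
      intro hk
      rw [hv k hk]
    rw [h8, ← hσr'] at h2
    rw [← hσr'] at hub
    have := mul_le_mul_of_nonneg_left
      (show r'.P i σ + r'.p σ * y' i ≤ r.P i s by rw [h5, hres]; linarith) hfac
    linarith
  · -- bidder `i` exits empty-handed under the other report
    have hq' : v' i ≤ r'.p σ := by
      rcases hσ with h1 | h1 | h1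
      · exact absurd h1 (lt_min hσr hσr').ne
      · exact absurd h1 (not_le.2 hq)
      · exact h1
    have hP0 : r'.P i r'.f = 0 := by
      rw [h'.P_eq_of_exit hσ0.le hσf' le_rfl hq']
      exact h'.P_eq_zero_of_exit ⟨hσ0.le, hσr'⟩ hq'
    have hx0 := h'.x_eq_zero h'.f_mem hP0
    obtain ⟨s, hs, -, hgt, -, -⟩ := h'.exists_last_same_price hσ0 hσr'
    have hy0 : y' i = 0 := final_eq_zero_of_lt hy'
      (lt_of_le_of_lt hq' (hgt _ ⟨hs.2, le_rfl⟩))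
    have h1 : r'.surplus y' (v i) i = 0 := by simp [surplus, hP0, hx0, hy0]
    rw [h1]
    exact h.surplus_nonneg hy i

end IsRun

end Trajectory

namespace Trajectory

open Set

/-! ### Piecewise solutions of differential equations -/

/-- The bound holds for all `x`, so the radius can be taken as bound times length and a single
application covers the interval. -/
theorem exists_solution_Icc {G : ℝ → ℝ → ℝ} {a b : ℝ} {K L : NNReal} (hab : a < b)
    (hK : ∀ t ∈ Icc a b, LipschitzWith K (G t)) (hc : ∀ x, ContinuousOn (G · x) (Icc a b))
    (hL : ∀ t ∈ Icc a b, ∀ x, |G t x| ≤ L) (y₀ : ℝ) :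
    ∃ y : ℝ → ℝ, y a = y₀ ∧ ContinuousOn y (Icc a b) ∧
      ∀ t ∈ Ico a b, RightDeriv y (G t (y t)) t := by
  have hPL : IsPicardLindelof G (tmin := a) (tmax := b) ⟨a, le_rfl, hab.le⟩ y₀
      (L * ⟨b - a, (sub_pos.2 hab).le⟩) 0 L K :=
    { lipschitzOnWith := fun t ht => (hK t ht).lipschitzOnWith
      continuousOn := fun x _ => hc x
      norm_le := fun t ht x _ => hL t ht x
      mul_max_le := by
        simp [max_eq_left (sub_pos.2 hab).le]
        exact le_rfl }
  obtain ⟨y, hy0, hy⟩ := hPL.exists_eq_forall_mem_Icc_hasDerivWithinAt₀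
  refine ⟨y, hy0, fun t ht => (hy t ht).continuousWithinAt, fun t ht => ?_⟩
  exact (hy t ⟨ht.1, ht.2.le⟩).mono_of_mem_nhdsWithin (mem_nhdsGE_iff_exists_Ico_subset' ht.2 |>.2
    ⟨b, ht.2, fun s hs => ⟨ht.1.trans hs.1, hs.2.le⟩⟩)

/-- Solutions on the intervals between finitely many break points can be joined. -/
theorem exists_piecewise_solution {F : ℝ → ℝ → ℝ} {a₀ b₀ : ℝ} (s : Finset ℝ)
    (hF : ∀ a b, a₀ ≤ a → a < b → b ≤ b₀ → (∀ c ∈ s, c ∉ Ioo a b) → ∀ y₀ : ℝ,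
      ∃ y : ℝ → ℝ, y a = y₀ ∧ ContinuousOn y (Icc a b) ∧
        ∀ t ∈ Ico a b, RightDeriv y (F t (y t)) t) :
    ∀ a b, a₀ ≤ a → a < b → b ≤ b₀ → ∀ y₀ : ℝ,
      ∃ y : ℝ → ℝ, y a = y₀ ∧ ContinuousOn y (Icc a b) ∧
        ∀ t ∈ Ico a b, RightDeriv y (F t (y t)) t := by
  -- Induction on the number of break points inside the interval.
  suffices H : ∀ N : ℕ, ∀ a b, (s.filter (· ∈ Ioo a b)).card ≤ N → a₀ ≤ a → a < b → b ≤ b₀ →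
      ∀ y₀ : ℝ, ∃ y : ℝ → ℝ, y a = y₀ ∧ ContinuousOn y (Icc a b) ∧
        ∀ t ∈ Ico a b, RightDeriv y (F t (y t)) t from
    fun a b => H _ a b le_rfl
  intro N
  induction N with
  | zero =>
    intro a b hN ha hab hb
    refine hF a b ha hab hb fun c hc hcI => ?_
    have := Finset.card_eq_zero.1 (Nat.le_zero.1 hN)
    exact Finset.notMem_empty c (this ▸ Finset.mem_filter.2 ⟨hc, hcI⟩)
  | succ N ih =>
    intro a b hN ha hab hb y₀
    by_cases hex : ∃ c ∈ s, c ∈ Ioo a b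
    · obtain ⟨c, hc, hcI⟩ := hex
      have hcard : ∀ a' b', Ioo a' b' ⊆ Ioo a b → c ∉ Ioo a' b' →
          (s.filter (· ∈ Ioo a' b')).card ≤ N := fun a' b' hsub hcn => by
        refine Nat.le_of_lt_succ ((Finset.card_lt_card ?_).trans_le hN)
        refine ⟨fun d hd => ?_, fun hsup => ?_⟩
        · rw [Finset.mem_filter] at hd ⊢
          exact ⟨hd.1, hsub hd.2⟩
        · exact hcn (Finset.mem_filter.1 (hsup (Finset.mem_filter.2 ⟨hc, hcI⟩))).2
      obtain ⟨y₁, h₁0, h₁c, h₁d⟩ := ih a c (hcard a c (Ioo_subset_Ioo_right hcI.2.le)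
        fun h => h.2.false) ha hcI.1 (hcI.2.le.trans hb) y₀
      obtain ⟨y₂, h₂0, h₂c, h₂d⟩ := ih c b (hcard c b (Ioo_subset_Ioo_left hcI.1.le)
        fun h => h.1.false) (ha.trans hcI.1.le) hcI.2 hb (y₁ c)
      have e₁ : ∀ t ∈ Icc a c, (if t ≤ c then y₁ t else y₂ t) = y₁ t := fun t ht => if_pos ht.2
      have e₂ : ∀ t ∈ Icc c b, (if t ≤ c then y₁ t else y₂ t) = y₂ t := fun t ht => by
        rcases eq_or_lt_of_le ht.1 with rfl | hlt
        · rw [if_pos le_rfl, h₂0]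
        · exact if_neg (not_le.2 hlt)
      refine ⟨fun t => if t ≤ c then y₁ t else y₂ t, ?_, ?_, fun t ht => ?_⟩
      · rw [← h₁0]; exact e₁ a ⟨le_rfl, hcI.1.le⟩
      · rw [← Icc_union_Icc_eq_Icc hcI.1.le hcI.2.le]
        exact (h₁c.congr e₁).union_of_isClosed (h₂c.congr e₂) isClosed_Icc isClosed_Icc
      · rcases lt_or_ge t c with htc | htc
        · simp only [e₁ t ⟨ht.1, htc.le⟩]
          exact (h₁d t ⟨ht.1, htc⟩).congr_Ico htc fun u hu => e₁ u ⟨ht.1.trans hu.1, hu.2.le⟩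
        · simp only [e₂ t ⟨htc, ht.2.le⟩]
          exact (h₂d t ⟨htc, ht.2⟩).congr_Ico ht.2 fun u hu => e₂ u ⟨htc.trans hu.1, hu.2.le⟩
    · exact hF a b ha hab hb (fun c hc hcI => hex ⟨c, hc, hcI⟩) y₀

/-- The sign matters at `m t = c`: a negative derivative pushes `m` below `c` at once, and a zero
derivative survives because truncation does not enlarge increments. -/
theorem RightDeriv.min_const {m : ℝ → ℝ} {c m' t : ℝ} (h : RightDeriv m m' t) (hm : m' ≤ 0) :
    RightDeriv (fun s => min c (m s)) (if m t ≤ c then m' else 0) t := by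
  rcases lt_trichotomy (m t) c with hlt | heq | hgt
  · rw [if_pos hlt.le]
    refine HasDerivWithinAt.congr_of_eventuallyEq h ?_ (min_eq_right hlt.le)
    filter_upwards [h.continuousWithinAt.eventually_lt_const hlt] with s hs
    exact min_eq_right hs.le
  · rw [if_pos heq.le]
    rcases eq_or_lt_of_le hm with rfl | hm
    · have h0 : RightDeriv (fun s => min 0 (m s - c)) 0 t := by
        rw [RightDeriv, hasDerivWithinAt_iff_isLittleO] at h ⊢
        refine Asymptotics.IsLittleO.of_norm_left (Asymptotics.IsBigO.trans_isLittleO ?_ h)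
        refine Asymptotics.IsBigO.of_bound 1 (Filter.Eventually.of_forall fun s => ?_)
        simp only [heq, sub_self, min_self, sub_zero, smul_zero, one_mul,
          Real.norm_eq_abs]
        rcases le_total 0 (m s - c) with h1 | h1
        · rw [min_eq_left h1]; simp
        · rw [min_eq_right h1, abs_abs]
      have := HasDerivWithinAt.add_const c h0
      refine HasDerivWithinAt.congr_of_eventuallyEq this ?_ ?_
      · filter_upwards with s
        rw [min_add, zero_add, sub_add_cancel]
      · rw [min_add, zero_add, sub_add_cancel]
    · refine HasDerivWithinAt.congr_of_eventuallyEq h ?_ (min_eq_right heq.le)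
      have h1 := (hasDerivWithinAt_iff_tendsto_slope.1 h).eventually_lt_const hm
      have h2 : ∀ᶠ s in nhdsWithin t (Ici t \ {t}), m s < m t := by
        filter_upwards [h1, self_mem_nhdsWithin] with s hs hst
        have hst' : 0 < s - t := sub_pos.2 (lt_of_le_of_ne hst.1 (Ne.symm hst.2))
        rw [slope_def_field, div_neg_iff] at hs
        rcases hs with hs | hs <;> linarith
      have h3 : ∀ᶠ s in nhdsWithin t (Ici t), s ≠ t → m s < m t := by
        rw [eventually_nhdsWithin_iff] at h2 ⊢
        filter_upwards [h2] with s hs hs1 hs2 using hs ⟨hs1, hs2⟩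
      filter_upwards [h3] with s hs
      rcases eq_or_ne s t with rfl | hne
      · exact min_eq_right heq.le
      · exact min_eq_right (heq ▸ (hs hne).le)
  · rw [if_neg (not_le.2 hgt)]
    refine HasDerivWithinAt.congr_of_eventuallyEq (hasDerivWithinAt_const t (Ici t) c) ?_
      (min_eq_left hgt.le)
    filter_upwards [h.continuousWithinAt.eventually_const_lt hgt] with s hs
    exact min_eq_left hs.le

/-! ### The price schedule -/

variable {n : ℕ} (v B : Fin n → ℝ)

/-- The time at which the price reaches the valuation of bidder `k`. -/
noncomputable def exitTime (k : Fin n) : ℝ := v k + ∑ j with v j < v k, B j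

/-- The time at which the budget of bidder `k` begins to be destroyed. -/
noncomputable def drainStart (k : Fin n) : ℝ :=
  v k + ∑ j with v j < v k ∨ v j = v k ∧ j < k, B j

/-- The part of the budget of bidder `k` that is destroyed until time `t`. -/
noncomputable def drainedUntil (k : Fin n) (t : ℝ) : ℝ :=
  max 0 (min (B k) (t - drainStart v B k))

/-- The price at time `t`. -/
noncomputable def priceAt (t : ℝ) : ℝ := t - ∑ k, drainedUntil v B k t

/-- The budget of bidder `k` is being destroyed at time `t`. -/
def Draining (k : Fin n) (t : ℝ) : Prop :=
  drainStart v B k ≤ t ∧ t < drainStart v B k + B k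

variable {v B} {k j : Fin n} {t : ℝ}

theorem drainedUntil_of_le (h : t ≤ drainStart v B k) : drainedUntil v B k t = 0 :=
  max_eq_left ((min_le_right _ _).trans (by linarith))

theorem drainedUntil_nonneg (k : Fin n) (t : ℝ) : 0 ≤ drainedUntil v B k t := le_max_left _ _

theorem drainedUntil_cont (k : Fin n) : Continuous (drainedUntil v B k) := by
  unfold drainedUntil; fun_prop

theorem priceAt_cont : Continuous (priceAt v B) := by
  unfold priceAt
  exact continuous_id.sub (continuous_finsetSum _ fun k _ => drainedUntil_cont k)

variable (hB : ∀ k, 0 < B k)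
include hB

theorem drainedUntil_of_ge (h : drainStart v B k + B k ≤ t) : drainedUntil v B k t = B k := by
  unfold drainedUntil
  rw [min_eq_left (by linarith), max_eq_right (hB k).le]

theorem drainedUntil_le (k : Fin n) (t : ℝ) : drainedUntil v B k t ≤ B k :=
  max_le (hB k).le (min_le_left _ _)

omit hB in
theorem drainedUntil_of_draining (h : Draining v B k t) :
    drainedUntil v B k t = t - drainStart v B k := by
  unfold drainedUntil
  rw [min_eq_right (by linarith [h.2]), max_eq_right (by linarith [h.1])]

open Classical in
theorem drainedUntil_deriv (k : Fin n) (t : ℝ) :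
    RightDeriv (drainedUntil v B k) (if Draining v B k t then 1 else 0) t := by
  rcases lt_or_ge t (drainStart v B k) with h1 | h1
  · rw [if_neg fun h => absurd h.1 (not_le.2 h1)]
    exact RightDeriv.congr_Ico (g := fun _ => 0) (hasDerivWithinAt_const _ _ _) h1
      fun s hs => drainedUntil_of_le hs.2.le
  rcases lt_or_ge t (drainStart v B k + B k) with h2 | h2
  · rw [if_pos ⟨h1, h2⟩]
    exact RightDeriv.congr_Ico (g := fun s => s - drainStart v B k)
      ((hasDerivWithinAt_id _ _).sub_const _) h2
      fun s hs => drainedUntil_of_draining ⟨h1.trans hs.1, hs.2⟩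
  · rw [if_neg fun h => absurd h.2 (not_lt.2 h2)]
    exact RightDeriv.congr_Ico (g := fun _ => B k) (hasDerivWithinAt_const _ _ _)
      (lt_add_one t) fun s hs => drainedUntil_of_ge hB (h2.trans hs.1)

theorem exitTime_le_drainStart (k : Fin n) : exitTime v B k ≤ drainStart v B k := by
  unfold exitTime drainStart
  gcongr 1
  refine Finset.sum_le_sum_of_subset_of_nonneg (fun l hl => ?_) fun l _ _ => (hB l).le
  simp only [Finset.mem_filter, Finset.mem_univ, true_and] at hl ⊢
  exact Or.inl hl

/-- Budgets are destroyed one after another, by valuation and then by index; the sum for the later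
time contains `B j` and all terms of the earlier one. -/
theorem drainStart_add_le_exitTime (h : v j < v k) :
    drainStart v B j + B j ≤ exitTime v B k := by
  unfold exitTime drainStart
  have h1 : ∑ l with v l < v j ∨ v l = v j ∧ l < j, B l + B j ≤ ∑ l with v l < v k, B l := by
    rw [add_comm, ← Finset.sum_insert (a := j) (by simp)]
    refine Finset.sum_le_sum_of_subset_of_nonneg (fun l hl => ?_) fun l _ _ => (hB l).le
    simp only [Finset.mem_insert, Finset.mem_filter, Finset.mem_univ, true_and] at hl ⊢
    rcases hl with rfl | hl | hl
    · exact h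
    · exact hl.trans h
    · rw [hl.1]; exact h
  linarith

theorem drainStart_add_le (h : v j < v k ∨ v j = v k ∧ j < k) :
    drainStart v B j + B j ≤ drainStart v B k := by
  rcases h with h | h
  · exact (drainStart_add_le_exitTime hB h).trans (exitTime_le_drainStart hB k)
  unfold drainStart
  rw [add_assoc, add_comm _ (B j), ← Finset.sum_insert (a := j) (by simp), h.1]
  gcongr 1
  refine Finset.sum_le_sum_of_subset_of_nonneg (fun l hl => ?_) fun l _ _ => (hB l).le
  simp only [Finset.mem_insert, Finset.mem_filter, Finset.mem_univ, true_and] at hl ⊢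
  rcases hl with rfl | hl | hl
  · exact Or.inr h
  · exact Or.inl hl
  · exact Or.inr ⟨hl.1, hl.2.trans h.2⟩

theorem exitTime_le_of_le (h : v k ≤ v j) : exitTime v B k ≤ exitTime v B j := by
  rcases eq_or_lt_of_le h with h | h
  · simp [exitTime, h]
  · have h1 := drainStart_add_le_exitTime hB h
    have h2 := exitTime_le_drainStart (v := v) hB k
    have := hB k
    linarith

theorem exitTime_lt_of_lt (h : v k < v j) : exitTime v B k < exitTime v B j := by
  have h1 := drainStart_add_le_exitTime hB h
  have h2 := exitTime_le_drainStart (v := v) hB k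
  have := hB k
  linarith

theorem le_exitTime (k : Fin n) : v k ≤ exitTime v B k :=
  le_add_of_nonneg_right (Finset.sum_nonneg fun j _ => (hB j).le)

omit hB in
theorem before_or_after (h : j ≠ k) :
    (v j < v k ∨ v j = v k ∧ j < k) ∨ (v k < v j ∨ v k = v j ∧ k < j) := by
  rcases lt_trichotomy (v j) (v k) with h1 | h1 | h1
  · exact Or.inl (Or.inl h1)
  · rcases lt_or_gt_of_ne h with h2 | h2
    · exact Or.inl (Or.inr ⟨h1, h2⟩)
    · exact Or.inr (Or.inr ⟨h1.symm, h2⟩)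
  · exact Or.inr (Or.inl h1)

theorem draining_unique (h : Draining v B j t) (h' : Draining v B k t) : j = k := by
  by_contra hne
  rcases before_or_after (v := v) hne with h1 | h1
  · have := drainStart_add_le hB h1
    linarith [h.2, h'.1]
  · have := drainStart_add_le hB h1
    linarith [h'.2, h.1]

omit hB in
theorem sum_eq_add_sum_of_before (g : Fin n → ℝ) (k : Fin n)
    (hg : ∀ j, v k < v j ∨ v k = v j ∧ k < j → g j = 0) :
    ∑ j, g j = ∑ j with v j < v k ∨ v j = v k ∧ j < k, g j + g k := by
  rw [add_comm, ← Finset.sum_insert (a := k) (by simp)]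
  symm
  refine Finset.sum_subset (Finset.subset_univ _) fun j _ hj => hg j ?_
  simp only [Finset.mem_insert, Finset.mem_filter, Finset.mem_univ, true_and, not_or] at hj
  have := before_or_after (v := v) hj.1
  tauto

/-- Everyone before `k` in the order is fully drained and everyone after is intact, so the time
elapsed in the interval cancels. -/
theorem priceAt_of_mem_Icc (h : t ∈ Icc (drainStart v B k) (drainStart v B k + B k)) :
    priceAt v B t = v k := by
  have h1 : drainedUntil v B k t = t - drainStart v B k := by
    unfold drainedUntil
    rw [min_eq_right (by linarith [h.2]), max_eq_right (by linarith [h.1])]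
  unfold priceAt
  rw [sum_eq_add_sum_of_before (v := v) _ k
    fun j hj => drainedUntil_of_le (h.2.trans (drainStart_add_le hB hj)), h1]
  rw [Finset.sum_congr rfl fun j hj => drainedUntil_of_ge hB
    ((drainStart_add_le hB (Finset.mem_filter.1 hj).2).trans h.1)]
  unfold drainStart
  ring

theorem priceAt_of_draining (h : Draining v B k t) : priceAt v B t = v k :=
  priceAt_of_mem_Icc hB ⟨h.1, h.2.le⟩

theorem priceAt_exitTime (k : Fin n) : priceAt v B (exitTime v B k) = v k := by
  have h1 : ∑ j, drainedUntil v B j (exitTime v B k) = ∑ j with v j < v k, B j := by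
    rw [Finset.sum_filter]
    refine Finset.sum_congr rfl fun j _ => ?_
    split_ifs with h
    · exact drainedUntil_of_ge hB (drainStart_add_le_exitTime hB h)
    · exact drainedUntil_of_le ((exitTime_le_of_le hB (not_lt.1 h)).trans
        (exitTime_le_drainStart hB j))
  unfold priceAt
  rw [h1, exitTime]
  ring

open Classical in
theorem sum_draining (s : Finset (Fin n)) (hs : ∀ k, Draining v B k t → k ∈ s) :
    (∑ k ∈ s, if Draining v B k t then (1 : ℝ) else 0) =
      if ∃ k, Draining v B k t then 1 else 0 := by
  split_ifs with h
  · obtain ⟨k, hk⟩ := h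
    rw [Finset.sum_eq_single_of_mem k (hs k hk), if_pos hk]
    intro j _ hjk
    rw [if_neg fun hj => hjk (draining_unique hB hj hk)]
  · exact Finset.sum_eq_zero fun k _ => if_neg fun hk => h ⟨k, hk⟩

open Classical in
theorem priceAt_deriv (t : ℝ) :
    RightDeriv (priceAt v B) (if ∃ k, Draining v B k t then 0 else 1) t := by
  have := HasDerivWithinAt.fun_sub (hasDerivWithinAt_id t (Ici t)) (HasDerivWithinAt.fun_sum
    (u := Finset.univ) fun k _ => drainedUntil_deriv (v := v) hB k t)
  rw [sum_draining hB Finset.univ fun k _ => Finset.mem_univ k] at this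
  refine HasDerivWithinAt.congr_deriv this ?_
  split_ifs <;> simp

theorem priceAt_mono : Monotone (priceAt v B) := fun s t hst => by
  classical
  refine le_of_rightDeriv_nonneg hst priceAt_cont.continuousOn
    (fun u _ => priceAt_deriv hB u) fun u _ => ?_
  split_ifs <;> simp

/-- Otherwise the price has slope one at `t`, although monotonicity keeps it at `v k` from `t` to
`drainStart v B k`. -/
theorem exists_draining (h : t < drainStart v B k) (hk : v k ≤ priceAt v B t) :
    ∃ j, Draining v B j t := by
  classical
  by_contra hno
  have h1 := priceAt_deriv (v := v) hB t
  rw [if_neg hno] at h1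
  have h2 : priceAt v B (drainStart v B k) = v k :=
    priceAt_of_mem_Icc hB ⟨le_rfl, by linarith [hB k]⟩
  have h3 : RightDeriv (priceAt v B) 0 t := by
    refine RightDeriv.congr_Ico (g := fun _ => v k) (hasDerivWithinAt_const _ _ _) h fun s hs => ?_
    exact le_antisymm (h2 ▸ priceAt_mono hB hs.2.le) (hk.trans (priceAt_mono hB hs.1))
  exact one_ne_zero (h1.unique h3)

/-- Reaching `v k` too early would happen while some `j` with `v j ≥ v k` is being drained, but that
drain starts no earlier than the exit time of `k`. -/
theorem priceAt_lt_iff : priceAt v B t < v k ↔ t < exitTime v B k := by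
  constructor
  · intro h
    by_contra hle
    have := priceAt_mono (v := v) hB (not_lt.1 hle)
    rw [priceAt_exitTime hB] at this
    linarith
  · intro h
    by_contra hle
    obtain ⟨j, hj⟩ := exists_draining hB (h.trans_le (exitTime_le_drainStart hB k)) (not_lt.1 hle)
    have h1 := priceAt_of_draining hB hj
    have h2 : v k ≤ v j := h1 ▸ not_lt.1 hle
    have h3 := (exitTime_le_of_le hB h2).trans (exitTime_le_drainStart hB j)
    linarith [hj.1]

/-- Outside the exit phases, the budgets of the bidders who have exited are destroyed. -/
theorem drainedUntil_of_not_draining (hno : ¬ ∃ j, Draining v B j t) (h : exitTime v B k ≤ t) :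
    drainedUntil v B k t = B k := by
  refine drainedUntil_of_ge hB (not_lt.1 fun h1 => ?_)
  rcases lt_or_ge t (drainStart v B k) with h2 | h2
  · exact hno (exists_draining hB h2 (not_lt.1 fun h3 => absurd ((priceAt_lt_iff hB).1 h3)
      (not_lt.2 h)))
  · exact hno ⟨k, h2, h1⟩

end Trajectory

namespace Trajectory

open Set

variable {n : ℕ} {v B : Fin n → ℝ} {ε f t : ℝ} {m : ℝ → ℝ} {g : Fin n → ℝ → ℝ} {k j : Fin n}

/-! ### The path of the residual -/

open Classical in
/-- The rate at which the residual decreases when its value is `m`: before time `ε` nobody clinches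
and the supply is one. -/
noncomputable def flowRate (v B : Fin n → ℝ) (ε t m : ℝ) : ℝ :=
  if t < ε ∨ ∃ k, Draining v B k t then 1
  -- The supply is total budget minus residual, over the price, with budgets capped by `m`. The
  -- truncations make the field bounded and Lipschitz in `m`; they are inactive before stopping
  -- (`flowRate_eq`).
  else max 0 (∑ k with t < exitTime v B k, min (B k) m - max m 0) / max (priceAt v B t) ε

/-- The residual on `[0, f]` of an auction that does not stop before `f`. -/
structure IsResidualPath (v B : Fin n → ℝ) (ε f : ℝ) (m : ℝ → ℝ) : Prop where
  two_le : 2 ≤ n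
  adm : Admissible v B
  ε_pos : 0 < ε
  ε_le_v : ∀ k, ε ≤ v k
  ε_le_B : ∀ k, ε ≤ B k
  m_zero : m 0 = ∑ k, B k
  m_cont : ContinuousOn m (Icc 0 f)
  m_deriv : ∀ t ∈ Ico 0 f, RightDeriv m (- flowRate v B ε t (m t)) t

theorem flowRate_nonneg (hε : 0 < ε) (t x : ℝ) : 0 ≤ flowRate v B ε t x := by
  unfold flowRate
  split_ifs
  · exact zero_le_one
  · exact div_nonneg (le_max_left _ _) (hε.le.trans (le_max_right _ _))

/-- The break points between which the regime of the auction does not change. -/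
theorem exists_breakpoints (v B : Fin n → ℝ) (ε : ℝ) : ∃ s : Finset ℝ, ∀ a b,
    (∀ c ∈ s, c ∉ Ioo a b) → ∀ t ∈ Ico a b,
      ((t < ε ∨ ∃ k, Draining v B k t) ↔ (a < ε ∨ ∃ k, Draining v B k a)) ∧
      ∀ k, t < exitTime v B k ↔ a < exitTime v B k := by
  refine ⟨{ε} ∪ Finset.univ.image (drainStart v B) ∪
    Finset.univ.image (fun k => drainStart v B k + B k) ∪ Finset.univ.image (exitTime v B),
    fun a b hs t ht => ?_⟩
  have key : ∀ c, c ∉ Ioo a b → (t < c ↔ a < c) := fun c hc =>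
    ⟨fun h => ht.1.trans_lt h, fun h => lt_of_not_ge fun h' => hc ⟨h, h'.trans_lt ht.2⟩⟩
  have h1 := key ε (hs ε (by simp))
  have h2 := fun k => key (drainStart v B k) (hs _ (by simp))
  have h3 := fun k => key (drainStart v B k + B k) (hs _ (by simp))
  have h4 := fun k => key (exitTime v B k) (hs _ (by simp))
  refine ⟨?_, h4⟩
  simp only [Draining, h1, h3, ← not_lt, h2]

theorem lipschitzWith_demand (v B : Fin n → ℝ) (hε : 0 < ε) (a p : ℝ) :
    LipschitzWith ((n + 1) / ⟨ε, hε.le⟩) fun x =>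
      - (max 0 (∑ k with a < exitTime v B k, min (B k) x - max x 0) / max p ε) := by
  refine LipschitzWith.of_dist_le_mul fun x y => ?_
  have hp : 0 < max p ε := hε.trans_le (le_max_right _ _)
  have h1 : |(∑ k with a < exitTime v B k, min (B k) x) -
      ∑ k with a < exitTime v B k, min (B k) y| ≤ n * |x - y| := by
    rw [← Finset.sum_sub_distrib]
    refine (Finset.abs_sum_le_sum_abs _ _).trans ((Finset.sum_le_card_nsmul _ _ |x - y| fun k _ =>
      ?_).trans ?_)
    · exact (abs_min_sub_min_le_max _ _ _ _).trans (by simp)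
    · rw [nsmul_eq_mul]
      gcongr
      exact_mod_cast (Finset.card_le_univ _).trans_eq (Fintype.card_fin n)
  have h2 : |max x 0 - max y 0| ≤ |x - y| := (abs_max_sub_max_le_max _ _ _ _).trans (by simp)
  have h3 := abs_max_sub_max_le_max 0 (∑ k with a < exitTime v B k, min (B k) x - max x 0)
    0 (∑ k with a < exitTime v B k, min (B k) y - max y 0)
  rw [sub_self, abs_zero, max_eq_right (a := 0) (b := |_ - _|) (abs_nonneg _)] at h3
  have h4 := abs_sub (∑ k with a < exitTime v B k, min (B k) x -
      ∑ k with a < exitTime v B k, min (B k) y) (max x 0 - max y 0)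
  have h5 : |max 0 (∑ k with a < exitTime v B k, min (B k) x - max x 0) -
      max 0 (∑ k with a < exitTime v B k, min (B k) y - max y 0)| ≤ (n + 1) * |x - y| := by
    have : (∑ k with a < exitTime v B k, min (B k) x - max x 0) -
      (∑ k with a < exitTime v B k, min (B k) y - max y 0) =
      (∑ k with a < exitTime v B k, min (B k) x -
      ∑ k with a < exitTime v B k, min (B k) y) - (max x 0 - max y 0) := by ring
    rw [this] at h3
    linarith
  rw [Real.dist_eq, Real.dist_eq, neg_sub_neg, ← sub_div, abs_div, abs_of_pos hp, abs_sub_comm]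
  have h6 : ((((n : NNReal) + 1) / ⟨ε, hε.le⟩ : NNReal) : ℝ) * |x - y| = (n + 1) * |x - y| / ε := by
    exact div_mul_eq_mul_div _ _ _
  rw [h6]
  exact div_le_div₀ (by positivity) h5 hε (le_max_right _ _)

theorem exists_pos_le (hn : 2 ≤ n) (h : Admissible v B) :
    ∃ ε, 0 < ε ∧ (∀ k, ε ≤ v k) ∧ ∀ k, ε ≤ B k := by
  have hne : (Finset.univ : Finset (Fin n)).Nonempty := ⟨⟨0, by omega⟩, Finset.mem_univ _⟩
  refine ⟨Finset.univ.inf' hne fun k => min (v k) (B k), ?_, fun k => ?_, fun k => ?_⟩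
  · rw [Finset.lt_inf'_iff]
    exact fun k _ => lt_min (h.1 k) (h.2 k)
  · exact (Finset.inf'_le _ (Finset.mem_univ k)).trans (min_le_left _ _)
  · exact (Finset.inf'_le _ (Finset.mem_univ k)).trans (min_le_right _ _)

theorem exists_isResidualPath (hn : 2 ≤ n) (h : Admissible v B) :
    ∃ ε, ∀ f, 0 < f → ∃ m, IsResidualPath v B ε f m := by
  obtain ⟨ε, hε, hv, hB⟩ := exists_pos_le hn h
  refine ⟨ε, fun f hf => ?_⟩
  obtain ⟨s, hs⟩ := exists_breakpoints v B ε
  obtain ⟨m, h0, hc, hd⟩ := exists_piecewise_solution (a₀ := 0) (b₀ := f)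
    (F := fun t x => - flowRate v B ε t x) s
    (by
      intro a b ha hab hb hsab y₀
      by_cases hcase : a < ε ∨ ∃ k, Draining v B k a
      · obtain ⟨y, hy0, hyc, hyd⟩ := exists_solution_Icc (G := fun _ _ => -1) (K := 0) (L := 1) hab
          (fun _ _ => LipschitzWith.const _) (fun _ => continuousOn_const) (by simp) y₀
        refine ⟨y, hy0, hyc, fun t ht => ?_⟩
        rw [flowRate, if_pos ((hs a b hsab t ht).1.2 hcase)]
        exact hyd t ht
      · have hmaxc : Continuous fun t => max (priceAt v B t) ε := priceAt_cont.max continuous_const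
        have hpos : ∀ t, 0 < max (priceAt v B t) ε := fun t => hε.trans_le (le_max_right _ _)
        have hsum : 0 ≤ ∑ k, B k := Finset.sum_nonneg fun k _ => (h.2 k).le
        obtain ⟨y, hy0, hyc, hyd⟩ := exists_solution_Icc (G := fun t x =>
            - (max 0 (∑ k with a < exitTime v B k, min (B k) x - max x 0) / max (priceAt v B t) ε))
          (K := (n + 1) / ⟨ε, hε.le⟩) (L := ⟨(∑ k, B k) / ε, div_nonneg hsum hε.le⟩) hab
          (fun t _ => lipschitzWith_demand v B hε a _)
          (fun x => (continuous_const.div hmaxc fun t => (hpos t).ne').neg.continuousOn)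
          (fun t _ x => by
            rw [abs_neg, abs_div, abs_of_pos (hpos t), abs_of_nonneg (le_max_left _ _)]
            refine div_le_div₀ hsum (max_le hsum ?_) hε (le_max_right _ _)
            have h1 : ∑ k with a < exitTime v B k, min (B k) x ≤ ∑ k, B k :=
              (Finset.sum_le_sum fun k _ => min_le_left _ _).trans
                (Finset.sum_le_sum_of_subset_of_nonneg (Finset.subset_univ _)
                  fun k _ _ => (h.2 k).le)
            have := le_max_right x 0
            linarith) y₀
        refine ⟨y, hy0, hyc, fun t ht => ?_⟩
        have h1 := hs a b hsab t ht
        rw [flowRate, if_neg fun hcon => hcase (h1.1.1 hcon)]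
        simp only [h1.2]
        exact hyd t ht) 0 f le_rfl hf le_rfl (∑ k, B k)
  exact ⟨m, hn, h, hε, hv, hB, h0, hc, hd⟩

namespace IsResidualPath

theorem mono {f' : ℝ} (h : IsResidualPath v B ε f m) (hf : f' ≤ f) : IsResidualPath v B ε f' m :=
  { h with
    m_cont := h.m_cont.mono (Icc_subset_Icc_right hf)
    m_deriv := fun t ht => h.m_deriv t ⟨ht.1, ht.2.trans_le hf⟩ }

variable (h : IsResidualPath v B ε f m)
include h

theorem B_pos (k : Fin n) : 0 < B k := h.adm.2 k

theorem ε_le_exitTime (k : Fin n) : ε ≤ exitTime v B k :=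
  (h.ε_le_v k).trans (le_exitTime h.B_pos k)

theorem ε_le_drainStart (k : Fin n) : ε ≤ drainStart v B k :=
  (h.ε_le_exitTime k).trans (exitTime_le_drainStart h.B_pos k)

theorem drainedUntil_of_le_ε (ht : t ≤ ε) (k : Fin n) : drainedUntil v B k t = 0 :=
  drainedUntil_of_le (ht.trans (h.ε_le_drainStart k))

theorem priceAt_of_le (ht : t ≤ ε) : priceAt v B t = t := by
  simp [priceAt, h.drainedUntil_of_le_ε ht]

theorem ε_le_priceAt (ht : ε ≤ t) : ε ≤ priceAt v B t :=
  (h.priceAt_of_le le_rfl).ge.trans (priceAt_mono h.B_pos ht)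

theorem B_add_ε_le (k : Fin n) : B k + ε ≤ ∑ j, B j := by
  obtain ⟨j, hj⟩ : ∃ j : Fin n, j ≠ k := by
    have : Nontrivial (Fin n) := Fin.nontrivial_iff_two_le.2 h.two_le
    exact exists_ne k
  have h1 : B k + B j ≤ ∑ l, B l := by
    rw [← Finset.sum_pair hj.symm]
    exact Finset.sum_le_sum_of_subset_of_nonneg (Finset.subset_univ _) fun l _ _ => (h.B_pos l).le
  have := h.ε_le_B j
  linarith

theorem m_of_le (ht : t ∈ Icc 0 f) (htε : t ≤ ε) : m t = ∑ k, B k - t := by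
  refine eq_of_rightDeriv_eq (g' := fun _ => -1) (k := fun s => ∑ k, B k - s) ht.1
    (h.m_cont.mono (Icc_subset_Icc_right ht.2)) (by fun_prop) (fun s hs => ?_)
    (fun s _ => (hasDerivWithinAt_id _ _).const_sub _) (by simp [h.m_zero])
  have := h.m_deriv s ⟨hs.1, hs.2.trans_le ht.2⟩
  rwa [flowRate, if_pos (Or.inl (hs.2.trans_le htε))] at this

/-- Both sides start at `∑ B`. During a drain both fall at unit rate; otherwise only `m` can fall.
-/
theorem m_le_sum (ht : t ∈ Icc 0 f) : m t ≤ ∑ k, (B k - drainedUntil v B k t) := by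
  classical
  have key := le_of_rightDeriv_nonneg (g := fun s => ∑ k, (B k - drainedUntil v B k s) - m s) ht.1
    ((continuous_finsetSum _ fun k _ =>
      continuous_const.sub (drainedUntil_cont k)).continuousOn.sub
        (h.m_cont.mono (Icc_subset_Icc_right ht.2)))
    (fun s hs => HasDerivWithinAt.fun_sub (HasDerivWithinAt.fun_sum (u := Finset.univ) fun k _ =>
      HasDerivWithinAt.const_sub (B k) (drainedUntil_deriv h.B_pos k s))
      (h.m_deriv s ⟨hs.1, hs.2.trans_le ht.2⟩))
    (fun s _ => by
      rw [Finset.sum_neg_distrib, sum_draining h.B_pos _ fun k _ => Finset.mem_univ k]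
      split_ifs with hex
      · rw [flowRate, if_pos (Or.inr hex)]
        norm_num
      · have := flowRate_nonneg (v := v) (B := B) h.ε_pos s (m s)
        linarith)
  simp only [h.m_zero, h.drainedUntil_of_le_ε h.ε_pos.le, sub_zero, sub_self] at key
  linarith

theorem flowRate_le (hex : ¬ ∃ k, Draining v B k t) (ht : ε ≤ t) (x : ℝ) :
    flowRate v B ε t x ≤ n / ε * max x 0 := by
  have hε := h.ε_pos
  rw [flowRate, if_neg (by rintro (h1 | h1); exacts [absurd h1 (not_lt.2 ht), hex h1]),
    div_mul_eq_mul_div]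
  have h0 : 0 ≤ n * max x 0 := mul_nonneg (Nat.cast_nonneg n) (le_max_right _ _)
  refine div_le_div₀ h0 (max_le h0 ?_) hε (le_max_right _ _)
  have h1 : ∑ k with t < exitTime v B k, min (B k) x ≤ n * max x 0 := by
    refine (Finset.sum_le_card_nsmul _ _ (max x 0) fun k _ =>
      (min_le_right _ _).trans (le_max_left _ _)).trans ?_
    rw [nsmul_eq_mul]
    refine mul_le_mul_of_nonneg_right ?_ (le_max_right _ _)
    exact_mod_cast (Finset.card_le_univ _).trans_eq (Fintype.card_fin n)
  have := le_max_right x 0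
  linarith

/-- If the auction does not stop at the exit times before `f`, then it does not stop before `f`. -/
theorem sum_exited_lt (hns : ∀ k, exitTime v B k < f →
    ∑ j with v j = v k, B j < m (exitTime v B k)) (ht : t ∈ Ico 0 f) :
    ∑ k with exitTime v B k ≤ t, (B k - drainedUntil v B k t) < m t := by
  classical
  have hε := h.ε_pos
  have hm0 : ∀ s ∈ Icc 0 f, s ≤ ε → 0 < m s := fun s hs hsε => by
    rw [h.m_of_le hs hsε]
    have h1 := h.B_add_ε_le ⟨0, by have := h.two_le; omega⟩
    have := h.B_pos ⟨0, by have := h.two_le; omega⟩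
    linarith
  rcases lt_or_ge t ε with htε | htε
  · rw [Finset.sum_eq_zero fun k hk => absurd (Finset.mem_filter.1 hk).2
      (not_le.2 (htε.trans_le (h.ε_le_exitTime k)))]
    exact hm0 t ⟨ht.1, ht.2.le⟩ htε.le
  -- the last exit time before `t`
  obtain ⟨θ, hθε, hθt, hθJ, hθm⟩ : ∃ θ, ε ≤ θ ∧ θ ≤ t ∧
      (∀ k, exitTime v B k ≤ t → exitTime v B k ≤ θ) ∧
      ∑ k with exitTime v B k ≤ t, (B k - drainedUntil v B k θ) < m θ := by
    rcases (Finset.univ.filter fun k => exitTime v B k ≤ t).eq_empty_or_nonempty with hJ | hJ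
    · refine ⟨ε, le_rfl, htε, fun k hk => ?_, ?_⟩
      · have : k ∈ Finset.univ.filter fun k => exitTime v B k ≤ t := by simpa using hk
        simp [hJ] at this
      · rw [hJ, Finset.sum_empty]
        exact hm0 ε ⟨hε.le, htε.trans ht.2.le⟩ le_rfl
    -- At the last exit time up to `t` all lower valuations are fully drained, so only the tied
    -- bidders count and `hns` applies.
    · obtain ⟨k, hk, hmax⟩ := Finset.exists_max_image _ (exitTime v B) hJ
      have hkt := (Finset.mem_filter.1 hk).2
      refine ⟨exitTime v B k, h.ε_le_exitTime k, hkt, fun j hj => hmax j (by simpa using hj), ?_⟩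
      refine lt_of_le_of_lt ?_ (hns k (hkt.trans_lt ht.2))
      rw [Finset.sum_filter, Finset.sum_filter]
      refine Finset.sum_le_sum fun j _ => ?_
      have hdn := drainedUntil_nonneg (v := v) (B := B) j (exitTime v B k)
      have hB := h.B_pos j
      split_ifs with h1 h2
      · linarith
      · rcases lt_or_gt_of_ne h2 with h3 | h3
        · rw [drainedUntil_of_ge h.B_pos (drainStart_add_le_exitTime h.B_pos h3), sub_self]
        · have := exitTime_lt_of_lt h.B_pos h3
          have := hmax j (by simpa using h1)
          linarith
      · exact hB.le
      · exact le_rfl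
  set J := Finset.univ.filter fun k => exitTime v B k ≤ t with hJdef
  set K : ℝ → ℝ := fun s => m s - ∑ k ∈ J, (B k - drainedUntil v B k s) with hK
  have hK0 : 0 < K θ := by simp only [hK]; linarith
  have hθ0 : 0 ≤ θ := hε.le.trans hθε
  -- A Grönwall comparison: `K` is constant during a drain; otherwise all of `J` is fully drained,
  -- so `K = m`, which decays at relative rate at most `n / ε`.
  have key := nonpos_of_barrier
    (g := fun s => K θ * Real.exp (-(n / ε) * (s - θ)) - K s) hθt
    ((by fun_prop : Continuous fun s => K θ * Real.exp (-(n / ε) * (s - θ))).continuousOn.sub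
      ((h.m_cont.mono (Icc_subset_Icc hθ0 ht.2.le)).sub
        (continuous_finsetSum _ fun k _ =>
          continuous_const.sub (drainedUntil_cont k)).continuousOn))
    (fun s hs => HasDerivWithinAt.fun_sub
      ((((((hasDerivAt_id s).sub_const θ).const_mul (-(n / ε))).exp).const_mul
        (K θ)).hasDerivWithinAt)
      (HasDerivWithinAt.fun_sub (h.m_deriv s ⟨hθ0.trans hs.1, hs.2.trans ht.2⟩)
        (HasDerivWithinAt.fun_sum (u := J) fun k _ =>
          HasDerivWithinAt.const_sub (B k) (drainedUntil_deriv h.B_pos k s))))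
    (by simp)
    (by
      intro s hs hg
      have hE : 0 < K θ * Real.exp (-(n / ε) * (s - θ)) := mul_pos hK0 (Real.exp_pos _)
      have hc : (0 : ℝ) ≤ n / ε := div_nonneg (Nat.cast_nonneg n) hε.le
      have hJs : ∀ k, Draining v B k s → k ∈ J := fun k hk => by
        have := (exitTime_le_drainStart (v := v) h.B_pos k).trans hk.1
        simpa [hJdef] using this.trans hs.2.le
      rw [Finset.sum_neg_distrib, sum_draining h.B_pos J hJs]
      simp only [id, mul_one]
      have hcE := mul_nonneg hc hE.le
      split_ifs with hex
      · rw [flowRate, if_pos (Or.inr hex)]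
        linarith
      · have hKs : K s = m s := by
          simp only [hK]
          rw [Finset.sum_eq_zero fun k hk => ?_, sub_zero]
          rw [drainedUntil_of_not_draining h.B_pos hex
            ((hθJ k (Finset.mem_filter.1 hk).2).trans hs.1), sub_self]
        have h1 := h.flowRate_le hex (hθε.trans hs.1) (m s)
        have h2 : max (m s) 0 ≤ K θ * Real.exp (-(n / ε) * (s - θ)) :=
          max_le (by rw [← hKs]; linarith) hE.le
        have h3 := mul_le_mul_of_nonneg_left h2 hc
        linarith)
  have hE : 0 < K θ * Real.exp (-(n / ε) * (t - θ)) := mul_pos hK0 (Real.exp_pos _)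
  have : 0 < K t := by linarith
  simp only [hK] at this
  linarith

end IsResidualPath

end Trajectory

namespace Trajectory

open Set

variable {n : ℕ} {v B : Fin n → ℝ} {ε f t : ℝ} {m : ℝ → ℝ} {g : Fin n → ℝ → ℝ} {k j : Fin n}

/-! ### The trajectory with a given path of the residual -/

/-- The money extracted from bidder `k` until time `t`. -/
noncomputable def extracted (v B : Fin n → ℝ) (m : ℝ → ℝ) (k : Fin n) (t : ℝ) : ℝ :=
  B k - min (B k) (m (min t (exitTime v B k)))

/-- The trajectory with residual `m` and gains `g`. -/
noncomputable def ofResidual (v B : Fin n → ℝ) (ε f : ℝ) (m : ℝ → ℝ) (g : Fin n → ℝ → ℝ) :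
    Trajectory n where
  f := f
  p := priceAt v B
  -- The truncation of the price matters only before time `ε`, where an auction path has extracted
  -- nothing.
  x k t := g k t + extracted v B m k t / max (priceAt v B t) ε
  P := extracted v B m
  b k t := B k - extracted v B m k t - drainedUntil v B k t

open Classical in
/-- The residual stops the auction at `f`, and `g` are the corresponding gains of the bidders. -/
structure IsAuctionPath (v B : Fin n → ℝ) (ε f : ℝ) (m : ℝ → ℝ) (g : Fin n → ℝ → ℝ) : Prop
    extends IsResidualPath v B ε f m where
  stops_at_end : ∃ k, exitTime v B k = f ∧ m f ≤ ∑ j with v j = v k, B j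
  not_stops_before : ∀ k, exitTime v B k < f → ∑ j with v j = v k, B j < m (exitTime v B k)
  g_zero : ∀ k, g k 0 = 0
  g_cont : ∀ k, ContinuousOn (g k) (Icc 0 f)
  g_deriv : ∀ k, ∀ t ∈ Ico 0 f, RightDeriv (g k)
    (if t < ε ∨ ∃ k, Draining v B k t then 0 else extracted v B m k t / max (priceAt v B t) ε ^ 2) t

theorem IsResidualPath.extracted_cont (h : IsResidualPath v B ε f m) (k : Fin n) :
    ContinuousOn (extracted v B m k) (Icc 0 f) := by
  refine continuousOn_const.sub (continuousOn_const.inf (h.m_cont.comp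
    (by fun_prop : Continuous fun t => min t (exitTime v B k)).continuousOn fun t ht => ?_))
  exact ⟨le_min ht.1 (h.ε_pos.le.trans (h.ε_le_exitTime k)), (min_le_left _ _).trans ht.2⟩

theorem exists_isAuctionPath (hn : 2 ≤ n) (hadm : Admissible v B) :
    ∃ ε f m g, IsAuctionPath v B ε f m g := by
  classical
  obtain ⟨ε, hε⟩ := exists_isResidualPath hn hadm
  have hne : (Finset.univ : Finset (Fin n)).Nonempty := ⟨⟨0, by omega⟩, Finset.mem_univ _⟩
  obtain ⟨K, -, hK⟩ := Finset.exists_max_image Finset.univ (exitTime v B) hne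
  have hpos : ∀ k, 0 < exitTime v B k := fun k => (hadm.1 k).trans_le (le_exitTime hadm.2 k)
  obtain ⟨m, hm⟩ := hε _ (hpos K)
  -- the set of bidders at whose exit the auction would stop
  have hKm : m (exitTime v B K) ≤ ∑ j with v j = v K, B j := by
    refine (hm.m_le_sum ⟨(hpos K).le, le_rfl⟩).trans ?_
    rw [Finset.sum_filter]
    refine Finset.sum_le_sum fun j _ => ?_
    have hj := hK j (Finset.mem_univ j)
    have hd := drainedUntil_nonneg (v := v) (B := B) j (exitTime v B K)
    split_ifs with h1
    · linarith
    · rcases lt_or_gt_of_ne h1 with h3 | h3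
      · rw [drainedUntil_of_ge hadm.2 (drainStart_add_le_exitTime hadm.2 h3), sub_self]
      · exact absurd hj (not_le.2 (exitTime_lt_of_lt hadm.2 h3))
  -- The stopping time is the earliest exit time at which the tied reported budgets cover the
  -- residual.
  obtain ⟨k, hk, hmin⟩ := Finset.exists_min_image
    (Finset.univ.filter fun k => m (exitTime v B k) ≤ ∑ j with v j = v k, B j) (exitTime v B)
    ⟨K, by simpa using hKm⟩
  have hm' := hm.mono (hK k (Finset.mem_univ k))
  obtain ⟨s, hs⟩ := exists_breakpoints v B ε
  -- The right side does not involve the unknown, so this is integration between break points.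
  have hg : ∀ k', ∃ y : ℝ → ℝ, y 0 = 0 ∧ ContinuousOn y (Icc 0 (exitTime v B k)) ∧
      ∀ t ∈ Ico 0 (exitTime v B k), RightDeriv y (if t < ε ∨ ∃ k, Draining v B k t then 0
        else extracted v B m k' t / max (priceAt v B t) ε ^ 2) t := fun k' => by
    refine exists_piecewise_solution (a₀ := 0) (b₀ := exitTime v B k)
      (F := fun t _ => if t < ε ∨ ∃ k, Draining v B k t then 0
        else extracted v B m k' t / max (priceAt v B t) ε ^ 2) s ?_ 0 _ le_rfl (hpos k) le_rfl 0
    intro a b ha hab hb hsab y₀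
    by_cases hcase : a < ε ∨ ∃ k, Draining v B k a
    · refine ⟨fun _ => y₀, rfl, continuousOn_const, fun t ht => ?_⟩
      rw [if_pos ((hs a b hsab t ht).1.2 hcase)]
      exact hasDerivWithinAt_const _ _ _
    · have hc : ContinuousOn (fun t => extracted v B m k' t / max (priceAt v B t) ε ^ 2)
          (Icc a b) :=
        ((hm'.extracted_cont k').mono (Icc_subset_Icc ha hb)).div
          ((priceAt_cont.max continuous_const).pow 2).continuousOn
          fun t _ => (pow_pos (hm.ε_pos.trans_le (le_max_right _ _)) 2).ne'
      obtain ⟨L, hL⟩ := isCompact_Icc.exists_bound_of_continuousOn hc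
      obtain ⟨y, hy0, hyc, hyd⟩ := exists_solution_Icc
        (G := fun t _ => extracted v B m k' t / max (priceAt v B t) ε ^ 2) (K := 0)
        (L := L.toNNReal) hab (fun _ _ => LipschitzWith.const _) (fun _ => hc)
        (fun t ht _ => (hL t ht).trans (Real.le_coe_toNNReal L)) y₀
      refine ⟨y, hy0, hyc, fun t ht => ?_⟩
      rw [if_neg fun hcon => hcase ((hs a b hsab t ht).1.1 hcon)]
      exact hyd t ht
  choose g hg0 hgc hgd using hg
  exact ⟨ε, _, m, g, hm', ⟨k, rfl, (Finset.mem_filter.1 hk).2⟩, fun j hj => not_le.1 fun hle =>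
    absurd (hmin j (by simpa using hle)) (not_le.2 hj), hg0, hgc, hgd⟩

namespace IsAuctionPath

variable (h : IsAuctionPath v B ε f m g)
include h

theorem ε_le_f : ε ≤ f := by
  obtain ⟨k, hk, -⟩ := h.stops_at_end
  exact hk ▸ h.ε_le_exitTime k

theorem f_pos : 0 < f := h.ε_pos.trans_le h.ε_le_f

theorem m_pos (ht : t ∈ Ico 0 f) : 0 < m t :=
  lt_of_le_of_lt (Finset.sum_nonneg fun k _ => sub_nonneg.2 (drainedUntil_le h.B_pos k t))
    (h.sum_exited_lt h.not_stops_before ht)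

theorem m_f_nonneg : 0 ≤ m f :=
  le_right_of_le_Ico h.f_pos continuousOn_const h.m_cont fun _ hs => (h.m_pos hs).le

omit h in
theorem extracted_of_le (ht : t ≤ exitTime v B k) :
    extracted v B m k t = B k - min (B k) (m t) := by
  rw [extracted, min_eq_left ht]

/-- Since the auction goes on at her exit, the residual there exceeds the tied budgets, in
particular her own. -/
theorem extracted_of_ge (ht : exitTime v B k ≤ t) (hk : exitTime v B k < f) :
    extracted v B m k t = 0 := by
  have h1 : B k ≤ ∑ j with v j = v k, B j :=
    Finset.single_le_sum (fun j _ => (h.B_pos j).le) (by simp)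
  rw [extracted, min_eq_right ht, min_eq_left (h1.trans (h.not_stops_before k hk).le), sub_self]

theorem extracted_of_le_ε (ht : t ∈ Icc 0 ε) (k : Fin n) : extracted v B m k t = 0 := by
  rw [extracted_of_le (ht.2.trans (h.ε_le_exitTime k)),
    h.m_of_le ⟨ht.1, ht.2.trans h.ε_le_f⟩ ht.2, min_eq_left, sub_self]
  have := h.B_add_ε_le k
  linarith [ht.2]

theorem extracted_deriv (ht : t ∈ Ico 0 f) (k : Fin n) : RightDeriv (extracted v B m k)
    (if t < exitTime v B k ∧ m t ≤ B k then flowRate v B ε t (m t) else 0) t := by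
  rcases lt_or_ge t (exitTime v B k) with h1 | h1
  · have h2 := (RightDeriv.min_const (c := B k) (h.m_deriv t ht)
      (neg_nonpos.2 (flowRate_nonneg h.ε_pos _ _))).const_sub (B k)
    refine RightDeriv.congr_Ico (HasDerivWithinAt.congr_deriv h2 ?_) h1
      fun s hs => extracted_of_le hs.2.le
    simp only [h1, true_and]
    split_ifs <;> simp
  · rw [if_neg fun h2 => absurd h2.1 (not_lt.2 h1)]
    exact RightDeriv.congr_Ico (g := fun _ => 0) (hasDerivWithinAt_const _ _ _) ht.2
      fun s hs => h.extracted_of_ge (h1.trans hs.1) (h1.trans_lt ht.2)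

theorem x_of_le_ε (ht : t ∈ Icc 0 ε) (k : Fin n) : (ofResidual v B ε f m g).x k t = 0 := by
  have h1 : g k t = 0 := by
    rw [eq_of_rightDeriv_zero ht.1 ((h.g_cont k).mono (Icc_subset_Icc_right
      (ht.2.trans h.ε_le_f))) (fun s hs => ?_), h.g_zero]
    have := h.g_deriv k s ⟨hs.1, hs.2.trans_le (ht.2.trans h.ε_le_f)⟩
    rwa [if_pos (Or.inl (hs.2.trans_le ht.2))] at this
  simp [ofResidual, h1, h.extracted_of_le_ε ht]

theorem max_price (ht : ε ≤ t) : max (priceAt v B t) ε = priceAt v B t :=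
  max_eq_left (h.ε_le_priceAt ht)

theorem price_pos (ht : ε ≤ t) : 0 < priceAt v B t := h.ε_pos.trans_le (h.ε_le_priceAt ht)

theorem B_lt_m (ht : t ∈ Ico 0 ε) (k : Fin n) : B k < m t := by
  rw [h.m_of_le ⟨ht.1, ht.2.le.trans h.ε_le_f⟩ ht.2.le]
  have := h.B_add_ε_le k
  linarith [ht.2]

/-- The term with `p'` in the derivative of `P / p` is cancelled by the derivative of the gain,
leaving `P' / p`. -/
theorem x_deriv (ht : t ∈ Ico 0 f) (k : Fin n) : RightDeriv ((ofResidual v B ε f m g).x k)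
    ((if t < exitTime v B k ∧ m t ≤ B k then flowRate v B ε t (m t) else 0) / priceAt v B t) t := by
  classical
  rcases lt_or_ge t ε with h1 | h1
  · rw [if_neg fun h2 => absurd h2.2 (not_le.2 (h.B_lt_m ⟨ht.1, h1⟩ k)), zero_div]
    exact RightDeriv.congr_Ico (g := fun _ => 0) (hasDerivWithinAt_const _ _ _) h1
      fun s hs => h.x_of_le_ε ⟨ht.1.trans hs.1, hs.2.le⟩ k
  · have hp := h.price_pos h1
    have h2 := HasDerivWithinAt.fun_add (h.g_deriv k t ht) (HasDerivWithinAt.fun_div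
      (h.extracted_deriv ht k) (priceAt_deriv h.B_pos t) hp.ne')
    refine RightDeriv.congr_Ico (HasDerivWithinAt.congr_deriv h2 ?_) (lt_add_one t) fun s hs => ?_
    · rw [h.max_price h1]
      simp only [not_lt.2 h1, false_or]
      split_ifs <;> field_simp <;> ring
    · simp only [ofResidual, h.max_price (h1.trans hs.1)]

theorem b_of_lt (ht : t < exitTime v B k) : (ofResidual v B ε f m g).b k t = min (B k) (m t) := by
  simp only [ofResidual]
  rw [extracted_of_le ht.le,
    drainedUntil_of_le (ht.le.trans (exitTime_le_drainStart h.B_pos k))]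
  ring

theorem b_of_ge (ht : exitTime v B k ≤ t) (htf : t < f) :
    (ofResidual v B ε f m g).b k t = B k - drainedUntil v B k t := by
  simp only [ofResidual]
  rw [h.extracted_of_ge ht (ht.trans_lt htf)]
  ring

theorem sum_b (ht : t ∈ Ico 0 f) : ∑ k, (ofResidual v B ε f m g).b k t =
    ∑ k with t < exitTime v B k, min (B k) (m t) +
      ∑ k with exitTime v B k ≤ t, (B k - drainedUntil v B k t) := by
  rw [← Finset.sum_filter_add_sum_filter_not Finset.univ (fun k => t < exitTime v B k)]
  simp only [not_lt]
  congr 1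
  · exact Finset.sum_congr rfl fun k hk => h.b_of_lt (Finset.mem_filter.1 hk).2
  · exact Finset.sum_congr rfl fun k hk => h.b_of_ge (Finset.mem_filter.1 hk).2 ht.2

/-- A capped bidder alone holds `m`. If nobody is capped, only drains have reduced the budgets and
`m_le_sum` applies. -/
theorem m_le_sum_b (ht : t ∈ Ico 0 f) : m t ≤ ∑ k, (ofResidual v B ε f m g).b k t := by
  rw [h.sum_b ht]
  have h0 : 0 ≤ ∑ k with exitTime v B k ≤ t, (B k - drainedUntil v B k t) :=
    Finset.sum_nonneg fun k _ => sub_nonneg.2 (drainedUntil_le h.B_pos k t)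
  by_cases hex : ∃ k, t < exitTime v B k ∧ m t ≤ B k
  · obtain ⟨k, hk, hmB⟩ := hex
    have h1 : min (B k) (m t) ≤ ∑ k with t < exitTime v B k, min (B k) (m t) :=
      Finset.single_le_sum (f := fun k => min (B k) (m t))
        (fun j _ => le_min (h.B_pos j).le (h.m_pos ht).le) (by simpa using hk)
    rw [min_eq_right hmB] at h1
    linarith
  · have h1 : ∑ k with t < exitTime v B k, min (B k) (m t) =
        ∑ k with t < exitTime v B k, (B k - drainedUntil v B k t) := by
      refine Finset.sum_congr rfl fun k hk => ?_
      have hk := (Finset.mem_filter.1 hk).2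
      rw [drainedUntil_of_le (hk.le.trans (exitTime_le_drainStart h.B_pos k)), sub_zero,
        min_eq_left (not_lt.1 fun h2 => hex ⟨k, hk, h2.le⟩)]
    have h2 := h.m_le_sum ⟨ht.1, ht.2.le⟩
    rw [← Finset.sum_filter_add_sum_filter_not Finset.univ (fun k => t < exitTime v B k)] at h2
    simp only [not_lt] at h2
    linarith

theorem flowRate_eq (ht : t ∈ Ico 0 f) (htε : ε ≤ t) (hex : ¬ ∃ k, Draining v B k t) :
    flowRate v B ε t (m t) =
      (∑ k, (ofResidual v B ε f m g).b k t - m t) / priceAt v B t := by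
  rw [flowRate, if_neg (by rintro (h1 | h1); exacts [absurd h1 (not_lt.2 htε), hex h1]),
    h.max_price htε]
  have h1 := h.m_le_sum_b ht
  have h2 : ∑ k with exitTime v B k ≤ t, (B k - drainedUntil v B k t) = 0 :=
    Finset.sum_eq_zero fun k hk => by
      rw [drainedUntil_of_not_draining h.B_pos hex (Finset.mem_filter.1 hk).2, sub_self]
  have h3 := h.sum_b ht
  rw [h2, add_zero] at h3
  rw [max_eq_left (h.m_pos ht).le, ← h3, max_eq_right (by linarith)]

theorem x_cont (k : Fin n) : ContinuousOn ((ofResidual v B ε f m g).x k) (Icc 0 f) :=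
  (h.g_cont k).add ((h.extracted_cont k).div (priceAt_cont.max continuous_const).continuousOn
    fun _ _ => (h.ε_pos.trans_le (le_max_right _ _)).ne')

theorem b_cont (k : Fin n) : ContinuousOn ((ofResidual v B ε f m g).b k) (Icc 0 f) :=
  (continuousOn_const.sub (h.extracted_cont k)).sub (drainedUntil_cont k).continuousOn

open Classical in
theorem b_deriv (ht : t ∈ Ico 0 f) (k : Fin n) : RightDeriv ((ofResidual v B ε f m g).b k)
    (- (if t < exitTime v B k ∧ m t ≤ B k then flowRate v B ε t (m t) else 0) -
      if Draining v B k t then 1 else 0) t :=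
  HasDerivWithinAt.fun_sub (HasDerivWithinAt.const_sub (B k) (h.extracted_deriv ht k))
    (drainedUntil_deriv h.B_pos k t)

/-- This makes the prescribed `m` the actual residual. After `ε`, the quotient of the right side by
the price has the same derivative as the supply, because `m` solves its equation. -/
theorem price_mul_S (ht : t ∈ Icc 0 f) : priceAt v B t * (ofResidual v B ε f m g).S t =
    ∑ k, (ofResidual v B ε f m g).b k t - m t := by
  classical
  have hinit : ∀ s ∈ Icc 0 ε, priceAt v B s * (ofResidual v B ε f m g).S s =
      ∑ k, (ofResidual v B ε f m g).b k s - m s := fun s hs => by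
    have h1 : ∀ k, (ofResidual v B ε f m g).b k s = B k := fun k => by
      simp [ofResidual, h.extracted_of_le_ε hs, h.drainedUntil_of_le_ε hs.2]
    simp [S, h.x_of_le_ε hs, h1, h.priceAt_of_le hs.2, h.m_of_le ⟨hs.1, hs.2.trans h.ε_le_f⟩ hs.2]
  rcases le_total t ε with htε | htε
  · exact hinit t ⟨ht.1, htε⟩
  have hsub : Icc ε t ⊆ Icc 0 f := Icc_subset_Icc h.ε_pos.le ht.2
  have key := eq_of_rightDeriv_zero (g := fun s =>
      (∑ k, (ofResidual v B ε f m g).b k s - m s) / priceAt v B s -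
        (1 - ∑ k, (ofResidual v B ε f m g).x k s)) htε
    (((((continuousOn_finsetSum _ fun k _ => h.b_cont k).sub h.m_cont).mono hsub).div
      priceAt_cont.continuousOn fun s hs => (h.price_pos hs.1).ne').sub
        (continuousOn_const.sub ((continuousOn_finsetSum _ fun k _ => h.x_cont k).mono hsub)))
    (fun s hs => by
      have hsf : s ∈ Ico 0 f := ⟨h.ε_pos.le.trans hs.1, hs.2.trans_le ht.2⟩
      have hp := h.price_pos hs.1
      have hd := HasDerivWithinAt.fun_sub (HasDerivWithinAt.fun_div (HasDerivWithinAt.fun_sub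
        (HasDerivWithinAt.fun_sum (u := Finset.univ) fun k _ => h.b_deriv hsf k)
          (h.m_deriv s hsf)) (priceAt_deriv h.B_pos s) hp.ne') (HasDerivWithinAt.const_sub 1
            (HasDerivWithinAt.fun_sum (u := Finset.univ) fun k _ => h.x_deriv hsf k))
      refine HasDerivWithinAt.congr_deriv hd ?_
      rw [Finset.sum_sub_distrib, sum_draining h.B_pos _ fun k _ => Finset.mem_univ k,
        Finset.sum_neg_distrib, ← Finset.sum_div]
      split_ifs with hex
      · rw [flowRate, if_pos (Or.inr hex)]
        field_simp
        ring
      · have := h.flowRate_eq hsf hs.1 hex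
        rw [eq_div_iff hp.ne'] at this
        field_simp
        linarith)
  have h0 := hinit ε ⟨h.ε_pos.le, le_rfl⟩
  have hp := h.price_pos htε
  have hpε := h.price_pos le_rfl
  simp only [S] at h0 ⊢
  rw [← h0, mul_div_cancel_left₀ _ hpε.ne', sub_self, sub_eq_zero, div_eq_iff hp.ne'] at key
  linarith

theorem residual_eq (ht : t ∈ Icc 0 f) : (ofResidual v B ε f m g).residual t = m t := by
  have := h.price_mul_S ht
  have h1 : (ofResidual v B ε f m g).residual t = ∑ k, (ofResidual v B ε f m g).b k t -
    priceAt v B t * (ofResidual v B ε f m g).S t := rfl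
  linarith

/-! ### The constructed trajectory obeys the rules of the auction. -/

theorem mem_E_iff (ht : t ∈ Ico 0 f) : k ∈ (ofResidual v B ε f m g).E v t ↔
    v k = priceAt v B t ∧ drainedUntil v B k t < B k := by
  rw [mem_E]
  refine and_congr_right fun hk => ?_
  have hk' : v k = priceAt v B t := hk
  rw [h.b_of_ge (not_lt.1 fun h1 => ((priceAt_lt_iff h.B_pos).2 h1).ne' hk') ht.2, sub_pos]

theorem mem_E_of_draining (ht : t ∈ Ico 0 f) (hk : Draining v B k t) :
    k ∈ (ofResidual v B ε f m g).E v t := by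
  rw [h.mem_E_iff ht, drainedUntil_of_draining hk]
  exact ⟨(priceAt_of_draining h.B_pos hk).symm, by linarith [hk.2]⟩

theorem exists_draining_of_mem_E (ht : t ∈ Ico 0 f) (hk : k ∈ (ofResidual v B ε f m g).E v t) :
    ∃ j, Draining v B j t := by
  rw [h.mem_E_iff ht] at hk
  by_contra hno
  have := drainedUntil_of_not_draining (k := k) h.B_pos hno
    (not_lt.1 fun h1 => ((priceAt_lt_iff h.B_pos).2 h1).ne' hk.1)
  linarith [hk.2]

/-- Tied bidders are drained in the order of their indices, so the one being drained has the
smallest index among those with budget left. -/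
theorem isFirstExiting_iff (ht : t ∈ Ico 0 f) :
    (ofResidual v B ε f m g).IsFirstExiting v t k ↔ Draining v B k t := by
  have key : ∀ j k, Draining v B j t → k ∈ (ofResidual v B ε f m g).E v t → j ≤ k := by
    intro j k hj hk
    by_contra hlt
    rw [h.mem_E_iff ht] at hk
    have h1 := drainStart_add_le h.B_pos (v := v)
      (Or.inr ⟨hk.1.trans (priceAt_of_draining h.B_pos hj), not_le.1 hlt⟩)
    have := drainedUntil_of_ge h.B_pos (h1.trans hj.1)
    linarith [hk.2]
  constructor
  · rintro ⟨hk, hmin⟩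
    obtain ⟨j, hj⟩ := h.exists_draining_of_mem_E ht hk
    have : j = k := le_antisymm (key j k hj hk) (hmin j (h.mem_E_of_draining ht hj))
    exact this ▸ hj
  · exact fun hk => ⟨h.mem_E_of_draining ht hk, fun j hj => key k j hk hj⟩

theorem E_eq_empty_iff (ht : t ∈ Ico 0 f) :
    (ofResidual v B ε f m g).E v t = ∅ ↔ ¬ ∃ k, Draining v B k t := by
  rw [← Finset.not_nonempty_iff_eq_empty, not_iff_not]
  exact ⟨fun ⟨k, hk⟩ => h.exists_draining_of_mem_E ht hk,
    fun ⟨k, hk⟩ => ⟨k, h.mem_E_of_draining ht hk⟩⟩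

theorem mem_C_iff (ht : t ∈ Ico 0 f) : k ∈ (ofResidual v B ε f m g).C v t ↔
    t < exitTime v B k ∧ m t ≤ B k := by
  rw [mem_C, h.residual_eq ⟨ht.1, ht.2.le⟩]
  have hp : (ofResidual v B ε f m g).p t < v k ↔ t < exitTime v B k := priceAt_lt_iff h.B_pos
  rw [hp, and_assoc]
  refine and_congr_right fun h1 => ?_
  rw [h.b_of_lt h1]
  constructor
  · rintro ⟨-, h2⟩
    exact min_eq_right_iff.1 h2
  · intro h2
    rw [min_eq_right h2]
    exact ⟨h.m_pos ht, rfl⟩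

theorem rate_eq (ht : t ∈ Ico 0 f) :
    (ofResidual v B ε f m g).rate v t = flowRate v B ε t (m t) := by
  unfold rate
  have hS := h.price_mul_S ⟨ht.1, ht.2.le⟩
  split_ifs with hE <;> rw [h.E_eq_empty_iff ht] at hE
  · rcases lt_or_ge t ε with h1 | h1
    · rw [flowRate, if_pos (Or.inl h1)]
      simp [S, h.x_of_le_ε ⟨ht.1, h1.le⟩]
    · rw [h.flowRate_eq ht h1 hE, ← hS, mul_div_cancel_left₀ _ (h.price_pos h1).ne']
  · rw [flowRate, if_pos (Or.inr (not_not.1 hE))]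

theorem not_stops (ht : t ∈ Ico 0 f) : ¬ (ofResidual v B ε f m g).Stops v t := by
  have hA : (ofResidual v B ε f m g).A v t =
      Finset.univ.filter fun k => t < exitTime v B k := by
    ext k
    have hp : (ofResidual v B ε f m g).p t < v k ↔ t < exitTime v B k := priceAt_lt_iff h.B_pos
    simp only [mem_A, hp, Finset.mem_filter, Finset.mem_univ, true_and, and_iff_left_iff_imp]
    intro h1
    rw [h.b_of_lt h1]
    exact lt_min (h.B_pos k) (h.m_pos ht)
  have hS : (ofResidual v B ε f m g).p t * (ofResidual v B ε f m g).S t = _ :=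
    h.price_mul_S ⟨ht.1, ht.2.le⟩
  rw [Stops, hA, not_le, hS, h.sum_b ht,
    Finset.sum_congr rfl fun k hk => h.b_of_lt (Finset.mem_filter.1 hk).2]
  have := h.sum_exited_lt h.not_stops_before ht
  linarith

theorem b_f_of_ge (hk : f ≤ exitTime v B k) :
    (ofResidual v B ε f m g).b k f = min (B k) (m f) := by
  simp only [ofResidual]
  rw [extracted_of_le hk, drainedUntil_of_le (hk.trans (exitTime_le_drainStart h.B_pos k))]
  ring

theorem b_f_nonneg (k : Fin n) : 0 ≤ (ofResidual v B ε f m g).b k f := by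
  rcases le_or_gt f (exitTime v B k) with h1 | h1
  · rw [h.b_f_of_ge h1]
    exact le_min (h.B_pos k).le h.m_f_nonneg
  · simp only [ofResidual]
    rw [h.extracted_of_ge h1.le h1, sub_zero]
    exact sub_nonneg.2 (drainedUntil_le h.B_pos k f)

theorem stops : (ofResidual v B ε f m g).Stops v f := by
  have hS : (ofResidual v B ε f m g).p f * (ofResidual v B ε f m g).S f = _ :=
    h.price_mul_S ⟨h.f_pos.le, le_rfl⟩
  rw [Stops, hS]
  obtain ⟨k, hk, hm⟩ := h.stops_at_end
  have h1 : m f ≤ ∑ j with v j = v k, (ofResidual v B ε f m g).b j f := by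
    have h2 : ∀ j, v j = v k → (ofResidual v B ε f m g).b j f = min (B j) (m f) := fun j hj =>
      h.b_f_of_ge (hk ▸ exitTime_le_of_le h.B_pos hj.ge)
    -- Either some tied bidder is capped and alone holds `m f`, or all tied bidders still have their
    -- reported budgets.
    by_cases hex : ∃ j, v j = v k ∧ m f ≤ B j
    · obtain ⟨j, hj, hmj⟩ := hex
      rw [← min_eq_right hmj, ← h2 j hj]
      exact Finset.single_le_sum (f := fun j => (ofResidual v B ε f m g).b j f)
        (fun j _ => h.b_f_nonneg j) (by simpa using hj)
    · refine hm.trans (Finset.sum_le_sum fun j hj => ?_)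
      have hj := (Finset.mem_filter.1 hj).2
      rw [h2 j hj, min_eq_left (not_lt.1 fun hlt => hex ⟨j, hj, hlt.le⟩)]
  have h3 : ∑ j ∈ (ofResidual v B ε f m g).A v f, (ofResidual v B ε f m g).b j f +
      ∑ j with v j = v k, (ofResidual v B ε f m g).b j f ≤
        ∑ j, (ofResidual v B ε f m g).b j f := by
    rw [← Finset.sum_union]
    · exact Finset.sum_le_sum_of_subset_of_nonneg (Finset.subset_univ _)
        fun j _ _ => h.b_f_nonneg j
    · refine Finset.disjoint_left.2 fun j hA hj => ?_
      have hj := (Finset.mem_filter.1 hj).2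
      have h4 : priceAt v B f < v j := (mem_A.1 hA).1
      rw [priceAt_lt_iff h.B_pos, ← hk] at h4
      exact absurd (exitTime_le_of_le h.B_pos hj.le) (not_le.2 h4)
  linarith

theorem isClinching : (ofResidual v B ε f m g).IsClinching v B := by
  classical
  have h0 : (0 : ℝ) ∈ Icc 0 ε := ⟨le_rfl, h.ε_pos.le⟩
  exact
  { f_nonneg := h.f_pos.le
    p_zero := h.priceAt_of_le h.ε_pos.le
    x_zero := h.x_of_le_ε h0
    P_zero := h.extracted_of_le_ε h0
    b_zero := fun k => by
      simp [ofResidual, h.extracted_of_le_ε h0, h.drainedUntil_of_le_ε h.ε_pos.le]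
    p_cont := priceAt_cont.continuousOn
    x_cont := h.x_cont
    P_cont := h.extracted_cont
    b_cont := h.b_cont
    not_stops := fun t ht => h.not_stops ht
    stops := h.stops
    p_deriv := fun t ht => by
      refine HasDerivWithinAt.congr_deriv (priceAt_deriv h.B_pos t) ?_
      simp only [h.E_eq_empty_iff ht, ite_not]
    P_deriv := fun t ht k => by
      simp only [h.mem_C_iff ht, h.rate_eq ht]
      exact h.extracted_deriv ht k
    x_deriv := fun t ht k => by
      refine HasDerivWithinAt.congr_deriv (h.x_deriv ht k) ?_
      simp only [h.mem_C_iff ht, h.rate_eq ht, ite_div, zero_div]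
      rfl
    b_deriv := fun t ht k => by
      refine HasDerivWithinAt.congr_deriv (h.b_deriv ht k) ?_
      simp only [h.mem_C_iff ht, h.rate_eq ht, h.isFirstExiting_iff ht]
      by_cases h1 : t < exitTime v B k ∧ m t ≤ B k
      · rw [if_pos h1, if_pos h1, if_neg fun hd => ?_, sub_zero]
        exact absurd (hd.1.trans_lt h1.1) (not_lt.2 (exitTime_le_drainStart h.B_pos k))
      · rw [if_neg h1, if_neg h1]
        split_ifs <;> simp }

end IsAuctionPath

/-- The auction has a trajectory on all admissible reports. -/
theorem exists_isRun (hn : 2 ≤ n) (h : Admissible v B) : ∃ r : Trajectory n, r.IsRun v B := by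
  obtain ⟨ε, f, m, g, hp⟩ := exists_isAuctionPath hn h
  exact ⟨_, hp.isClinching, hn, h⟩

/-- The rest of the supply can be divided at the stopping time. -/
theorem IsRun.exists_isFinalAllocation {r : Trajectory n} (h : r.IsRun v B) :
    ∃ y, r.IsFinalAllocation v y := by
  have hp := h.p_f_pos
  have hdisj : ∀ k, k ∈ r.E v r.f → k ∉ r.A v r.f := fun k hE hA =>
    (mem_A.1 hA).1.ne' (mem_E.1 hE).1
  -- the demand of the exiting bidders and the remaining supply, in units of money
  set e := ∑ k ∈ r.E v r.f, r.b k r.f with he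
  set q := r.p r.f * r.S r.f - ∑ k ∈ r.A v r.f, r.b k r.f with hq
  have he' : ∑ k with v k ≤ r.p r.f, r.b k r.f = e := by
    rw [h.sum_exiting_eq h.f_mem]
    symm
    refine Finset.sum_subset (fun k hk => by simpa using (mem_E.1 hk).1) fun k hk hk' => ?_
    refine le_antisymm (not_lt.1 fun hb => hk' (mem_E.2 ⟨?_, hb⟩)) (h.b_nonneg h.f_mem k)
    simpa using hk
  have hq0 : 0 ≤ q := by
    have := h.stops
    rw [Stops] at this
    linarith
  have hqe : q ≤ e := by
    have h1 := h.sum_b_eq h.f_mem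
    have h2 := h.residual_nonneg h.f_mem
    unfold residual at h2
    linarith
  -- All exiting bidders receive the same fraction `c` of their demand; if `e = 0`, then `q = 0` as
  -- well.
  obtain ⟨c, hc0, hc1, hce⟩ : ∃ c, 0 ≤ c ∧ c ≤ 1 ∧ c * e = q := by
    rcases eq_or_lt_of_le (hq0.trans hqe) with h0 | h0
    · exact ⟨0, le_rfl, zero_le_one, by linarith⟩
    · exact ⟨q / e, div_nonneg hq0 h0.le, (div_le_one h0).2 hqe, div_mul_cancel₀ _ h0.ne'⟩
  refine ⟨fun k => if k ∈ r.A v r.f then r.b k r.f / r.p r.f else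
    if k ∈ r.E v r.f then c * r.b k r.f / r.p r.f else 0, ?_, ?_, ?_, ?_, ?_⟩
  · intro k
    have hb := h.b_nonneg h.f_mem k
    split_ifs
    · positivity
    · positivity
    · exact le_rfl
  · intro k
    have hb := h.b_nonneg h.f_mem k
    split_ifs
    · rw [mul_div_cancel₀ _ hp.ne']
    · rw [mul_div_cancel₀ _ hp.ne']
      exact mul_le_of_le_one_left hb hc1
    · simpa using hb
  · intro k hA hE
    simp [hA, hE]
  · exact Finset.sum_congr rfl fun k hk => if_pos hk
  · rw [Finset.sum_congr rfl fun k hk => (if_neg (hdisj k hk)).trans (if_pos hk),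
      ← Finset.sum_div, ← Finset.mul_sum, ← he, hce, hq, ← Finset.sum_div]
    field_simp

end Trajectory

/-! ### Randomized extraction -/

section Randomized

variable {n : ℕ} {μ : PMF (Outcome n)} {i : Fin n} {b q : ℝ}

/-- If `b` and `0` have total probability one, then no other price is charged. -/
theorem payment_mem_of_two_point (hq0 : 0 ≤ q) (hq1 : q ≤ 1) (hb : b ≠ 0)
    (hμb : μ.map (fun ω => ω.P i) b = ENNReal.ofReal q)
    (hμ0 : μ.map (fun ω => ω.P i) 0 = ENNReal.ofReal (1 - q)) {ω : Outcome n}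
    (hω : ω ∈ μ.support) : (ω.P i = b ∧ 0 < q) ∨ (ω.P i = 0 ∧ q < 1) := by
  classical
  have hmem : ω.P i ∈ (μ.map fun ω => ω.P i).support := by
    rw [PMF.mem_support_map_iff]
    exact ⟨ω, hω, rfl⟩
  rw [PMF.mem_support_iff] at hmem
  by_cases h1 : ω.P i = b
  · rw [h1, hμb] at hmem
    exact Or.inl ⟨h1, by simpa using hmem⟩
  by_cases h2 : ω.P i = 0
  · rw [h2, hμ0] at hmem
    exact Or.inr ⟨h2, by simpa using hmem⟩
  exfalso
  -- A third value would carry mass on top of a total of one.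
  have h3 : ∑ c ∈ ({b, 0, ω.P i} : Finset ℝ), (μ.map fun ω => ω.P i) c ≤ 1 :=
    (ENNReal.sum_le_tsum _).trans_eq (PMF.tsum_coe _)
  rw [Finset.sum_insert (by simp [hb, Ne.symm h1]), Finset.sum_insert (by simp [Ne.symm h2]),
    Finset.sum_singleton, hμb, hμ0, ← add_assoc, ← ENNReal.ofReal_add hq0 (by linarith),
    add_sub_cancel, ENNReal.ofReal_one] at h3
  have h4 : (1 : ENNReal) + (μ.map fun ω => ω.P i) (ω.P i) ≤ 1 + 0 := by simpa using h3
  exact hmem (le_antisymm ((ENNReal.add_le_add_iff_left ENNReal.one_ne_top).1 h4) zero_le)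

theorem tsum_of_two_point (hq0 : 0 ≤ q) (hq1 : q ≤ 1) (hb : b ≠ 0)
    (hμb : μ.map (fun ω => ω.P i) b = ENNReal.ofReal q)
    (hμ0 : μ.map (fun ω => ω.P i) 0 = ENNReal.ofReal (1 - q)) {g : Outcome n → ENNReal}
    {gb g0 : ENNReal} (hgb : ∀ ω ∈ μ.support, ω.P i = b → g ω = gb)
    (hg0 : ∀ ω ∈ μ.support, ω.P i = 0 → g ω = g0) :
    ∑' ω, μ ω * g ω = ENNReal.ofReal q * gb + ENNReal.ofReal (1 - q) * g0 := by
  classical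
  rw [← hμb, ← hμ0, PMF.map_apply, PMF.map_apply, ← ENNReal.tsum_mul_right,
    ← ENNReal.tsum_mul_right, ← ENNReal.tsum_add]
  refine tsum_congr fun ω => ?_
  by_cases hω : ω ∈ μ.support
  · rcases payment_mem_of_two_point hq0 hq1 hb hμb hμ0 hω with ⟨h1, -⟩ | ⟨h1, -⟩
    · rw [hgb ω hω h1, h1, if_pos rfl, if_neg hb.symm, zero_mul, add_zero]
    · rw [hg0 ω hω h1, h1, if_pos rfl, if_neg hb, zero_mul, zero_add]
  · have : μ ω = 0 := by simpa [PMF.mem_support_iff] using hω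
    simp [this]

/-- The expected utility of a bidder who is never charged more than her budget. -/
theorem expectation_of_two_point (hq0 : 0 ≤ q) (hq1 : q ≤ 1) (hb : 0 < b)
    (hμb : μ.map (fun ω => ω.P i) b = ENNReal.ofReal q)
    (hμ0 : μ.map (fun ω => ω.P i) 0 = ENNReal.ofReal (1 - q)) {X η β : ℝ} (hβ0 : 0 ≤ β)
    (hX : ∀ ω ∈ μ.support, ω.X i = X) (hβ : b ≤ β ∨ q = 0) :
    expectation μ (utility η β i) = ((η * X - q * b : ℝ) : EReal) := by
  have hub : ∀ ω ∈ μ.support, ω.P i = b → utility η β i ω = ((η * X - b : ℝ) : EReal) := by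
    intro ω hω hP
    rcases payment_mem_of_two_point hq0 hq1 hb.ne' hμb hμ0 hω with ⟨-, h1⟩ | ⟨h1, -⟩
    · rw [utility, hP, hX ω hω, if_neg]
      rcases hβ with h2 | h2
      · exact not_lt.2 h2
      · exact absurd h2 h1.ne'
    · exact absurd (hP ▸ h1) hb.ne'
  have hu0 : ∀ ω ∈ μ.support, ω.P i = 0 → utility η β i ω = ((η * X : ℝ) : EReal) := by
    intro ω hω hP
    rw [utility, hP, hX ω hω, if_neg (not_lt.2 hβ0), sub_zero]
  unfold expectation
  rw [tsum_of_two_point hq0 hq1 hb.ne' hμb hμ0 (gb := ENNReal.ofReal (η * X - b))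
      (g0 := ENNReal.ofReal (η * X)) (fun ω hω hP => by rw [hub ω hω hP, EReal.real_coe_toENNReal])
      (fun ω hω hP => by rw [hu0 ω hω hP, EReal.real_coe_toENNReal]),
    tsum_of_two_point hq0 hq1 hb.ne' hμb hμ0 (gb := ENNReal.ofReal (-(η * X - b)))
      (g0 := ENNReal.ofReal (-(η * X)))
      (fun ω hω hP => by rw [hub ω hω hP, ← EReal.coe_neg, EReal.real_coe_toENNReal])
      (fun ω hω hP => by rw [hu0 ω hω hP, ← EReal.coe_neg, EReal.real_coe_toENNReal])]
  simp only [EReal.coe_ennreal_add, EReal.coe_ennreal_mul, EReal.coe_ennreal_ofReal]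
  rw [max_eq_left hq0, max_eq_left (sub_nonneg.2 hq1)]
  norm_cast
  have h1 := max_zero_sub_max_neg_zero_eq_self (η * X - b)
  have h2 := max_zero_sub_max_neg_zero_eq_self (η * X)
  linear_combination q * h1 + (1 - q) * h2

/-- A bidder who is charged more than her budget with positive probability has expected utility
`-∞`. -/
theorem expectation_of_two_point_of_lt (hq0 : 0 < q) (hq1 : q ≤ 1) (hb : 0 < b)
    (hμb : μ.map (fun ω => ω.P i) b = ENNReal.ofReal q)
    (hμ0 : μ.map (fun ω => ω.P i) 0 = ENNReal.ofReal (1 - q)) {X η β : ℝ} (hβ0 : 0 ≤ β)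
    (hX : ∀ ω ∈ μ.support, ω.X i = X) (hβ : β < b) :
    expectation μ (utility η β i) = ⊥ := by
  have hub : ∀ ω ∈ μ.support, ω.P i = b → utility η β i ω = ⊥ := fun ω _ hP => by
    rw [utility, hP, if_pos hβ]
  have hu0 : ∀ ω ∈ μ.support, ω.P i = 0 → utility η β i ω = ((η * X : ℝ) : EReal) := by
    intro ω hω hP
    rw [utility, hP, hX ω hω, if_neg (not_lt.2 hβ0), sub_zero]
  unfold expectation
  -- An infinite negative part gives `⊥` whatever the positive part is.
  rw [tsum_of_two_point (g := fun ω => (-(utility η β i ω)).toENNReal) hq0.le hq1 hb.ne' hμb hμ0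
      (gb := ⊤) (g0 := ENNReal.ofReal (-(η * X)))
      (fun ω hω hP => by rw [hub ω hω hP, EReal.neg_bot, EReal.toENNReal_top])
      (fun ω hω hP => by rw [hu0 ω hω hP, ← EReal.coe_neg, EReal.real_coe_toENNReal]),
    ENNReal.mul_top (by simpa using hq0), top_add, EReal.coe_ennreal_top, EReal.sub_top]

/-- Probability laws have a joint law. -/
theorem exists_joint_law {ι α : Type*} [DecidableEq ι] [Nonempty α] (ν : ι → PMF α)
    (s : Finset ι) : ∃ μ : PMF (ι → α), ∀ i ∈ s, μ.map (fun g => g i) = ν i := by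
  induction s using Finset.induction_on with
  | empty => exact ⟨PMF.pure fun _ => Classical.arbitrary α, by simp⟩
  | insert a s ha ih =>
    obtain ⟨μ, hμ⟩ := ih
    -- Coordinate `a` is overwritten by an independent draw, which leaves the marginals in `s`
    -- unchanged.
    refine ⟨μ.bind fun g => (ν a).map (Function.update g a), fun i hi => ?_⟩
    rw [PMF.map_bind]
    simp only [PMF.map_comp]
    by_cases hia : i = a
    · subst hia
      have : ∀ g : ι → α, (fun g : ι → α => g i) ∘ Function.update g i = id := fun g => by
        ext x; simp
      simp only [this, PMF.map_id, PMF.bind_const]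
    · have : ∀ g : ι → α, (fun g : ι → α => g i) ∘ Function.update g a =
          Function.const α (g i) := fun g => by
        ext x; simp [hia]
      simp only [this, PMF.map_const]
      rw [← hμ i ((Finset.mem_insert.1 hi).resolve_left hia)]
      exact PMF.bind_pure_comp (fun g : ι → α => g i) μ

theorem exists_two_point_law (hq0 : 0 ≤ q) (hq1 : q ≤ 1) (hb : b ≠ 0) :
    ∃ ν : PMF ℝ, ν b = ENNReal.ofReal q ∧ ν 0 = ENNReal.ofReal (1 - q) := by
  refine ⟨PMF.ofFinset (fun c => if c = b then ENNReal.ofReal q else if c = 0 then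
    ENNReal.ofReal (1 - q) else 0) {b, 0} ?_ ?_, ?_, ?_⟩
  · rw [Finset.sum_insert (by simpa using hb), Finset.sum_singleton, if_pos rfl, if_neg hb.symm,
      if_pos rfl, ← ENNReal.ofReal_add hq0 (by linarith), add_sub_cancel, ENNReal.ofReal_one]
  · intro c hc
    simp only [Finset.mem_insert, Finset.mem_singleton, not_or] at hc
    rw [if_neg hc.1, if_neg hc.2]
  · simp
  · simp [hb.symm]

end Randomized

/-! ### Properties of the adaptive clinching auction -/

section Auction

open Trajectory

variable {n : ℕ} {v B v' B' : Fin n → ℝ} {ω ω' : Outcome n}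

theorem exists_isAdaptiveClinching (hn : 2 ≤ n) : ∃ M : DetMechanism n, IsAdaptiveClinching M := by
  classical
  have key : ∀ v B : Fin n → ℝ, Admissible v B → ∃ ω, IsClinchingOutcome v B ω := fun v B h => by
    obtain ⟨r, hr⟩ := exists_isRun hn h
    obtain ⟨y, hy⟩ := hr.exists_isFinalAllocation
    exact ⟨⟨fun i => r.x i r.f + y i, fun i => r.P i r.f + r.p r.f * y i⟩, r, y,
      hr.toIsClinching, hy, fun _ => rfl, fun _ => rfl⟩
  refine ⟨fun v B => if h : Admissible v B then (key v B h).choose else ⟨0, 0⟩, fun v B h => ?_⟩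
  simp only [dif_pos h]
  exact (key v B h).choose_spec

namespace IsClinchingOutcome

variable (h : IsClinchingOutcome v B ω) (hn : 2 ≤ n) (hadm : Admissible v B)
include h hn hadm

theorem exists_isRun : ∃ (r : Trajectory n) (y : Fin n → ℝ), r.IsRun v B ∧
    r.IsFinalAllocation v y ∧ (∀ i, ω.X i = r.x i r.f + y i) ∧
      ∀ i, ω.P i = r.P i r.f + r.p r.f * y i := by
  obtain ⟨r, y, hr, hy, hX, hP⟩ := h
  exact ⟨r, y, ⟨hr, hn, hadm⟩, hy, hX, hP⟩

theorem payment_nonneg (i : Fin n) : 0 ≤ ω.P i := by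
  obtain ⟨r, y, hr, hy, -, hP⟩ := h.exists_isRun hn hadm
  rw [hP]
  exact hr.payment_nonneg hy i

theorem payment_le (i : Fin n) : ω.P i ≤ B i := by
  obtain ⟨r, y, hr, hy, -, hP⟩ := h.exists_isRun hn hadm
  rw [hP]
  exact hr.payment_le hy i

theorem quantity_nonneg (i : Fin n) : 0 ≤ ω.X i := by
  obtain ⟨r, y, hr, hy, hX, -⟩ := h.exists_isRun hn hadm
  rw [hX]
  exact hr.total_nonneg hy i

theorem sum_quantity : ∑ i, ω.X i = 1 := by
  obtain ⟨r, y, hr, hy, hX, -⟩ := h.exists_isRun hn hadm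
  simp only [hX]
  exact IsRun.sum_total hy

theorem payment_eq_of_higher {i j : Fin n} (hi : 0 < ω.X i) (hij : v i < v j) : ω.P j = B j := by
  obtain ⟨r, y, hr, hy, hX, hP⟩ := h.exists_isRun hn hadm
  rw [hP]
  exact hr.payment_eq_of_higher hy (hX i ▸ hi) hij

theorem quantity_eq_zero {i : Fin n} (hi : ω.P i = 0) : ω.X i = 0 := by
  obtain ⟨r, y, hr, hy, hX, hP⟩ := h.exists_isRun hn hadm
  rw [hX]
  exact hr.total_eq_zero_of_payment hy (hP i ▸ hi)

theorem surplus_nonneg (i : Fin n) : 0 ≤ v i * ω.X i - ω.P i := by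
  obtain ⟨r, y, hr, hy, hX, hP⟩ := h.exists_isRun hn hadm
  rw [hX, hP]
  exact hr.surplus_nonneg hy i

theorem surplus_le_surplus (h' : IsClinchingOutcome v' B' ω') (hadm' : Admissible v' B')
    {i : Fin n} (hv : ∀ k, k ≠ i → v k = v' k) (hB : ∀ k, k ≠ i → B k = B' k)
    (hBi : B' i ≤ B i) : v i * ω'.X i - ω'.P i ≤ v i * ω.X i - ω.P i := by
  obtain ⟨r, y, hr, hy, hX, hP⟩ := h.exists_isRun hn hadm
  obtain ⟨r', y', hr', hy', hX', hP'⟩ := h'.exists_isRun hn hadm'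
  rw [hX, hP, hX', hP']
  exact hr.surplus_le_surplus hr' hv hB hBi hy hy'

end IsClinchingOutcome

theorem exists_isRandomizedExtraction (hn : 2 ≤ n) {M : DetMechanism n}
    (hM : IsAdaptiveClinching M) : ∃ R : RandMechanism n, IsRandomizedExtraction M R := by
  classical
  have key : ∀ v B : Fin n → ℝ, Admissible v B → ∃ μ : PMF (Outcome n),
      (∀ ω ∈ μ.support, ω.X = (M v B).X) ∧
      ∀ i, μ.map (fun ω => ω.P i) (B i) = ENNReal.ofReal ((M v B).P i / B i) ∧
        μ.map (fun ω => ω.P i) 0 = ENNReal.ofReal (1 - (M v B).P i / B i) := by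
    intro v B hadm
    have hω := hM v B hadm
    choose ν hν using fun i => exists_two_point_law (b := B i) (q := (M v B).P i / B i)
      (div_nonneg (hω.payment_nonneg hn hadm i) (hadm.2 i).le)
      ((div_le_one (hadm.2 i)).2 (hω.payment_le hn hadm i)) (hadm.2 i).ne'
    obtain ⟨μ, hμ⟩ := exists_joint_law ν Finset.univ
    refine ⟨μ.map fun P => ⟨(M v B).X, P⟩, fun ω hω => ?_, fun i => ?_⟩
    · obtain ⟨P, -, rfl⟩ := (PMF.mem_support_map_iff _ _ _).1 hω
      rfl
    · have : (μ.map fun P => (⟨(M v B).X, P⟩ : Outcome n)).map (fun ω => ω.P i) = ν i := by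
        rw [PMF.map_comp]
        exact hμ i (Finset.mem_univ i)
      rw [this]
      exact hν i
  refine ⟨fun v B => if h : Admissible v B then (key v B h).choose else PMF.pure ⟨0, 0⟩,
    fun v B h => ?_⟩
  simp only [dif_pos h]
  exact (key v B h).choose_spec

namespace IsRandomizedExtraction

variable {M : DetMechanism n} {R : RandMechanism n} (hR : IsRandomizedExtraction M R)
  (hM : IsAdaptiveClinching M) (hn : 2 ≤ n)
include hR hM hn

theorem payment_mem (hadm : Admissible v B) (hω : ω ∈ (R v B).support) (i : Fin n) :
    (ω.P i = B i ∧ 0 < (M v B).P i) ∨ (ω.P i = 0 ∧ (M v B).P i < B i) := by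
  have hc := hM v B hadm
  have hB := hadm.2 i
  have := payment_mem_of_two_point (div_nonneg (hc.payment_nonneg hn hadm i) hB.le)
    ((div_le_one hB).2 (hc.payment_le hn hadm i)) hB.ne' ((hR v B hadm).2 i).1
    ((hR v B hadm).2 i).2 hω
  rwa [div_pos_iff_of_pos_right hB, div_lt_one hB] at this

theorem isFeasible : IsFeasible R := fun v B hadm ω hω => by
  rw [(hR v B hadm).1 ω hω]
  exact ⟨(hM v B hadm).quantity_nonneg hn hadm, ((hM v B hadm).sum_quantity hn hadm).le⟩

theorem noPositiveTransfers : NoPositiveTransfers R := fun v B hadm ω hω i => by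
  rcases hR.payment_mem hM hn hadm hω i with ⟨h, -⟩ | ⟨h, -⟩
  · exact h ▸ (hadm.2 i).le
  · exact h.ge

/-- A bidder who exhausts her budget in the deterministic auction is charged it with probability
one. -/
theorem paretoOptimalExPost : ParetoOptimalExPost R := fun v B hadm ω hω => by
  have hc := hM v B hadm
  rw [(hR v B hadm).1 ω hω]
  refine ⟨hc.sum_quantity hn hadm, fun i j hi hij => ?_⟩
  have hP := hc.payment_eq_of_higher hn hadm hi hij
  rcases hR.payment_mem hM hn hadm hω j with ⟨h, -⟩ | ⟨-, h⟩
  · exact h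
  · exact absurd hP h.ne

/-- The expected utility in the randomized auction is the utility in the deterministic one, if the
reported budget is at most the true one or nothing is paid. -/
theorem expectation_eq (hadm : Admissible v B) {i : Fin n} {η β : ℝ} (hβ0 : 0 ≤ β)
    (hβ : B i ≤ β ∨ (M v B).P i = 0) : expectation (R v B) (utility η β i) =
      ((η * (M v B).X i - (M v B).P i : ℝ) : EReal) := by
  have hc := hM v B hadm
  have hB := hadm.2 i
  rw [expectation_of_two_point (div_nonneg (hc.payment_nonneg hn hadm i) hB.le)
    ((div_le_one hB).2 (hc.payment_le hn hadm i)) hB ((hR v B hadm).2 i).1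
    ((hR v B hadm).2 i).2 hβ0 (fun ω hω => by rw [(hR v B hadm).1 ω hω])
    (hβ.imp_right fun h => by rw [h, zero_div]), div_mul_cancel₀ _ hB.ne']

theorem voluntaryParticipation : VoluntaryParticipation R := fun v B hadm i => by
  rw [hR.expectation_eq hM hn hadm (hadm.2 i).le (Or.inl le_rfl)]
  exact_mod_cast (hM v B hadm).surplus_nonneg hn hadm i

theorem incentiveCompatible : IncentiveCompatible R := fun v B hadm i v' B' hv' hB' => by
  have hadm' : Admissible (Function.update v i v') (Function.update B i B') := by
    constructor <;> intro k <;> rcases eq_or_ne k i with rfl | hk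
    · simpa using hv'
    · simpa [hk] using hadm.1 k
    · simpa using hB'
    · simpa [hk] using hadm.2 k
  have hc := hM v B hadm
  have hc' := hM _ _ hadm'
  have hβ := hadm.2 i
  rw [hR.expectation_eq hM hn hadm hβ.le (Or.inl le_rfl)]
  rcases le_or_gt B' (B i) with hle | hlt
  · rw [hR.expectation_eq hM hn hadm' hβ.le (Or.inl (by simpa using hle))]
    exact_mod_cast hc.surplus_le_surplus hn hadm hc' hadm'
      (fun k hk => (Function.update_of_ne hk _ _).symm)
      (fun k hk => (Function.update_of_ne hk _ _).symm) (by simpa using hle)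
  -- For a budget reported above the true one, a positive payment means a charge beyond the true
  -- budget with positive probability. A zero payment comes with zero quantity, and truth yields at
  -- least zero.
  rcases eq_or_lt_of_le (hc'.payment_nonneg hn hadm' i) with h0 | h0
  · rw [hR.expectation_eq hM hn hadm' hβ.le (Or.inr h0.symm), hc'.quantity_eq_zero hn hadm' h0.symm,
      ← h0]
    have := hc.surplus_nonneg hn hadm i
    rw [mul_zero, sub_zero]
    exact_mod_cast this
  · have hBi := hadm'.2 i
    rw [expectation_of_two_point_of_lt (div_pos h0 hBi)
      ((div_le_one hBi).2 (hc'.payment_le hn hadm' i)) hBi ((hR _ _ hadm').2 i).1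
      ((hR _ _ hadm').2 i).2 hβ.le (fun ω hω => by rw [(hR _ _ hadm').1 ω hω])
      (by simpa using hlt)]
    exact bot_le

end IsRandomizedExtraction

end Auction

theorem theorem4 (n : ℕ) (hn : 2 ≤ n) :
    (∃ M : DetMechanism n, IsAdaptiveClinching M) ∧
    ∀ M : DetMechanism n, IsAdaptiveClinching M →
      (∃ R : RandMechanism n, IsRandomizedExtraction M R) ∧
      ∀ R : RandMechanism n, IsRandomizedExtraction M R →
        IsFeasible R ∧ NoPositiveTransfers R ∧ ParetoOptimalExPost R ∧
        VoluntaryParticipation R ∧ IncentiveCompatible R :=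
  ⟨exists_isAdaptiveClinching hn, fun _ hM => ⟨exists_isRandomizedExtraction hn hM, fun _ hR =>
    ⟨hR.isFeasible hM hn, hR.noPositiveTransfers hM hn, hR.paretoOptimalExPost hM hn,
      hR.voluntaryParticipation hM hn, hR.incentiveCompatible hM hn⟩⟩⟩
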